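/- Let $l^1$, $l^\infty$ be the complex sequence spaces indexed by $\mathbb N$, with $(l^1)^*$ identified with $l^\infty$. For a complex Banach space $X$ and $T\in L(X)$, let $T^*\in L(X^*)$ be the adjoint, $\sigma(T)$ the spectrum, $r(T)$ the spectral radius, and $\sigma_a(T)$ the approximate point spectrum, i.e. the set of $\lambda\in\mathbb C$ for which there are unit vectors $x_n\in X$ with $(T-\lambda)x_n\to 0$. Call $T$ *$J$-class* if there is $x\neq 0$ in $X$ such that for every $y\in X$ there are a strictly increasing sequence $(k_n)$ of natural numbers and a sequence $(x_n)$ in $X$ with $x_n\to x$ and $T^{k_n}x_n\to y$. Call an operator weakly compact if the image of the closed unit ball is relatively weakly compact. For $r\ge 0$ put $K_r=\{z\in\mathbb C:|z|<r\}$ and $\overline{K_r}=\{z\in\mathbb C:|z|\le r\}$, and let $\overline{\mathbb D}=\overline{K_1}$. If $f$ is holomorphic on an open set containing $K_R$ with $R>r(T)$, then $f(T)=\sum_{n\ge0}a_nT^n$, where $\sum a_nz^n$ is the Taylor series of $f$ at $0$; the series converges in operator norm. **Theorem.** (i) Let $T=S^*+W\in L(l^\infty)$, where $S\in L(l^1)$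 and $W\in L(l^\infty)$ is weakly compact. Let $R>\max\{r(T),r(S^*)\}$ and let $f$ be holomorphic on a neighborhood of the open disc $K_R$. Then $f(T)$ is well defined, and it is $J$-class if and only if $$f(\sigma_a(T^*))\cap\overline{\mathbb D}=\emptyset\quad\text{and}\quad \overline{\mathbb D}\subseteq f\big(\sigma(T^*)\setminus\sigma_a(T^*)\big).$$ (ii) Let $w=(w_k)_{k\in\mathbb N}$ be a bounded sequence of positive real numbers and let $B_w$ be the weighted backward shift $B_w(x_1,x_2,x_3,\dots)=(w_1x_2,w_2x_3,\dots)$ on $l^\infty$. Then the limits $$r_1=\lim_{n\to\infty}\sup_{k\in\mathbb N}(w_kw_{k+1}\cdots w_{k+n-1})^{1/n},\qquad r_2=\lim_{n\to\infty}\inf_{k\in\mathbb N}(w_kw_{k+1}\cdots w_{k+n-1})^{1/n}$$ exist in $[0,\infty)$. If $f$ is holomorphic on an open neighborhood of the closed disc $\overline{K_{r_1}}$, then $f(B_w)$ is well defined, and it is $J$-class if and only if $$\overline{\mathbb D}\cap f\big(\overline{K_{r_1}}\setminus K_{r_2}\big)=\emptyset\quad\text{and}\quad\overline{\mathbb D}\subseteq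 f(K_{r_2}).$$ -/

import Mathlib

open Filter Topology
open scoped ENNReal NNReal

noncomputable section

namespace JClassOp

/-- The complex sequence space `l^1`. -/
abbrev L1 : Type := lp (fun _ : ℕ => ℂ) 1

/-- The complex sequence space `l^∞` with the supremum norm. -/
abbrev Linf : Type := lp (fun _ : ℕ => ℂ) ∞

section General

variable {E F : Type*} [NormedAddCommGroup E] [NormedSpace ℂ E]
  [NormedAddCommGroup F] [NormedSpace ℂ F]

/-- The `J`-set `J_T(x)`: all `y` for which there are a strictly increasing sequence `k` of natural
numbers and a sequence `u` of vectors with `u n → x` and `T ^ (k n) (u n) → y`. -/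
def jSet (T : E →L[ℂ] E) (x : E) : Set E :=
  {y | ∃ (k : ℕ → ℕ) (u : ℕ → E), StrictMono k ∧ Tendsto u atTop (𝓝 x) ∧
    Tendsto (fun n => (T ^ k n) (u n)) atTop (𝓝 y)}

/-- `T` is a `J`-class operator: `J_T(x)` is the whole space for some non-zero `x`. -/
def IsJClass (T : E →L[ℂ] E) : Prop :=
  ∃ x : E, x ≠ 0 ∧ jSet T x = Set.univ

/-- The Banach space adjoint `T^*`, acting on the norm dual by `φ ↦ φ ∘ T`. -/
def dualOp (T : E →L[ℂ] F) : StrongDual ℂ F →L[ℂ] StrongDual ℂ E :=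
  ContinuousLinearMap.precomp ℂ T

/-- The approximate point spectrum `σ_a(T)`. -/
def approxPointSpectrum (T : E →L[ℂ] E) : Set ℂ :=
  {c | ∃ u : ℕ → E, (∀ n, ‖u n‖ = 1) ∧ Tendsto (fun n => T (u n) - c • u n) atTop (𝓝 0)}

/-- `T` is weakly compact: the image of the closed unit ball is relatively weakly compact. -/
def IsWeaklyCompact (T : E →L[ℂ] F) : Prop :=
  IsCompact (closure (toWeakSpace ℂ F '' (T '' Metric.closedBall 0 1)))

/-- The `n`-th term `a_n T^n` of the series defining `f(T)`, where `∑ a_n z^n` is the Taylor series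
of `f` at the origin. -/
def calcTerm (f : ℂ → ℂ) (T : E →L[ℂ] E) (n : ℕ) : E →L[ℂ] E :=
  (iteratedDeriv n f 0 / (n.factorial : ℂ)) • T ^ n

/-- The operator `f(T) = ∑ a_n T^n` (convergence in operator norm), for `f` holomorphic on a disc
centred at the origin whose radius is larger than the spectral radius of `T`. -/
def funcCalc (f : ℂ → ℂ) (T : E →L[ℂ] E) : E →L[ℂ] E :=
  ∑' n, calcTerm f T n

end General

/-- The functional `x ↦ ∑ y_n x_n` on `l^1` defined by `y ∈ l^∞`. -/
def toDual : Linf →L[ℂ] StrongDual ℂ L1 :=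
  lp.dualPairing ∞ 1 (fun _ : ℕ => ContinuousLinearMap.mul ℂ ℂ) (K := 1) (fun _ => by simp)

theorem toDual_apply (y : Linf) (x : L1) : toDual y x = ∑' n, y n * x n := rfl

theorem norm_dual_single_le (φ : StrongDual ℂ L1) (n : ℕ) :
    ‖φ (lp.single 1 n (1 : ℂ))‖ ≤ ‖φ‖ := by
  have h := φ.le_opNorm (lp.single 1 n (1 : ℂ))
  rwa [lp.norm_single (by norm_num), norm_one, mul_one] at h

/-- The sequence `(φ(e_n))_n ∈ l^∞` of a functional `φ` on `l^1`. -/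
def ofDual : StrongDual ℂ L1 →L[ℂ] Linf :=
  LinearMap.mkContinuous
    { toFun := fun φ => ⟨fun n => φ (lp.single 1 n (1 : ℂ)),
        memℓp_infty ⟨‖φ‖, by rintro _ ⟨n, rfl⟩; exact norm_dual_single_le φ n⟩⟩
      map_add' := fun φ ψ => by ext n; rfl
      map_smul' := fun c φ => by ext n; rfl }
    1
    (fun φ => by
      rw [one_mul]
      exact lp.norm_le_of_forall_le (norm_nonneg _) (fun n => norm_dual_single_le φ n))

theorem ofDual_apply (φ : StrongDual ℂ L1) (n : ℕ) :
    ofDual φ n = φ (lp.single 1 n (1 : ℂ)) := rfl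

theorem toDual_single (y : Linf) (n : ℕ) : toDual y (lp.single 1 n (1 : ℂ)) = y n := by
  rw [toDual_apply, tsum_eq_single n]
  · rw [lp.single_apply_self, mul_one]
  · intro m hm
    rw [lp.single_apply_ne _ _ _ hm, mul_zero]

theorem ofDual_toDual (y : Linf) : ofDual (toDual y) = y := by
  ext n
  exact toDual_single y n

theorem toDual_ofDual (φ : StrongDual ℂ L1) : toDual (ofDual φ) = φ := by
  refine lp.ext_continuousLinearMap (by norm_num) fun n => ?_
  ext
  change toDual (ofDual φ) (lp.single 1 n (1 : ℂ)) = φ (lp.single 1 n (1 : ℂ))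
  rw [toDual_single, ofDual_apply]

/-- The usual identification of `l^∞` with the dual of `l^1`. -/
def dualEquiv : Linf ≃L[ℂ] StrongDual ℂ L1 :=
  ContinuousLinearEquiv.equivOfInverse toDual ofDual ofDual_toDual toDual_ofDual

/-- The adjoint `S^* ∈ L(l^∞)` of `S ∈ L(l^1)`, under the identification of the dual of `l^1` with
`l^∞`. -/
def adj (S : L1 →L[ℂ] L1) : Linf →L[ℂ] Linf :=
  (dualEquiv.symm : StrongDual ℂ L1 →L[ℂ] Linf) ∘L dualOp S ∘L
    (dualEquiv : Linf →L[ℂ] StrongDual ℂ L1)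

/-- The unilateral weighted backward shift `(x_0, x_1, …) ↦ (w_0 x_1, w_1 x_2, …)` on `l^∞`, for a
bounded weight sequence `w`. -/
def backwardShift (w : ℕ → ℝ) (hw : ∃ C, ∀ n, |w n| ≤ C) : Linf →L[ℂ] Linf :=
  have key : ∀ (C : ℝ), (∀ n, |w n| ≤ C) → ∀ (x : Linf) (n : ℕ),
      ‖(w n : ℂ) * x (n + 1)‖ ≤ C * ‖x‖ := fun C hC x n => by
    rw [norm_mul, Complex.norm_real, Real.norm_eq_abs]
    exact mul_le_mul (hC n) (lp.norm_apply_le_norm (by simp) x (n + 1)) (norm_nonneg _)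
      ((abs_nonneg _).trans (hC n))
  LinearMap.mkContinuous
    { toFun := fun x => ⟨fun n => (w n : ℂ) * x (n + 1),
        memℓp_infty ⟨hw.choose * ‖x‖, by
          rintro _ ⟨n, rfl⟩; exact key _ hw.choose_spec x n⟩⟩
      map_add' := fun x y => by
        ext n; exact mul_add _ _ _
      map_smul' := fun c x => by
        ext n; exact mul_left_comm _ _ _ }
    hw.choose
    (fun x => lp.norm_le_of_forall_le
      (mul_nonneg ((abs_nonneg _).trans (hw.choose_spec 0)) (norm_nonneg _))
      (fun n => key _ hw.choose_spec x n))

theorem backwardShift_apply (w : ℕ → ℝ) (hw : ∃ C, ∀ n, |w n| ≤ C) (x : Linf) (n : ℕ) :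
    backwardShift w hw x n = (w n : ℂ) * x (n + 1) := rfl

end JClassOp

end

/-! Suppose `A` is such that `A* - μ` is bounded below whenever it is injective. Then `A` is
`J`-class exactly when, for every `|μ| ≤ 1`, `A* - μ` is bounded below and `A - μ` has a kernel
(`isJClass_iff`). A `J`-class operator moves arbitrarily small vectors close to any target, so `A*`
has no eigenvalue in the closed disc. Lower bounds on the closed disc extend uniformly to a disc of
radius `ρ > 1` and force `‖(A*)^n φ‖ ≥ C ρ^n ‖φ‖` (`exists_pow_growth`). Dually, every `y` is nearly
`A^n u` with `‖u‖ ≤ ‖y‖ / (C ρ^n)`. A kernel vector `x` of `A` can then be perturbed by such `u` to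
reach any `y`. If instead some `A - μ` is injective, then `A*` is invertible, the growth of its
powers bounds all powers of `A` uniformly below, and no orbit started near `x ≠ 0` comes close to
`0`.

For `A = f(T)` the conditions are read off `T` through the mapping theorem for approximate point
spectra (`tendsto_funcCalc_sub`, `exists_of_not_boundedBelow_funcCalc`). The nontrivial inclusion
needs simultaneous approximate eigenvectors of commuting operators, which become honest kernel
vectors in the space of bounded sequences modulo null sequences (`exists_joint_approx`).

The hypothesis on `A` holds on `l^∞` because `f(T) - μ` is again an adjoint plus a weakly compact
operator, and for these an injective adjoint is bounded below (`boundedBelow_dualOp_of_injective`).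
On `l^1` inside the bidual this follows from Schur's theorem. Weak-star compactness then extends the
bound to all functionals with an error `‖φ ∘ W‖`. On a weak-star null sequence that error has
arbitrarily small terms, by Phillips' lemma and a Dunford-Pettis argument with ultrafilter limits
(`tendsto_apply_of_weakly_null`).

A backward shift is the adjoint of a forward shift, so only its spectral sets remain. For `|z| < r₂`
a right inverse settles the matter. For `r₂ ≤ |z| ≤ r₁`, a lower bound for `B_w* - z` would control
block sums of weight products by their end terms, which forces uniform geometric growth or decay and
puts `|z|` outside the annulus (`lt_or_lt_of_block_sum_le`). -/

noncomputable section
namespace JClassOp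

open BoundedContinuousFunction

/-! ### Operators bounded below and the approximate point spectrum. -/

section BoundedBelow

variable {E F : Type*} [NormedAddCommGroup E] [NormedSpace ℂ E]
  [NormedAddCommGroup F] [NormedSpace ℂ F]

/-- `L` is bounded below. -/
def BoundedBelow (L : E →L[ℂ] F) : Prop := ∃ c > 0, ∀ v, c * ‖v‖ ≤ ‖L v‖

theorem exists_unit_of_not_boundedBelow {L : E →L[ℂ] F} (h : ¬ BoundedBelow L) {ε : ℝ}
    (hε : 0 < ε) : ∃ v, ‖v‖ = 1 ∧ ‖L v‖ < ε := by
  simp only [BoundedBelow, not_exists, not_and, not_forall, not_le] at h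
  obtain ⟨v, hv⟩ := h ε hε
  have hv0 : ‖v‖ ≠ 0 := fun h0 => by
    rw [h0, mul_zero] at hv
    exact absurd hv (not_lt.2 (norm_nonneg _))
  have hpos : 0 < ‖v‖ := lt_of_le_of_ne (norm_nonneg _) hv0.symm
  refine ⟨((‖v‖⁻¹ : ℝ) : ℂ) • v, ?_, ?_⟩
  · rw [norm_smul, Complex.norm_real, norm_inv, norm_norm, inv_mul_cancel₀ hv0]
  · rw [map_smul, norm_smul, Complex.norm_real, norm_inv, norm_norm, inv_mul_lt_iff₀ hpos, mul_comm]
    exact hv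

theorem exists_seq_of_not_boundedBelow {L : E →L[ℂ] F} (h : ¬ BoundedBelow L) :
    ∃ v : ℕ → E, (∀ n, ‖v n‖ = 1) ∧ Tendsto (fun n => L (v n)) atTop (𝓝 0) := by
  choose v hv1 hv2 using fun n : ℕ =>
    exists_unit_of_not_boundedBelow h (Nat.one_div_pos_of_nat (α := ℝ) (n := n))
  exact ⟨v, hv1, squeeze_zero_norm (fun n => (hv2 n).le) tendsto_one_div_add_atTop_nhds_zero_nat⟩

theorem not_boundedBelow_of_seq {L : E →L[ℂ] F} {v : ℕ → E} (hv : ∀ n, ‖v n‖ = 1)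
    (hL : Tendsto (fun n => L (v n)) atTop (𝓝 0)) : ¬ BoundedBelow L := by
  rintro ⟨c, hc, h⟩
  have h1 := le_of_tendsto_of_tendsto' (tendsto_const_nhds (x := c)) hL.norm
    (fun n => by simpa [hv] using h (v n))
  rw [norm_zero] at h1
  exact absurd hc (not_lt.2 h1)

theorem mem_approxPointSpectrum_iff {T : E →L[ℂ] E} {c : ℂ} :
    c ∈ approxPointSpectrum T ↔ ¬ BoundedBelow (T - c • (1 : E →L[ℂ] E)) := by
  constructor
  · rintro ⟨u, hu, hT⟩
    exact not_boundedBelow_of_seq hu hT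
  · intro h
    obtain ⟨v, hv, hT⟩ := exists_seq_of_not_boundedBelow h
    exact ⟨v, hv, hT⟩

theorem BoundedBelow.injective {L : E →L[ℂ] F} (h : BoundedBelow L) : Function.Injective L := by
  obtain ⟨c, hc, h⟩ := h
  refine (injective_iff_map_eq_zero L).2 fun v hv => norm_le_zero_iff.1 ?_
  have := h v
  rw [hv, norm_zero] at this
  exact nonpos_of_mul_nonpos_right this hc

theorem boundedBelow_of_isUnit {L : E →L[ℂ] E} (h : IsUnit L) : BoundedBelow L := by
  obtain ⟨u, rfl⟩ := h
  set M : E →L[ℂ] E := ↑u⁻¹ with hM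
  refine ⟨(‖M‖ + 1)⁻¹, by positivity, fun v => ?_⟩
  rw [inv_mul_le_iff₀ (by positivity)]
  have h1 : M ((u : E →L[ℂ] E) v) = v := by
    rw [← mul_apply_eq_comp, hM, Units.inv_mul, one_apply_eq_self]
  calc ‖v‖ = ‖M ((u : E →L[ℂ] E) v)‖ := by rw [h1]
    _ ≤ ‖M‖ * ‖(u : E →L[ℂ] E) v‖ := M.le_opNorm _
    _ ≤ _ := by gcongr; linarith

theorem approxPointSpectrum_subset_spectrum (T : E →L[ℂ] E) :
    approxPointSpectrum T ⊆ spectrum ℂ T := by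
  intro c hc
  rw [mem_approxPointSpectrum_iff] at hc
  rw [spectrum.mem_iff]
  intro h
  apply hc
  apply boundedBelow_of_isUnit
  have : T - c • (1 : E →L[ℂ] E) = -(algebraMap ℂ (E →L[ℂ] E) c - T) := by
    rw [Algebra.algebraMap_eq_smul_one]; abel
  rw [this]
  exact h.neg

/-- A lower bound `c` for `M` bounds `‖M⁻¹‖` by `c⁻¹`, so `M⁻¹ (M - N)` has norm below one and a
Neumann series inverts `N = M (1 - M⁻¹ (M - N))`. -/
theorem isUnit_of_norm_sub_lt [CompleteSpace E] {M N : E →L[ℂ] E} (hM : IsUnit M) {c : ℝ}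
    (hc : ∀ v, c * ‖v‖ ≤ ‖M v‖) (hMN : ‖N - M‖ < c) : IsUnit N := by
  obtain ⟨u, rfl⟩ := hM
  have hc0 : 0 < c := (norm_nonneg _).trans_lt hMN
  set K : E →L[ℂ] E := ↑u⁻¹ with hK
  have h1 : ∀ v, (u : E →L[ℂ] E) (K v) = v := fun v => by
    rw [← mul_apply_eq_comp, hK, Units.mul_inv, one_apply_eq_self]
  have hKn : ‖K‖ ≤ c⁻¹ := K.opNorm_le_bound (by positivity) fun v => by
    rw [← div_eq_inv_mul, le_div_iff₀ hc0, mul_comm]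
    simpa [h1] using hc (K v)
  have h2 : ‖K * ((u : E →L[ℂ] E) - N)‖ < 1 := by
    refine (norm_mul_le _ _).trans_lt ?_
    rw [norm_sub_rev]
    calc ‖K‖ * ‖N - u‖ ≤ c⁻¹ * ‖N - u‖ := by gcongr
      _ < c⁻¹ * c := by gcongr
      _ = 1 := inv_mul_cancel₀ hc0.ne'
  have h3 : N = u * (1 - K * ((u : E →L[ℂ] E) - N)) := by
    rw [mul_sub, mul_one, ← mul_assoc, hK, Units.mul_inv, one_mul, sub_sub_cancel]
  rw [h3]
  exact u.isUnit.mul (isUnit_one_sub_of_norm_lt_one h2)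

/-- A spectral point `z` of maximal modulus is a limit of resolvent points `z'`. Were `L - z`
bounded below by `c`, then `L - z'` would be bounded below by `c / 2` for `|z' - z| < c / 2`, and
its invertibility would pass to `L - z`. -/
theorem exists_mem_approxPointSpectrum [CompleteSpace E] [Nontrivial E] (L : E →L[ℂ] E) :
    (approxPointSpectrum L).Nonempty := by
  obtain ⟨z, hz, hzr⟩ := spectrum.exists_nnnorm_eq_spectralRadius L
  refine ⟨z, ?_⟩
  rw [mem_approxPointSpectrum_iff]
  rintro ⟨c, hc, hL⟩
  obtain ⟨z', hz'1, hz'2⟩ : ∃ z' : ℂ, ‖z' - z‖ < c / 2 ∧ ‖z‖ < ‖z'‖ := by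
    by_cases h0 : z = 0
    · refine ⟨(c / 4 : ℝ), ?_, ?_⟩
      · rw [h0, sub_zero, Complex.norm_real, Real.norm_of_nonneg (by positivity)]; linarith
      · rw [h0, norm_zero, Complex.norm_real, Real.norm_of_nonneg (by positivity)]; positivity
    · have hz0 : 0 < ‖z‖ := norm_pos_iff.2 h0
      refine ⟨((1 + c / (4 * ‖z‖) : ℝ) : ℂ) * z, ?_, ?_⟩
      · have : ((1 + c / (4 * ‖z‖) : ℝ) : ℂ) * z - z = ((c / (4 * ‖z‖) : ℝ) : ℂ) * z := by
          push_cast; ring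
        rw [this, norm_mul, Complex.norm_real, Real.norm_of_nonneg (by positivity)]
        field_simp
        linarith
      · rw [norm_mul, Complex.norm_real, Real.norm_of_nonneg (by positivity)]
        have : 0 < c / (4 * ‖z‖) := by positivity
        nlinarith
  have hu : z' ∉ spectrum ℂ L := fun h => by
    have h1 := le_iSup₂ (f := fun (k : ℂ) (_ : k ∈ spectrum ℂ L) => (‖k‖₊ : ℝ≥0∞)) z' h
    change (‖z'‖₊ : ℝ≥0∞) ≤ spectralRadius ℂ L at h1
    rw [← hzr, ENNReal.coe_le_coe, ← NNReal.coe_le_coe] at h1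
    exact absurd hz'2 (not_lt.2 h1)
  rw [spectrum.notMem_iff] at hu
  refine spectrum.mem_iff.1 hz (isUnit_of_norm_sub_lt hu (c := c / 2) (fun v => ?_) ?_)
  · have h1 : (algebraMap ℂ (E →L[ℂ] E) z' - L) v = (z' - z) • v - (L - z • (1 : E →L[ℂ] E)) v := by
      simp [Algebra.algebraMap_eq_smul_one, sub_smul]
    have h2 : ‖(L - z • (1 : E →L[ℂ] E)) v‖ ≤
        ‖(algebraMap ℂ (E →L[ℂ] E) z' - L) v‖ + ‖(z' - z) • v‖ := by
      rw [h1, add_comm, norm_sub_rev ((z' - z) • v)]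
      exact (le_of_eq (by congr 1; abel)).trans (norm_add_le _ _)
    rw [norm_smul] at h2
    have h3 := hL v
    have h4 : ‖z' - z‖ * ‖v‖ ≤ c / 2 * ‖v‖ := by gcongr
    linarith
  · have : algebraMap ℂ (E →L[ℂ] E) z - L - (algebraMap ℂ (E →L[ℂ] E) z' - L) =
        (z - z') • (1 : E →L[ℂ] E) := by
      rw [Algebra.algebraMap_eq_smul_one, Algebra.algebraMap_eq_smul_one, sub_smul]; abel
    rw [this, norm_smul, norm_sub_rev]
    calc ‖z' - z‖ * ‖(1 : E →L[ℂ] E)‖ ≤ ‖z' - z‖ * 1 := by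
          gcongr; exact ContinuousLinearMap.norm_id_le
      _ < c / 2 := by rwa [mul_one]

end BoundedBelow
end JClassOp
end

noncomputable section
namespace JClassOp

open BoundedContinuousFunction

/-! ### Joint approximate eigenvectors of commuting operators. -/

section JointApproximation

variable {E : Type*} [NormedAddCommGroup E] [NormedSpace ℂ E]

/-- The bounded sequences that tend to zero. -/
def nullSeq (E : Type*) [NormedAddCommGroup E] [NormedSpace ℂ E] : Submodule ℂ (ℕ →ᵇ E) where
  carrier := {v | Tendsto v atTop (𝓝 0)}
  add_mem' := fun {v w} hv hw => by
    have := Tendsto.add (show Tendsto v atTop (𝓝 0) from hv) hw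
    rwa [add_zero] at this
  zero_mem' := by
    change Tendsto (fun _ => (0 : E)) atTop (𝓝 0)
    exact tendsto_const_nhds
  smul_mem' := fun c v hv => by
    simpa using Tendsto.const_smul (show Tendsto v atTop (𝓝 0) from hv) c

theorem mem_nullSeq {v : ℕ →ᵇ E} : v ∈ nullSeq E ↔ Tendsto v atTop (𝓝 0) := Iff.rfl

theorem isClosed_nullSeq : IsClosed (nullSeq E : Set (ℕ →ᵇ E)) := by
  refine isClosed_of_closure_subset fun v hv => ?_
  change Tendsto v atTop (𝓝 0)
  rw [Metric.tendsto_atTop]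
  intro ε hε
  obtain ⟨w, hw, hvw⟩ := Metric.mem_closure_iff.1 hv (ε / 2) (half_pos hε)
  obtain ⟨N, hN⟩ := Metric.tendsto_atTop.1 (mem_nullSeq.1 hw) (ε / 2) (half_pos hε)
  refine ⟨N, fun n hn => ?_⟩
  calc dist (v n) 0 ≤ dist (v n) (w n) + dist (w n) 0 := dist_triangle _ _ _
    _ < ε / 2 + ε / 2 := add_lt_add_of_le_of_lt
        ((BoundedContinuousFunction.dist_coe_le_dist n).trans hvw.le) (hN n hn)
    _ = ε := add_halves ε

instance : IsClosed (nullSeq E : Set (ℕ →ᵇ E)) := isClosed_nullSeq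

/-- Bounded sequences modulo null sequences. -/
abbrev Germs (E : Type*) [NormedAddCommGroup E] [NormedSpace ℂ E] : Type _ :=
  (ℕ →ᵇ E) ⧸ nullSeq E

/-- The operator induced on germs of bounded sequences. -/
def germMap (L : E →L[ℂ] E) : Germs E →L[ℂ] Germs E :=
  (nullSeq E).liftQL ((nullSeq E).mkQL ∘L L.compLeftContinuousBounded ℕ) (by
    intro v hv
    rw [LinearMap.mem_ker]
    change (nullSeq E).mkQ (L.compLeftContinuousBounded ℕ v) = 0
    rw [Submodule.mkQ_apply, Submodule.Quotient.mk_eq_zero, mem_nullSeq]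
    have := (L.continuous.tendsto 0).comp (mem_nullSeq.1 hv)
    rwa [map_zero] at this)

theorem germMap_mk (L : E →L[ℂ] E) (v : ℕ →ᵇ E) :
    germMap L (Submodule.Quotient.mk v) =
      Submodule.Quotient.mk (L.compLeftContinuousBounded ℕ v) := rfl

/-- The quotient norm of a germ is the limsup of the norms of its terms; this is one half, and
`norm_mk_le_of_eventually` is the other. -/
theorem eventually_norm_lt_of_norm_mk_lt {v : ℕ →ᵇ E} {ε : ℝ}
    (h : ‖(Submodule.Quotient.mk v : Germs E)‖ < ε) : ∀ᶠ n in atTop, ‖v n‖ < ε := by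
  obtain ⟨m, hm, hmn⟩ := Submodule.Quotient.norm_mk_lt (Submodule.Quotient.mk v : Germs E)
    (sub_pos.2 h)
  rw [add_sub_cancel] at hmn
  have h1 : Tendsto (v - m) atTop (𝓝 0) := (Submodule.Quotient.eq _).1 hm.symm
  filter_upwards [(tendsto_zero_iff_norm_tendsto_zero.1 h1).eventually_lt_const (sub_pos.2 hmn)]
    with n hn
  have h2 : v n = (v - m) n + m n := by simp
  rw [h2]
  refine (norm_add_le _ _).trans_lt ?_
  have := m.norm_coe_le_norm n
  linarith

theorem norm_mk_le_of_eventually {v : ℕ →ᵇ E} {ε : ℝ} (hε : 0 ≤ ε)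
    (h : ∀ᶠ n in atTop, ‖v n‖ ≤ ε) : ‖(Submodule.Quotient.mk v : Germs E)‖ ≤ ε := by
  obtain ⟨N, hN⟩ := eventually_atTop.1 h
  let w : ℕ →ᵇ E := BoundedContinuousFunction.ofNormedAddCommGroup
    (fun n => if n < N then 0 else v n) continuous_of_discreteTopology ε (fun n => by
      split_ifs with hn
      · simpa using hε
      · exact hN n (not_lt.1 hn))
  have h1 : (Submodule.Quotient.mk v : Germs E) = Submodule.Quotient.mk w := by
    rw [Submodule.Quotient.eq, mem_nullSeq]
    refine tendsto_const_nhds.congr' ?_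
    filter_upwards [eventually_ge_atTop N] with n hn
    simp [w, not_lt.2 hn]
  rw [h1]
  exact (Submodule.Quotient.norm_mk_le _ w).trans
    (BoundedContinuousFunction.norm_ofNormedAddCommGroup_le _ hε _)

/-- If `P` is not bounded below and `L` commutes with `P`, then `L` has an approximate eigenvalue
with approximate eigenvectors that are also approximate null vectors of `P`. -/
theorem exists_joint_approx [CompleteSpace E] {P L : E →L[ℂ] E} (hPL : Commute P L)
    (hP : ¬ BoundedBelow P) :
    ∃ (z : ℂ) (v : ℕ → E), (∀ n, ‖v n‖ = 1) ∧ Tendsto (fun n => P (v n)) atTop (𝓝 0) ∧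
      Tendsto (fun n => L (v n) - z • v n) atTop (𝓝 0) := by
  -- Approximate null vectors of `P` turn into a true kernel `Z`. It is a nonzero Banach space,
  -- invariant under `L` by commutation, so `L` has an approximate eigenvalue on it.
  let Z : Submodule ℂ (Germs E) := LinearMap.ker (germMap P : Germs E →ₗ[ℂ] Germs E)
  have hZc : IsClosed (Z : Set (Germs E)) := (germMap P).isClosed_ker
  have : CompleteSpace Z := hZc.completeSpace_coe
  have : Nontrivial Z := by
    obtain ⟨v, hv, hPv⟩ := exists_seq_of_not_boundedBelow hP
    let w : ℕ →ᵇ E := BoundedContinuousFunction.ofNormedAddCommGroup v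
      continuous_of_discreteTopology 1 (fun n => (hv n).le)
    have hw : (Submodule.Quotient.mk w : Germs E) ∈ Z := by
      change germMap P (Submodule.Quotient.mk w) = 0
      rw [germMap_mk, Submodule.Quotient.mk_eq_zero]
      exact hPv
    refine ⟨⟨⟨_, hw⟩, 0, fun h => ?_⟩⟩
    have h1 : (Submodule.Quotient.mk w : Germs E) = 0 := congrArg Subtype.val h
    rw [Submodule.Quotient.mk_eq_zero, mem_nullSeq] at h1
    have h2 := h1.norm
    simp only [w, BoundedContinuousFunction.coe_ofNormedAddCommGroup, hv, norm_zero] at h2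
    exact one_ne_zero (tendsto_nhds_unique tendsto_const_nhds h2)
  have hLZ : ∀ x ∈ Z, germMap L x ∈ Z := by
    intro x hx
    obtain ⟨v, rfl⟩ := Submodule.Quotient.mk_surjective _ x
    have hx' : germMap P (Submodule.Quotient.mk v) = 0 := hx
    change germMap P (germMap L (Submodule.Quotient.mk v)) = 0
    rw [germMap_mk, Submodule.Quotient.mk_eq_zero, mem_nullSeq] at hx'
    rw [germMap_mk, germMap_mk, Submodule.Quotient.mk_eq_zero, mem_nullSeq]
    have h1 := (L.continuous.tendsto 0).comp hx'
    rw [map_zero] at h1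
    refine h1.congr fun n => ?_
    exact (DFunLike.congr_fun hPL.eq (v n)).symm
  let LZ : Z →L[ℂ] Z := (germMap L).restrict hLZ
  obtain ⟨z, hz⟩ := exists_mem_approxPointSpectrum (E := Z) LZ
  refine ⟨z, ?_⟩
  have key : ∀ ε > 0, ∃ v : E, ‖v‖ = 1 ∧ ‖P v‖ < ε ∧ ‖L v - z • v‖ < ε := by
    intro ε hε
    rw [mem_approxPointSpectrum_iff] at hz
    obtain ⟨⟨x, hxZ⟩, hx1, hx2⟩ := exists_unit_of_not_boundedBelow hz (half_pos hε)
    obtain ⟨v, rfl⟩ := Submodule.Quotient.mk_surjective _ x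
    have h1 : ‖(Submodule.Quotient.mk (L.compLeftContinuousBounded ℕ v - z • v) : Germs E)‖
        < ε / 2 := hx2
    -- A germ of norm one has infinitely many terms of norm above `1 / 2`. Normalising such a term
    -- costs at most a factor two, which is why the errors are kept below `ε / 2`.
    have h2 : ∃ᶠ n in atTop, 1 / 2 < ‖v n‖ := by
      by_contra hcon
      rw [not_frequently] at hcon
      have h3 := norm_mk_le_of_eventually (v := v) (ε := 1 / 2) (by norm_num)
        (hcon.mono fun n hn => not_lt.1 hn)
      have h4 : ‖(Submodule.Quotient.mk v : Germs E)‖ = 1 := hx1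
      rw [h4] at h3
      norm_num at h3
    have h3 : Tendsto (fun n => P (v n)) atTop (𝓝 0) := by
      have : germMap P (Submodule.Quotient.mk v) = 0 := hxZ
      rwa [germMap_mk, Submodule.Quotient.mk_eq_zero, mem_nullSeq] at this
    have h4 := (tendsto_zero_iff_norm_tendsto_zero.1 h3).eventually_lt_const (half_pos hε)
    obtain ⟨n, hn, hn1, hn2⟩ := (h2.and_eventually (h4.and
      (eventually_norm_lt_of_norm_mk_lt h1))).exists
    have hn2' : ‖L (v n) - z • v n‖ < ε / 2 := hn2
    have hpos : 0 < ‖v n‖ := by linarith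
    have hscale : ∀ w : E, ‖w‖ < ε / 2 → ‖((‖v n‖⁻¹ : ℝ) : ℂ) • w‖ < ε := fun w hw => by
      rw [norm_smul, Complex.norm_real, norm_inv, norm_norm, inv_mul_lt_iff₀ hpos]
      nlinarith
    refine ⟨((‖v n‖⁻¹ : ℝ) : ℂ) • v n, ?_, ?_, ?_⟩
    · rw [norm_smul, Complex.norm_real, norm_inv, norm_norm, inv_mul_cancel₀ hpos.ne']
    · rw [map_smul]; exact hscale _ hn1
    · rw [map_smul, smul_comm z, ← smul_sub]; exact hscale _ hn2'
  choose v hv1 hv2 hv3 using fun n : ℕ => key _ (Nat.one_div_pos_of_nat (α := ℝ) (n := n))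
  exact ⟨v, hv1, squeeze_zero_norm (fun n => (hv2 n).le) tendsto_one_div_add_atTop_nhds_zero_nat,
    squeeze_zero_norm (fun n => (hv3 n).le) tendsto_one_div_add_atTop_nhds_zero_nat⟩

end JointApproximation
end JClassOp
end

noncomputable section
namespace JClassOp

open BoundedContinuousFunction

/-! ### From lower bounds on a disc to growth of powers. -/

section Growth

variable {E F : Type*} [NormedAddCommGroup E] [NormedSpace ℂ E]
  [NormedAddCommGroup F] [NormedSpace ℂ F]

/-- The left shift on bounded sequences. -/
def leftShift (E : Type*) [NormedAddCommGroup E] [NormedSpace ℂ E] : (ℕ →ᵇ E) →L[ℂ] (ℕ →ᵇ E) :=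
  compContinuousCLM E ℂ ⟨fun n : ℕ => n + 1, continuous_of_discreteTopology⟩

/-- The shift is a contraction commuting with the coordinatewise action of `B`. Failure would give
joint approximate eigenvectors with shift eigenvalue `z`, `|z| ≤ 1`, making `ρ z` an approximate
eigenvalue of the coordinatewise `B`, against the bound `h` applied in each coordinate. -/
theorem boundedBelow_sub_leftShift [CompleteSpace E] {B : E →L[ℂ] E} {ρ c : ℝ} (hρ : 0 ≤ ρ)
    (hc : 0 < c) (h : ∀ μ : ℂ, ‖μ‖ ≤ ρ → ∀ v, c * ‖v‖ ≤ ‖B v - μ • v‖) :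
    BoundedBelow (B.compLeftContinuousBounded ℕ - (ρ : ℂ) • leftShift E) := by
  set Bh := B.compLeftContinuousBounded ℕ with hBh
  by_contra hcon
  have hcomm : Commute (Bh - (ρ : ℂ) • leftShift E) (leftShift E) := by
    have h1 : Commute Bh (leftShift E) := ContinuousLinearMap.ext fun v => by ext n; rfl
    exact h1.sub_left ((Commute.refl _).smul_left _)
  obtain ⟨z, v, hv, hP, hL⟩ := exists_joint_approx hcomm hcon
  have hz : ‖z‖ ≤ 1 := by
    refine ge_of_tendsto' (f := fun n => ‖leftShift E (v n) - z • v n‖ + 1) ?_ (fun n => ?_)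
      (x := atTop) |>.trans_eq (zero_add 1)
    · simpa using hL.norm.add_const 1
    · calc ‖z‖ = ‖z • v n‖ := by rw [norm_smul, hv, mul_one]
        _ = ‖leftShift E (v n) - (leftShift E (v n) - z • v n)‖ := by rw [sub_sub_cancel]
        _ ≤ ‖leftShift E (v n)‖ + ‖leftShift E (v n) - z • v n‖ := norm_sub_le _ _
        _ ≤ 1 + ‖leftShift E (v n) - z • v n‖ := by
          gcongr
          rw [← hv n]
          exact (BoundedContinuousFunction.norm_le (norm_nonneg _)).2 fun k =>
            (v n).norm_coe_le_norm _
        _ = _ := add_comm _ _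
  have h1 : Tendsto (fun n => Bh (v n) - ((ρ : ℂ) * z) • v n) atTop (𝓝 0) := by
    have := hP.add (hL.const_smul (ρ : ℂ))
    rw [smul_zero, add_zero] at this
    refine this.congr fun n => ?_
    simp only [_root_.sub_apply, _root_.smul_apply, smul_sub, mul_smul]
    abel
  have h2 : ∀ n, c ≤ ‖Bh (v n) - ((ρ : ℂ) * z) • v n‖ := fun n => by
    have hle : ‖v n‖ ≤ c⁻¹ * ‖Bh (v n) - ((ρ : ℂ) * z) • v n‖ := by
      refine (BoundedContinuousFunction.norm_le (by positivity)).2 fun k => ?_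
      rw [← div_eq_inv_mul, le_div_iff₀ hc, mul_comm]
      refine (h ((ρ : ℂ) * z) ?_ (v n k)).trans
        ((Bh (v n) - ((ρ : ℂ) * z) • v n).norm_coe_le_norm k)
      rw [norm_mul, Complex.norm_real, Real.norm_of_nonneg hρ]
      exact mul_le_of_le_one_right hρ hz
    rwa [hv, ← div_eq_inv_mul, le_div_iff₀ hc, one_mul] at hle
  have h3 := ge_of_tendsto' h1.norm h2
  rw [norm_zero] at h3
  linarith

/-- If `B - μ` is uniformly bounded below for `|μ| ≤ ρ`, then the powers of `B` grow at least like
those of `ρ`. -/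
theorem exists_pow_growth [CompleteSpace E] {B : E →L[ℂ] E} {ρ c : ℝ} (hρ : 0 < ρ)
    (hc : 0 < c) (h : ∀ μ : ℂ, ‖μ‖ ≤ ρ → ∀ v, c * ‖v‖ ≤ ‖B v - μ • v‖) :
    ∃ C > 0, ∀ (n : ℕ) (v : E), C * ρ ^ n * ‖v‖ ≤ ‖(B ^ n) v‖ := by
  obtain ⟨K, hK, hB⟩ := boundedBelow_sub_leftShift hρ.le hc h
  have key : ∀ (n : ℕ) (v : E), K / ρ * ρ ^ (n + 1) * ‖v‖ ≤ ‖(B ^ (n + 1)) v‖ := by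
    intro n v
    -- The scaled orbit `ρ^{-k} B^k v`, cut off after `k = n`. Under `B - ρ · shift` everything
    -- cancels except the entry at `k = n`, which is `ρ^{-n} B^{n+1} v`.
    let g : ℕ → E := fun k => if k ≤ n then ((ρ ^ k : ℝ) : ℂ)⁻¹ • (B ^ k) v else 0
    have hg : ∀ k, ‖g k‖ ≤ ∑ i ∈ Finset.range (n + 1), ‖g i‖ := fun k => by
      by_cases hk : k ≤ n
      · exact Finset.single_le_sum (f := fun i => ‖g i‖) (fun i _ => norm_nonneg _)
          (Finset.mem_range.2 (Nat.lt_succ_of_le hk))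
      · simp only [g, if_neg hk, norm_zero]
        exact Finset.sum_nonneg fun i _ => norm_nonneg _
    let Φ : ℕ →ᵇ E := BoundedContinuousFunction.ofNormedAddCommGroup g
      continuous_of_discreteTopology _ hg
    have h0 : ‖v‖ ≤ ‖Φ‖ := by
      have := Φ.norm_coe_le_norm 0
      simpa [Φ, g] using this
    have h1 : ‖(B.compLeftContinuousBounded ℕ - (ρ : ℂ) • leftShift E) Φ‖ ≤
        (ρ ^ n)⁻¹ * ‖(B ^ (n + 1)) v‖ := by
      refine (BoundedContinuousFunction.norm_le (by positivity)).2 fun k => ?_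
      change ‖B (g k) - (ρ : ℂ) • g (k + 1)‖ ≤ _
      have hBk : B ((B ^ k) v) = (B ^ (k + 1)) v := by
        rw [pow_succ', mul_apply_eq_comp]
      rcases lt_trichotomy k n with hk | rfl | hk
      · have : B (g k) - (ρ : ℂ) • g (k + 1) = 0 := by
          simp only [g, if_pos hk.le, if_pos (Nat.succ_le_of_lt hk), map_smul, hBk, smul_smul]
          rw [← sub_smul]
          have hρ' : (ρ : ℂ) ≠ 0 := by exact_mod_cast hρ.ne'
          have : ((ρ ^ k : ℝ) : ℂ)⁻¹ - (ρ : ℂ) * ((ρ ^ (k + 1) : ℝ) : ℂ)⁻¹ = 0 := by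
            push_cast
            field_simp
            ring
          rw [this, zero_smul]
        rw [this, norm_zero]; positivity
      · simp only [g, le_refl, if_true, if_neg (Nat.not_succ_le_self k), smul_zero, sub_zero,
          map_smul, hBk, norm_smul, norm_inv, Complex.norm_real]
        rw [Real.norm_of_nonneg (by positivity)]
      · simp only [g, if_neg (not_le.2 hk), if_neg (not_le.2 (hk.trans (Nat.lt_succ_self k))),
          smul_zero, sub_zero, map_zero, norm_zero]
        positivity
    have h2 := (mul_le_mul_of_nonneg_left h0 hK.le).trans ((hB Φ).trans h1)
    rw [← div_eq_inv_mul, le_div_iff₀ (by positivity)] at h2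
    calc K / ρ * ρ ^ (n + 1) * ‖v‖ = K * ‖v‖ * ρ ^ n := by field_simp; ring
      _ ≤ _ := h2
  refine ⟨min 1 (K / ρ), by positivity, fun n v => ?_⟩
  cases n with
  | zero =>
    simp only [pow_zero, mul_one, one_apply_eq_self]
    exact mul_le_of_le_one_left (norm_nonneg _) (min_le_left _ _)
  | succ n =>
    refine le_trans ?_ (key n v)
    gcongr
    exact min_le_right _ _

/-- Compactness: otherwise there are unit vectors and `μ_n` with `|μ_n| ≤ 1 + 1/(n+1)` and `B v_n -
μ_n v_n → 0`, and a limit point of the `μ_n` lies in the closed unit disc, where the lower bound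
holds. -/
theorem exists_uniform_boundedBelow {B : E →L[ℂ] E}
    (h : ∀ μ : ℂ, ‖μ‖ ≤ 1 → BoundedBelow (B - μ • (1 : E →L[ℂ] E))) :
    ∃ ρ > 1, ∃ c > 0, ∀ μ : ℂ, ‖μ‖ ≤ ρ → ∀ v, c * ‖v‖ ≤ ‖B v - μ • v‖ := by
  by_contra! hcon
  have h1 : ∀ n : ℕ, ∃ (μ : ℂ) (v : E), ‖μ‖ ≤ 1 + 1 / ((n : ℝ) + 1) ∧ ‖v‖ = 1 ∧
      ‖B v - μ • v‖ < 1 / ((n : ℝ) + 1) := fun n => by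
    have hp : 0 < 1 / ((n : ℝ) + 1) := Nat.one_div_pos_of_nat
    obtain ⟨μ, hμ, v, hv⟩ := hcon (1 + 1 / ((n : ℝ) + 1)) (by linarith) _ hp
    have : ¬ ∀ v, 1 / ((n : ℝ) + 1) * ‖v‖ ≤ ‖(B - μ • (1 : E →L[ℂ] E)) v‖ := fun h =>
      absurd (h v) (not_le.2 hv)
    have hv0 : 0 < ‖v‖ := by
      by_contra h0
      have : ‖v‖ = 0 := le_antisymm (not_lt.1 h0) (norm_nonneg _)
      rw [this, mul_zero] at hv
      exact absurd hv (not_lt.2 (norm_nonneg _))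
    refine ⟨μ, ((‖v‖⁻¹ : ℝ) : ℂ) • v, hμ, ?_, ?_⟩
    · rw [norm_smul, Complex.norm_real, norm_inv, norm_norm, inv_mul_cancel₀ hv0.ne']
    · rw [map_smul, smul_comm μ, ← smul_sub, norm_smul, Complex.norm_real, norm_inv, norm_norm,
        inv_mul_lt_iff₀ hv0, mul_comm]
      exact hv
  choose μ v hμ hv hBv using h1
  have hμ2 : ∀ n, μ n ∈ Metric.closedBall (0 : ℂ) 2 := fun n => by
    rw [mem_closedBall_zero_iff]
    refine (hμ n).trans ?_
    have : 1 / ((n : ℝ) + 1) ≤ 1 := by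
      rw [div_le_one (by positivity)]; linarith [n.cast_nonneg (α := ℝ)]
    linarith
  obtain ⟨z, -, k, hk, hz⟩ := (isCompact_closedBall (0 : ℂ) 2).tendsto_subseq hμ2
  have hlim := (tendsto_one_div_add_atTop_nhds_zero_nat (𝕜 := ℝ)).comp hk.tendsto_atTop
  have hz1 : ‖z‖ ≤ 1 := by
    have := le_of_tendsto_of_tendsto' hz.norm (hlim.const_add 1) fun n => hμ (k n)
    rwa [add_zero] at this
  refine not_boundedBelow_of_seq (v := fun n => v (k n)) (fun n => hv _) ?_ (h z hz1)
  have h2 : Tendsto (fun n => B (v (k n)) - μ (k n) • v (k n)) atTop (𝓝 0) :=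
    squeeze_zero_norm (fun n => (hBv (k n)).le) hlim
  have h3 : Tendsto (fun n => (μ (k n) - z) • v (k n)) atTop (𝓝 0) := by
    rw [tendsto_zero_iff_norm_tendsto_zero]
    simp only [norm_smul, hv, mul_one]
    have := (hz.sub_const z).norm
    simpa using this
  have h4 := h2.add h3
  rw [add_zero] at h4
  refine h4.congr fun n => ?_
  simp only [_root_.sub_apply, _root_.smul_apply, one_apply_eq_self, sub_smul]
  abel

end Growth

/-! ### Adjoints: surjectivity, invertibility and spectrum. -/

section Duality

variable {E F : Type*} [NormedAddCommGroup E] [NormedSpace ℂ E]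
  [NormedAddCommGroup F] [NormedSpace ℂ F]

/-- A shortcut instance: the generic search is slow on operators between dual spaces. -/
scoped instance dualOperatorRing : Ring (StrongDual ℂ E →L[ℂ] StrongDual ℂ E) := ContinuousLinearMap.ring

/-- A shortcut instance: the generic search is slow on operators between dual spaces. -/
scoped instance dualOperatorMonoid : Monoid (StrongDual ℂ E →L[ℂ] StrongDual ℂ E) :=
  dualOperatorRing.toMonoid

theorem dualOp_apply_apply (T : E →L[ℂ] F) (φ : StrongDual ℂ F) (x : E) :
    dualOp T φ x = φ (T x) := rfl

theorem dualOp_sub_smul (T : E →L[ℂ] E) (μ : ℂ) :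
    dualOp (T - μ • (1 : E →L[ℂ] E)) = dualOp T - μ • (1 : StrongDual ℂ E →L[ℂ] StrongDual ℂ E) := by
  ext φ x
  simp [dualOp_apply_apply]

theorem dualOp_mul (S T : E →L[ℂ] E) : dualOp (S * T) = dualOp T * dualOp S := rfl

theorem dualOp_one : dualOp (1 : E →L[ℂ] E) = 1 := rfl

theorem dualOp_pow (T : E →L[ℂ] E) (n : ℕ) : dualOp (T ^ n) = dualOp T ^ n := by
  induction n with
  | zero => rfl
  | succ n ih => rw [pow_succ', pow_succ, dualOp_mul, ih]

/-- If the adjoint is bounded below, then points can be approximated by images of vectors of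
controlled norm. -/
theorem exists_norm_apply_sub_lt {A : E →L[ℂ] F} {c : ℝ} (hc : 0 < c)
    (h : ∀ φ : StrongDual ℂ F, c * ‖φ‖ ≤ ‖φ ∘L A‖) (y : F) {ε : ℝ} (hε : 0 < ε) :
    ∃ u, c * ‖u‖ ≤ ‖y‖ ∧ ‖A u - y‖ < ε := by
  rcases eq_or_ne y 0 with rfl | hy
  · exact ⟨0, by simp, by simpa using hε⟩
  have hy0 : 0 < ‖y‖ := norm_pos_iff.2 hy
  by_contra! hcon
  let s : Set F := closure (A '' Metric.closedBall 0 (‖y‖ / c))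
  have hys : y ∉ s := fun hys => by
    obtain ⟨_, ⟨u, hu, rfl⟩, hd⟩ := Metric.mem_closure_iff.1 hys ε hε
    rw [mem_closedBall_zero_iff, le_div_iff₀ hc, mul_comm] at hu
    have := hcon u hu
    rw [dist_eq_norm, norm_sub_rev] at hd
    linarith
  have hconv : Convex ℝ (A '' Metric.closedBall 0 (‖y‖ / c)) :=
    (convex_closedBall 0 _).is_linear_image (f := A)
      ⟨A.map_add, fun r x => by
        rw [← Complex.coe_smul, ← Complex.coe_smul, map_smul]⟩
  -- If `y` is not approximated, it is separated from the closed image of the ball of radius `‖y‖ /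
  -- c`. The separating `f` satisfies `‖f ∘ A‖ ≤ t c / ‖y‖` but `re f(y) > t`, contradicting the
  -- lower bound for the adjoint.
  obtain ⟨f, t, hft, hty⟩ := RCLike.geometric_hahn_banach_closed_point (𝕜 := ℂ)
    hconv.closure isClosed_closure hys
  have hball : ∀ x : E, ‖x‖ ≤ ‖y‖ / c → ‖f (A x)‖ ≤ t := fun x hx => by
    obtain ⟨w, hw1, hw2⟩ : ∃ w : ℂ, ‖w‖ = 1 ∧ w * f (A x) = ‖f (A x)‖ := by
      by_cases h0 : f (A x) = 0
      · exact ⟨1, by simp, by simp [h0]⟩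
      · refine ⟨‖f (A x)‖ / f (A x), ?_, div_mul_cancel₀ _ h0⟩
        rw [norm_div, Complex.norm_real, norm_norm, div_self (norm_ne_zero_iff.2 h0)]
    have h1 := hft (A (w • x)) (subset_closure ⟨w • x, by
      rw [mem_closedBall_zero_iff, norm_smul, hw1, one_mul]; exact hx, rfl⟩)
    rw [map_smul, map_smul, smul_eq_mul, hw2] at h1
    exact le_of_lt (by simpa using h1)
  have ht : 0 ≤ t := (norm_nonneg _).trans (hball 0 (by rw [norm_zero]; positivity))
  have hn : ‖f ∘L A‖ ≤ t * c / ‖y‖ := by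
    refine ContinuousLinearMap.opNorm_le_bound _ (by positivity) fun x => ?_
    rcases eq_or_ne x 0 with rfl | hx
    · simp
    have hx0 : 0 < ‖x‖ := norm_pos_iff.2 hx
    have h1 := hball (((‖y‖ / c / ‖x‖ : ℝ) : ℂ) • x) (by
      rw [norm_smul, Complex.norm_real, Real.norm_of_nonneg (by positivity),
        div_mul_cancel₀ _ hx0.ne'])
    rw [map_smul, map_smul, norm_smul, Complex.norm_real, Real.norm_of_nonneg (by positivity)] at h1
    change ‖f (A x)‖ ≤ _
    rw [div_mul_eq_mul_div, le_div_iff₀ hy0]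
    rw [div_mul_eq_mul_div, div_le_iff₀ hx0, div_mul_eq_mul_div, div_le_iff₀ hc] at h1
    linarith
  have h1 := (h f).trans hn
  rw [le_div_iff₀ hy0] at h1
  have h2 : RCLike.re (f y) ≤ ‖f‖ * ‖y‖ := (RCLike.re_le_norm _).trans (f.le_opNorm y)
  have h3 : ‖f‖ * ‖y‖ ≤ t := le_of_mul_le_mul_left (by linarith) hc
  linarith

/-- Successive approximation: each correction halves the residual and is controlled by it in norm,
so the corrections sum in the complete space `E` to an exact preimage. -/
theorem surjective_of_boundedBelow_dualOp [CompleteSpace E] {A : E →L[ℂ] F}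
    (h : BoundedBelow (dualOp A)) : Function.Surjective A := by
  obtain ⟨c, hc, h⟩ := h
  have h1 : ∀ y : F, ∃ u : E, c * ‖u‖ ≤ ‖y‖ ∧ ‖A u - y‖ ≤ 1 / 2 * ‖y‖ := fun y => by
    rcases eq_or_ne y 0 with rfl | hy
    · exact ⟨0, by simp, by simp⟩
    · obtain ⟨u, hu1, hu2⟩ := exists_norm_apply_sub_lt hc h y
        (ε := 1 / 2 * ‖y‖) (by have := norm_pos_iff.2 hy; positivity)
      exact ⟨u, hu1, hu2.le⟩
  choose g hg1 hg2 using h1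
  intro y
  let r : ℕ → F := fun n => (fun z => z - A (g z))^[n] y
  have hr_succ : ∀ n, r (n + 1) = r n - A (g (r n)) := fun n =>
    Function.iterate_succ_apply' _ _ _
  have hr : ∀ n, ‖r n‖ ≤ (1 / 2) ^ n * ‖y‖ := fun n => by
    induction n with
    | zero => simp [r]
    | succ n ih =>
      rw [hr_succ, norm_sub_rev, pow_succ']
      refine (hg2 _).trans ?_
      rw [mul_assoc]; gcongr
  have hs : Summable fun n => g (r n) := by
    refine Summable.of_norm_bounded (g := fun n : ℕ => (1 / 2) ^ n * (‖y‖ / c))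
      ((summable_geometric_of_lt_one (by norm_num) (by norm_num)).mul_right _) fun n => ?_
    rw [← mul_div_assoc, le_div_iff₀ hc, mul_comm]
    exact (hg1 _).trans (hr n)
  refine ⟨∑' n, g (r n), ?_⟩
  have h2 : HasSum (fun n => A (g (r n))) (A (∑' n, g (r n))) := A.hasSum hs.hasSum
  have h3 : ∀ n, ∑ i ∈ Finset.range n, A (g (r i)) = y - r n := fun n => by
    induction n with
    | zero => simp [r]
    | succ n ih => rw [Finset.sum_range_succ, ih, hr_succ]; abel
  have h4 : Tendsto r atTop (𝓝 0) := by
    refine squeeze_zero_norm hr ?_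
    have := (tendsto_pow_atTop_nhds_zero_of_lt_one (r := (1 / 2 : ℝ)) (by norm_num)
      (by norm_num)).mul_const ‖y‖
    rwa [zero_mul] at this
  have h5 := h2.tendsto_sum_nat
  simp only [h3] at h5
  have h6 := h4.const_sub y
  rw [sub_zero] at h6
  exact tendsto_nhds_unique h5 h6

/-- When `A*` is invertible it is bounded below, so `A` is onto. It is also onto, so a norming
functional of a kernel vector of `A` has the form `ψ ∘ A` and vanishes on that vector, which is
therefore zero. -/
theorem isUnit_dualOp_iff [CompleteSpace E] {A : E →L[ℂ] E} : IsUnit (dualOp A) ↔ IsUnit A := by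
  constructor
  · intro h
    rw [ContinuousLinearMap.isUnit_iff_bijective]
    refine ⟨(injective_iff_map_eq_zero A).2 fun x hx => ?_,
      surjective_of_boundedBelow_dualOp (boundedBelow_of_isUnit h)⟩
    by_contra h0
    obtain ⟨φ, -, hφ⟩ := exists_dual_vector ℂ x (norm_ne_zero_iff.2 h0)
    obtain ⟨ψ, rfl⟩ := (ContinuousLinearMap.isUnit_iff_bijective.1 h).2 φ
    rw [dualOp_apply_apply, hx, map_zero] at hφ
    exact h0 (norm_eq_zero.1 (Complex.ofReal_eq_zero.1 hφ.symm))
  · rintro ⟨u, rfl⟩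
    refine ⟨⟨dualOp (u : E →L[ℂ] E), dualOp (↑u⁻¹ : E →L[ℂ] E), ?_, ?_⟩, rfl⟩
    · rw [← dualOp_mul, Units.inv_mul, dualOp_one]
    · rw [← dualOp_mul, Units.mul_inv, dualOp_one]

theorem mem_spectrum_iff_sub {T : E →L[ℂ] E} {μ : ℂ} :
    μ ∈ spectrum ℂ T ↔ ¬ IsUnit (T - μ • (1 : E →L[ℂ] E)) := by
  rw [spectrum.mem_iff, ← IsUnit.neg_iff, neg_sub, Algebra.algebraMap_eq_smul_one]

theorem spectrum_dualOp [CompleteSpace E] (T : E →L[ℂ] E) :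
    spectrum ℂ (dualOp T) = spectrum ℂ T := by
  ext μ
  rw [mem_spectrum_iff_sub, mem_spectrum_iff_sub, ← dualOp_sub_smul, isUnit_dualOp_iff]

end Duality
end JClassOp
end

noncomputable section
namespace JClassOp

/-! ### The spectral criterion for `J`-class operators. -/

section Criterion

variable {E : Type*} [NormedAddCommGroup E] [NormedSpace ℂ E]

/-- The `J`-set of `x` contains `m y` for every `m`; dividing the approximating vectors by a large
`m` makes both them and the error small. -/
theorem IsJClass.exists_norm_lt {A : E →L[ℂ] E} (hA : IsJClass A) (y : E) {ε : ℝ} (hε : 0 < ε) :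
    ∃ (k : ℕ) (u : E), ‖u‖ < ε ∧ ‖(A ^ k) u - y‖ < ε := by
  obtain ⟨x, -, hJ⟩ := hA
  obtain ⟨m, hm⟩ := exists_nat_gt ((‖x‖ + 1) / ε)
  have hm0 : (0 : ℝ) < m := lt_of_le_of_lt (by positivity) hm
  rw [div_lt_iff₀ hε] at hm
  have hy : (m : ℂ) • y ∈ jSet A x := hJ ▸ Set.mem_univ _
  obtain ⟨k, u, -, hu, hk⟩ := hy
  have h1 : ∀ᶠ n in atTop, ‖u n‖ < ‖x‖ + 1 := hu.norm.eventually_lt_const (by linarith)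
  have h2 : ∀ᶠ n in atTop, ‖(A ^ k n) (u n) - (m : ℂ) • y‖ < m * ε :=
    (tendsto_iff_norm_sub_tendsto_zero.1 hk).eventually_lt_const (by positivity)
  obtain ⟨n, hn1, hn2⟩ := (h1.and h2).exists
  have hmc : (m : ℂ) ≠ 0 := by exact_mod_cast hm0.ne'
  refine ⟨k n, (m : ℂ)⁻¹ • u n, ?_, ?_⟩
  · rw [norm_smul, norm_inv, Complex.norm_natCast, inv_mul_lt_iff₀ hm0]
    exact hn1.trans hm
  · have : (A ^ k n) ((m : ℂ)⁻¹ • u n) - y = (m : ℂ)⁻¹ • ((A ^ k n) (u n) - (m : ℂ) • y) := by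
      rw [map_smul, smul_sub, inv_smul_smul₀ hmc]
    rw [this, norm_smul, norm_inv, Complex.norm_natCast, inv_mul_lt_iff₀ hm0]
    exact hn2

/-- The adjoint of a `J`-class operator has no eigenvalues in the closed unit disc. -/
theorem IsJClass.injective_dualOp_sub {A : E →L[ℂ] E} (hA : IsJClass A) {μ : ℂ} (hμ : ‖μ‖ ≤ 1) :
    Function.Injective (dualOp A - μ • (1 : StrongDual ℂ E →L[ℂ] StrongDual ℂ E)) := by
  refine (injective_iff_map_eq_zero _).2 fun φ hφ => ?_
  have h1 : dualOp A φ = μ • φ := by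
    rw [← sub_eq_zero]; exact hφ
  -- Since `|μ| ≤ 1`, an eigenfunctional stays small along the whole orbit of a small vector,
  -- although that orbit comes close to any given `y`.
  have h2 : ∀ k u, φ ((A ^ k) u) = μ ^ k * φ u := fun k => by
    induction k with
    | zero => intro u; simp
    | succ k ih =>
      intro u
      rw [pow_succ, mul_apply_eq_comp, ih, pow_succ, mul_assoc]
      congr 1
      exact DFunLike.congr_fun h1 u
  ext y
  rw [zero_apply]
  refine norm_le_zero_iff.1 (le_of_forall_pos_le_add fun ε hε => ?_)
  rw [zero_add]
  have hpos : 0 < 2 * (‖φ‖ + 1) := by positivity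
  obtain ⟨k, u, hu, hk⟩ := hA.exists_norm_lt y (div_pos hε hpos)
  have h3 : φ y = μ ^ k * φ u - φ ((A ^ k) u - y) := by rw [map_sub, h2]; ring
  have h4 : ‖μ ^ k‖ ≤ 1 := by rw [norm_pow]; exact pow_le_one₀ (norm_nonneg _) hμ
  have h5 : (‖φ‖ + 1) * (ε / (2 * (‖φ‖ + 1))) = ε / 2 := by field_simp
  calc ‖φ y‖ ≤ ‖μ ^ k‖ * ‖φ u‖ + ‖φ ((A ^ k) u - y)‖ := by
        rw [h3, ← norm_mul]; exact norm_sub_le _ _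
    _ ≤ 1 * (‖φ‖ * ‖u‖) + ‖φ‖ * ‖(A ^ k) u - y‖ := by
        gcongr
        · exact φ.le_opNorm u
        · exact φ.le_opNorm _
    _ ≤ 1 * ((‖φ‖ + 1) * (ε / (2 * (‖φ‖ + 1)))) + (‖φ‖ + 1) * (ε / (2 * (‖φ‖ + 1))) := by
        gcongr <;> linarith
    _ = ε := by rw [h5]; ring

variable [CompleteSpace E]

/-- Invertibility is carried from `z` to `0` along the segment joining them, in `N` steps shorter
than the common lower bound `c`. -/
theorem isUnit_of_isUnit_sub {B : E →L[ℂ] E} {c : ℝ} (hc : 0 < c)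
    (h : ∀ μ : ℂ, ‖μ‖ ≤ 1 → ∀ v, c * ‖v‖ ≤ ‖B v - μ • v‖) {z : ℂ} (hz : ‖z‖ ≤ 1)
    (hu : IsUnit (B - z • (1 : E →L[ℂ] E))) : IsUnit B := by
  obtain ⟨N, hN⟩ := exists_nat_gt (1 / c)
  have hN0 : (0 : ℝ) < N := lt_trans (by positivity) hN
  have key : ∀ j : ℕ, j ≤ N → IsUnit (B - ((1 - j / N : ℝ) * z : ℂ) • (1 : E →L[ℂ] E)) := by
    intro j
    induction j with
    | zero => intro _; simpa using hu
    | succ j ih =>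
      intro hj
      refine isUnit_of_norm_sub_lt (ih (by omega)) (c := c) (fun v => h _ ?_ v) ?_
      · have h1 : (j : ℝ) / N ≤ 1 := by
          rw [div_le_one hN0]; exact_mod_cast (by omega : j ≤ N)
        have h2 : 0 ≤ (j : ℝ) / N := by positivity
        rw [norm_mul, Complex.norm_real, Real.norm_of_nonneg (by linarith)]
        exact mul_le_one₀ (by linarith) (norm_nonneg _) hz
      · have : B - ((1 - ((j + 1 : ℕ) : ℝ) / N : ℝ) * z : ℂ) • (1 : E →L[ℂ] E) -
            (B - ((1 - j / N : ℝ) * z : ℂ) • (1 : E →L[ℂ] E)) =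
            ((1 / N : ℝ) * z : ℂ) • (1 : E →L[ℂ] E) := by
          rw [sub_sub_sub_cancel_left, ← sub_smul]
          congr 1
          push_cast
          ring
        rw [this, norm_smul, norm_mul, Complex.norm_real, Real.norm_of_nonneg (by positivity)]
        have h1 : 1 / (N : ℝ) < c := by
          rw [div_lt_iff₀ hN0]
          rwa [div_lt_iff₀ hc, mul_comm] at hN
        calc 1 / (N : ℝ) * ‖z‖ * ‖(1 : E →L[ℂ] E)‖ ≤ 1 / (N : ℝ) * 1 * 1 := by
              gcongr; exact ContinuousLinearMap.norm_id_le
          _ < c := by simpa using h1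
  have := key N le_rfl
  rw [div_self hN0.ne', sub_self] at this
  simpa using this

/-- A spectral criterion for being `J`-class, for operators `A` such that `A^* - μ` is bounded below
as soon as it is injective. -/
theorem isJClass_iff {A : E →L[ℂ] E}
    (hA : ∀ μ : ℂ, Function.Injective (dualOp A - μ • (1 : StrongDual ℂ E →L[ℂ] StrongDual ℂ E)) →
      BoundedBelow (dualOp A - μ • (1 : StrongDual ℂ E →L[ℂ] StrongDual ℂ E))) :
    IsJClass A ↔
      (∀ μ : ℂ, ‖μ‖ ≤ 1 →
        BoundedBelow (dualOp A - μ • (1 : StrongDual ℂ E →L[ℂ] StrongDual ℂ E))) ∧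
      ∀ μ : ℂ, ‖μ‖ ≤ 1 → ¬ Function.Injective (A - μ • (1 : E →L[ℂ] E)) := by
  constructor
  · intro hJ
    have h1 : ∀ μ : ℂ, ‖μ‖ ≤ 1 →
        BoundedBelow (dualOp A - μ • (1 : StrongDual ℂ E →L[ℂ] StrongDual ℂ E)) :=
      fun μ hμ => hA μ (hJ.injective_dualOp_sub hμ)
    refine ⟨h1, fun μ hμ hinj => ?_⟩
    obtain ⟨ρ, hρ, c, hc, hB⟩ := exists_uniform_boundedBelow h1
    have hsurj : Function.Surjective (A - μ • (1 : E →L[ℂ] E)) :=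
      surjective_of_boundedBelow_dualOp (by rw [dualOp_sub_smul]; exact h1 μ hμ)
    have hu : IsUnit (dualOp A - μ • (1 : StrongDual ℂ E →L[ℂ] StrongDual ℂ E)) := by
      rw [← dualOp_sub_smul, isUnit_dualOp_iff, ContinuousLinearMap.isUnit_iff_bijective]
      exact ⟨hinj, hsurj⟩
    have hu0 : IsUnit (dualOp A) :=
      isUnit_of_isUnit_sub hc (fun μ hμ => hB μ (hμ.trans hρ.le)) hμ hu
    obtain ⟨C, hC, hgrow⟩ := exists_pow_growth (by linarith) hc hB
    -- Since `(A*)^k` is onto, a norming functional of `u` is `(A*)^k ψ`, and the growth estimate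
    -- gives `‖ψ‖ ≤ 1 / C`. Evaluating `ψ` at `A^k u` bounds `A^k` below uniformly in `k`, so `0` is
    -- not in the `J`-set of a nonzero `x`.
    have hlow : ∀ (k : ℕ) (u : E), C * ‖u‖ ≤ ‖(A ^ k) u‖ := by
      intro k u
      by_cases h0 : u = 0
      · simp [h0]
      obtain ⟨φ, hφ1, hφ⟩ := exists_dual_vector ℂ u (norm_ne_zero_iff.2 h0)
      obtain ⟨ψ, hψ⟩ := (ContinuousLinearMap.isUnit_iff_bijective.1 (hu0.pow k)).2 φ
      have h2 := hgrow k ψ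
      rw [hψ, hφ1] at h2
      have h3 : C * ‖ψ‖ ≤ 1 := by
        refine le_trans ?_ h2
        have := one_le_pow₀ hρ.le (n := k)
        have : C * 1 * ‖ψ‖ ≤ C * ρ ^ k * ‖ψ‖ := by gcongr
        linarith
      have h4 : ‖u‖ = ‖ψ ((A ^ k) u)‖ := by
        rw [← dualOp_apply_apply, dualOp_pow, hψ, hφ]
        exact ((Complex.norm_real _).trans (norm_norm u)).symm
      rw [h4]
      calc C * ‖ψ ((A ^ k) u)‖ ≤ C * (‖ψ‖ * ‖(A ^ k) u‖) := by gcongr; exact ψ.le_opNorm _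
        _ = C * ‖ψ‖ * ‖(A ^ k) u‖ := by ring
        _ ≤ 1 * ‖(A ^ k) u‖ := by gcongr
        _ = _ := one_mul _
    obtain ⟨x, hx, hJx⟩ := hJ
    have h0 : (0 : E) ∈ jSet A x := hJx ▸ Set.mem_univ _
    obtain ⟨k, u, -, hux, hk⟩ := h0
    have h2 := le_of_tendsto_of_tendsto' (hux.norm.const_mul C) hk.norm fun n => hlow (k n) (u n)
    rw [norm_zero] at h2
    exact hx (norm_le_zero_iff.1 (nonpos_of_mul_nonpos_right h2 hC))
  · rintro ⟨h1, h2⟩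
    obtain ⟨ρ, hρ, c, hc, hB⟩ := exists_uniform_boundedBelow h1
    obtain ⟨C, hC, hgrow⟩ := exists_pow_growth (by linarith) hc hB
    have h3 := h2 0 (by simp)
    rw [injective_iff_map_eq_zero] at h3
    push Not at h3
    obtain ⟨x, hAx, hx⟩ := h3
    have hAx' : A x = 0 := by simpa using hAx
    refine ⟨x, hx, Set.eq_univ_of_forall fun y => ?_⟩
    have h4 : ∀ n : ℕ, ∃ u, C * ρ ^ (n + 1) * ‖u‖ ≤ ‖y‖ ∧
        ‖(A ^ (n + 1)) u - y‖ < 1 / ((n : ℝ) + 1) := fun n => by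
      refine exists_norm_apply_sub_lt (by positivity) (fun φ => ?_) y Nat.one_div_pos_of_nat
      have := hgrow (n + 1) φ
      rwa [← dualOp_pow] at this
    choose u hu1 hu2 using h4
    -- The exponents start at one so that each power kills the kernel vector `x`; the added `u n`
    -- alone then produces `y`, and its norm decays like `ρ^{-(n+1)}`.
    refine ⟨fun n => n + 1, fun n => x + u n, fun a b hab => Nat.succ_lt_succ hab, ?_, ?_⟩
    · have : Tendsto u atTop (𝓝 0) := by
        refine squeeze_zero_norm (a := fun n : ℕ => ‖y‖ / C * (ρ⁻¹) ^ (n + 1)) (fun n => ?_) ?_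
        · rw [inv_pow, ← div_eq_mul_inv, div_div, le_div_iff₀ (by positivity), mul_comm]
          exact hu1 n
        · have h5 := (tendsto_pow_atTop_nhds_zero_of_lt_one (r := ρ⁻¹) (by positivity)
            (inv_lt_one_of_one_lt₀ hρ)).comp (tendsto_add_atTop_nat 1)
          have h6 := h5.const_mul (‖y‖ / C)
          rwa [mul_zero] at h6
      simpa using this.const_add x
    · rw [tendsto_iff_norm_sub_tendsto_zero]
      refine squeeze_zero (fun n => norm_nonneg _) (fun n => ?_)
        tendsto_one_div_add_atTop_nhds_zero_nat
      have : (A ^ (n + 1)) x = 0 := by rw [pow_succ, mul_apply_eq_comp, hAx', map_zero]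
      rw [map_add, this, zero_add]
      exact (hu2 n).le

end Criterion

/-! ### The power series calculus and the approximate point spectrum. -/

section FunctionalCalculus

variable {E : Type*} [NormedAddCommGroup E] [NormedSpace ℂ E]
  {T : E →L[ℂ] E} {f : ℂ → ℂ} {R : ℝ}

theorem hasSum_apply {g : ℕ → E →L[ℂ] E} {G : E →L[ℂ] E} (h : HasSum g G) (x : E) :
    HasSum (fun n => g n x) (G x) :=
  (ContinuousLinearMap.apply ℂ E x).hasSum h

theorem norm_lt_of_mem_spectrum (hT : spectralRadius ℂ T < ENNReal.ofReal R) {z : ℂ}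
    (hz : z ∈ spectrum ℂ T) : ‖z‖ < R := by
  have h1 := le_iSup₂ (f := fun (k : ℂ) (_ : k ∈ spectrum ℂ T) => (‖k‖₊ : ℝ≥0∞)) z hz
  have h2 : (‖z‖₊ : ℝ≥0∞) < ENNReal.ofReal R := lt_of_le_of_lt h1 hT
  rw [← ENNReal.ofReal_coe_nnreal] at h2
  exact (ENNReal.ofReal_lt_ofReal_iff'.1 h2).1

variable [CompleteSpace E]

theorem exists_norm_pow_le {r : ℝ} (hr : 0 < r) (hT : spectralRadius ℂ T < ENNReal.ofReal r) :
    ∀ᶠ n : ℕ in atTop, ‖T ^ n‖ ≤ r ^ n := by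
  have h := spectrum.pow_norm_pow_one_div_tendsto_nhds_spectralRadius T
  filter_upwards [h.eventually_lt_const hT, eventually_ge_atTop 1] with n hn hn1
  have h1 : ‖T ^ n‖ ^ (1 / (n : ℝ)) < r := (ENNReal.ofReal_lt_ofReal_iff hr).1 hn
  have hn0 : (0 : ℝ) < n := by exact_mod_cast hn1
  calc ‖T ^ n‖ = (‖T ^ n‖ ^ (1 / (n : ℝ))) ^ (n : ℝ) := by
        rw [← Real.rpow_mul (norm_nonneg _), one_div_mul_cancel hn0.ne', Real.rpow_one]
    _ ≤ r ^ (n : ℝ) := by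
        gcongr
    _ = r ^ n := Real.rpow_natCast _ _

theorem hasSum_taylor (hf : DifferentiableOn ℂ f (Metric.ball 0 R)) {z : ℂ} (hz : ‖z‖ < R) :
    HasSum (fun n : ℕ => iteratedDeriv n f 0 / (n.factorial : ℂ) * z ^ n) (f z) := by
  have := Complex.hasSum_taylorSeries_on_ball hf (z := z) (by simpa using hz)
  refine this.congr_fun fun n => ?_
  simp only [sub_zero, smul_eq_mul]
  ring

/-- Comparison with the Taylor series at a radius `r` strictly between the spectral radius and `R`,
since `‖T^n‖ ≤ r^n` eventually. -/
theorem summable_norm_calcTerm (hT : spectralRadius ℂ T < ENNReal.ofReal R)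
    (hf : DifferentiableOn ℂ f (Metric.ball 0 R)) : Summable fun n => ‖calcTerm f T n‖ := by
  obtain ⟨r, hr1, hr2⟩ := ENNReal.lt_iff_exists_real_btwn.1 hT |>.imp fun r h => h.2
  have hr0 : 0 < r := by
    by_contra h0
    rw [ENNReal.ofReal_of_nonpos (not_lt.1 h0)] at hr1
    exact not_lt_bot hr1
  have hrR : r < R := (ENNReal.ofReal_lt_ofReal_iff'.1 hr2).1
  have hs := (hasSum_taylor hf (z := (r : ℂ))
    (by rwa [Complex.norm_real, Real.norm_of_nonneg hr0.le])).summable.norm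
  refine Summable.of_norm_bounded_eventually_nat hs ?_
  filter_upwards [exists_norm_pow_le hr0 hr1] with n hn
  have h1 : ‖(r : ℂ) ^ n‖ = r ^ n := by
    rw [norm_pow, Complex.norm_real, Real.norm_of_nonneg hr0.le]
  rw [norm_norm, calcTerm, norm_smul, norm_mul (iteratedDeriv n f 0 / _), h1]
  gcongr

theorem hasSum_calcTerm (hT : spectralRadius ℂ T < ENNReal.ofReal R)
    (hf : DifferentiableOn ℂ f (Metric.ball 0 R)) : HasSum (calcTerm f T) (funcCalc f T) :=
  (summable_norm_calcTerm hT hf).of_norm.hasSum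

theorem dualOp_funcCalc (hT : spectralRadius ℂ T < ENNReal.ofReal R)
    (hf : DifferentiableOn ℂ f (Metric.ball 0 R)) :
    dualOp (funcCalc f T) = funcCalc f (dualOp T) := by
  have h1 := ((ContinuousLinearMap.compL ℂ E E ℂ).flip).hasSum (hasSum_calcTerm hT hf)
  refine (h1.tsum_eq.symm.trans (tsum_congr fun n => ?_))
  change dualOp (calcTerm f T n) = _
  rw [calcTerm, calcTerm, ← dualOp_pow]
  ext φ x
  simp [dualOp_apply_apply]

/-- Approximate eigenvectors of `T` at `z` are approximate eigenvectors of each power at `z^k`, and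
dominated convergence sums these limits over the series. This gives one inclusion of the mapping
theorem. -/
theorem tendsto_funcCalc_sub (hT : spectralRadius ℂ T < ENNReal.ofReal R)
    (hf : DifferentiableOn ℂ f (Metric.ball 0 R)) {z : ℂ} (hz : ‖z‖ < R) {u : ℕ → E}
    (hu : ∀ n, ‖u n‖ = 1) (hTu : Tendsto (fun n => T (u n) - z • u n) atTop (𝓝 0)) :
    Tendsto (fun n => funcCalc f T (u n) - f z • u n) atTop (𝓝 0) := by
  have hpow : ∀ k : ℕ, Tendsto (fun n => (T ^ k) (u n) - z ^ k • u n) atTop (𝓝 0) := by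
    intro k
    induction k with
    | zero => simp
    | succ k ih =>
      have h1 := ((T.continuous.tendsto 0).comp ih).add (hTu.const_smul (z ^ k))
      rw [map_zero, smul_zero, add_zero] at h1
      refine h1.congr fun n => ?_
      simp only [Function.comp_apply, map_sub, map_smul, smul_sub, smul_smul, ← pow_succ]
      rw [pow_succ' T, mul_apply_eq_comp]
      abel
  have hs1 := summable_norm_calcTerm hT hf
  have hs2 := hasSum_taylor hf hz
  have hsum : ∀ n, funcCalc f T (u n) - f z • u n =
      ∑' k, (iteratedDeriv k f 0 / (k.factorial : ℂ)) • ((T ^ k) (u n) - z ^ k • u n) := by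
    intro n
    have h1 : HasSum (fun k => calcTerm f T k (u n)) (funcCalc f T (u n)) :=
      hasSum_apply (hasSum_calcTerm hT hf) (u n)
    have h2 := hs2.smul_const (u n)
    rw [← (h1.sub h2).tsum_eq]
    refine tsum_congr fun k => ?_
    rw [calcTerm, smul_apply, smul_sub, smul_smul]
  simp_rw [hsum]
  have h3 : (0 : E) = ∑' _ : ℕ, (0 : E) := tsum_zero.symm
  rw [h3]
  refine tendsto_tsum_of_dominated_convergence (hs1.add hs2.summable.norm) (fun k => ?_)
    (Eventually.of_forall fun n k => ?_)
  · have := (hpow k).const_smul (iteratedDeriv k f 0 / (k.factorial : ℂ))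
    rwa [smul_zero] at this
  · rw [smul_sub, smul_smul]
    refine (norm_sub_le _ _).trans ?_
    gcongr
    · have := (calcTerm f T k).le_opNorm (u n)
      rwa [hu, mul_one] at this
    · rw [norm_smul, hu, mul_one]

/-- As `f(T)` commutes with `T`, approximate null vectors of `f(T) - c` can be chosen to be
approximate eigenvectors of `T` at some `z`. On them `f(T)` acts asymptotically both as `c` and as
`f(z)`. -/
theorem exists_of_not_boundedBelow_funcCalc (hT : spectralRadius ℂ T < ENNReal.ofReal R)
    (hf : DifferentiableOn ℂ f (Metric.ball 0 R)) {c : ℂ}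
    (hc : ¬ BoundedBelow (funcCalc f T - c • (1 : E →L[ℂ] E))) :
    ∃ z ∈ approxPointSpectrum T, f z = c := by
  have hcomm : Commute (funcCalc f T - c • (1 : E →L[ℂ] E)) T := by
    refine Commute.sub_left ?_ ((Commute.one_left _).smul_left _)
    exact (Commute.tsum_right T fun n => ((Commute.refl T).pow_right n).smul_right _).symm
  obtain ⟨z, v, hv, h1, h2⟩ := exists_joint_approx hcomm hc
  have hz : z ∈ approxPointSpectrum T := ⟨v, hv, h2⟩
  refine ⟨z, hz, ?_⟩
  have h3 := tendsto_funcCalc_sub hT hf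
    (norm_lt_of_mem_spectrum hT (approxPointSpectrum_subset_spectrum T hz)) hv h2
  have h4 := (h1.sub h3).norm
  have h5 : ∀ n, ‖(funcCalc f T - c • (1 : E →L[ℂ] E)) (v n) - (funcCalc f T (v n) - f z • v n)‖ =
      ‖f z - c‖ := fun n => by
    have : (funcCalc f T - c • (1 : E →L[ℂ] E)) (v n) - (funcCalc f T (v n) - f z • v n) =
        (f z - c) • v n := by
      simp only [sub_apply, smul_apply, one_apply_eq_self, sub_smul]
      abel
    rw [this, norm_smul, hv, mul_one]
  simp only [h5, sub_zero, norm_zero] at h4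
  exact sub_eq_zero.1 (norm_eq_zero.1 (tendsto_nhds_unique tendsto_const_nhds h4))

theorem funcCalc_apply_eigenvector (hT : spectralRadius ℂ T < ENNReal.ofReal R)
    (hf : DifferentiableOn ℂ f (Metric.ball 0 R)) {z : ℂ} (hz : ‖z‖ < R) {x : E}
    (hx : T x = z • x) : funcCalc f T x = f z • x := by
  have h1 : HasSum (fun k => calcTerm f T k x) (funcCalc f T x) :=
    hasSum_apply (hasSum_calcTerm hT hf) x
  have hpow : ∀ k : ℕ, (T ^ k) x = z ^ k • x := fun k => by
    induction k with
    | zero => simp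
    | succ k ih => rw [pow_succ', mul_apply_eq_comp, ih, map_smul, hx, smul_smul, pow_succ]
  refine h1.unique (((hasSum_taylor hf hz).smul_const x).congr_fun fun k => ?_)
  rw [calcTerm, smul_apply, hpow, smul_smul]

/-- The spectral criterion for `f(T)` to be `J`-class, in terms of the spectra of `T^*`. -/
theorem isJClass_funcCalc_iff (hT : spectralRadius ℂ T < ENNReal.ofReal R)
    (hf : DifferentiableOn ℂ f (Metric.ball 0 R))
    (hA : ∀ μ : ℂ, Function.Injective
      (dualOp (funcCalc f T) - μ • (1 : StrongDual ℂ E →L[ℂ] StrongDual ℂ E)) →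
      BoundedBelow (dualOp (funcCalc f T) - μ • (1 : StrongDual ℂ E →L[ℂ] StrongDual ℂ E))) :
    IsJClass (funcCalc f T) ↔
      f '' approxPointSpectrum (dualOp T) ∩ Metric.closedBall 0 1 = ∅ ∧
      Metric.closedBall 0 1 ⊆
        f '' (spectrum ℂ (dualOp T) \ approxPointSpectrum (dualOp T)) := by
  have hT' : spectralRadius ℂ (dualOp T) < ENNReal.ofReal R := by
    rwa [spectralRadius, spectrum_dualOp]
  rw [isJClass_iff hA]
  have h1 : (∀ μ : ℂ, ‖μ‖ ≤ 1 →
      BoundedBelow (dualOp (funcCalc f T) - μ • (1 : StrongDual ℂ E →L[ℂ] StrongDual ℂ E))) ↔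
      f '' approxPointSpectrum (dualOp T) ∩ Metric.closedBall 0 1 = ∅ := by
    rw [dualOp_funcCalc hT hf]
    constructor
    · intro h
      refine Set.eq_empty_of_forall_notMem ?_
      rintro _ ⟨⟨z, hz, rfl⟩, hz1⟩
      have hzR := norm_lt_of_mem_spectrum hT' (approxPointSpectrum_subset_spectrum _ hz)
      obtain ⟨u, hu, hTu⟩ := hz
      exact not_boundedBelow_of_seq hu (tendsto_funcCalc_sub hT' hf hzR hu hTu)
        (h _ (mem_closedBall_zero_iff.1 hz1))
    · intro h μ hμ
      by_contra hcon
      obtain ⟨z, hz, rfl⟩ := exists_of_not_boundedBelow_funcCalc hT' hf hcon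
      exact Set.notMem_empty (f z) (h ▸ ⟨⟨z, hz, rfl⟩, mem_closedBall_zero_iff.2 hμ⟩)
  rw [h1]
  refine and_congr_right fun h => ?_
  constructor
  -- A kernel of `f(T) - c` gives `c = f(z)` with `z` in the approximate point spectrum of `T`
  -- itself, hence in the spectrum of `T*`. The first condition keeps `z` out of the approximate
  -- point spectrum of `T*`.
  · intro hinj c hc
    obtain ⟨z, hz, rfl⟩ := exists_of_not_boundedBelow_funcCalc hT hf
      (fun hb => hinj c (mem_closedBall_zero_iff.1 hc) hb.injective)
    refine ⟨z, ⟨?_, fun hza => ?_⟩, rfl⟩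
    · rw [spectrum_dualOp]
      exact approxPointSpectrum_subset_spectrum _ hz
    · exact Set.notMem_empty (f z) (h ▸ ⟨⟨z, hza, rfl⟩, hc⟩)
  -- Here `T* - z` is bounded below, so `T - z` is onto; not being invertible, it has a kernel,
  -- which lies in the kernel of `f(T) - f(z)`.
  · intro hsub μ hμ hinj
    obtain ⟨z, ⟨hz, hza⟩, rfl⟩ := hsub (mem_closedBall_zero_iff.2 hμ)
    rw [spectrum_dualOp] at hz
    rw [mem_approxPointSpectrum_iff, not_not, ← dualOp_sub_smul] at hza
    have hsurj := surjective_of_boundedBelow_dualOp hza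
    have hzR := norm_lt_of_mem_spectrum hT hz
    rw [mem_spectrum_iff_sub, ContinuousLinearMap.isUnit_iff_bijective] at hz
    refine hz ⟨(injective_iff_map_eq_zero _).2 fun x hx => ?_, hsurj⟩
    have hx' : T x = z • x := by rw [← sub_eq_zero]; exact hx
    refine (injective_iff_map_eq_zero _).1 hinj x ?_
    change funcCalc f T x - f z • x = 0
    rw [funcCalc_apply_eigenvector hT hf hzR hx', sub_self]

end FunctionalCalculus
end JClassOp
end

noncomputable section
namespace JClassOp

/-! ### Functionals on `l^∞` as finitely additive measures; lemmas of Rosenthal and Phillips. -/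

section Variation

theorem norm_coord_le (x : Linf) (n : ℕ) : ‖x n‖ ≤ ‖x‖ := lp.norm_apply_le_norm (by simp) x n

/-- A bounded sequence as an element of `l^∞`. -/
def linfMk (g : ℕ → ℂ) (h : ∃ C, ∀ n, ‖g n‖ ≤ C) : Linf :=
  ⟨g, memℓp_infty (by obtain ⟨C, hC⟩ := h; exact ⟨C, by rintro _ ⟨n, rfl⟩; exact hC n⟩)⟩

theorem linfMk_apply (g : ℕ → ℂ) (h : ∃ C, ∀ n, ‖g n‖ ≤ C) (n : ℕ) : linfMk g h n = g n := rfl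

/-- Multiplication by the indicator function of `s`. -/
def cutoff (s : Set ℕ) : Linf →L[ℂ] Linf :=
  LinearMap.mkContinuous
    { toFun := fun x => linfMk (s.indicator x)
        ⟨‖x‖, fun n => (norm_indicator_le_norm_self x n).trans (norm_coord_le x n)⟩
      map_add' := fun x y => by
        ext n
        exact congrFun (Set.indicator_add s x y) n
      map_smul' := fun c x => by
        ext n
        exact congrFun (Set.indicator_const_smul s c x) n }
    1
    (fun x => by
      rw [one_mul]
      exact lp.norm_le_of_forall_le (norm_nonneg _) fun n =>
        (norm_indicator_le_norm_self x n).trans (norm_coord_le x n))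

theorem cutoff_apply (s : Set ℕ) (x : Linf) (n : ℕ) : cutoff s x n = s.indicator x n := rfl

theorem cutoff_apply_of_mem {s : Set ℕ} (x : Linf) {n : ℕ} (hn : n ∈ s) : cutoff s x n = x n :=
  Set.indicator_of_mem hn x

theorem cutoff_apply_of_notMem {s : Set ℕ} (x : Linf) {n : ℕ} (hn : n ∉ s) : cutoff s x n = 0 :=
  Set.indicator_of_notMem hn x

theorem norm_cutoff_apply_le (s : Set ℕ) (x : Linf) : ‖cutoff s x‖ ≤ ‖x‖ :=
  lp.norm_le_of_forall_le (norm_nonneg _) fun n =>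
    (norm_indicator_le_norm_self x n).trans (norm_coord_le x n)

theorem cutoff_cutoff (s t : Set ℕ) (x : Linf) : cutoff s (cutoff t x) = cutoff (s ∩ t) x := by
  ext n
  simp only [cutoff_apply]
  by_cases hs : n ∈ s <;> by_cases ht : n ∈ t <;>
    simp [Set.indicator, hs, ht, cutoff_apply]

theorem cutoff_union_of_disjoint {s t : Set ℕ} (h : Disjoint s t) (x : Linf) :
    cutoff (s ∪ t) x = cutoff s x + cutoff t x := by
  ext n
  exact congrFun (Set.indicator_union_of_disjoint h x) n

theorem cutoff_univ (x : Linf) : cutoff Set.univ x = x := by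
  ext n
  exact cutoff_apply_of_mem x (Set.mem_univ n)

/-- The total variation on `s` of a functional on `l^∞`. -/
def variation (φ : StrongDual ℂ Linf) (s : Set ℕ) : ℝ := ‖φ ∘L cutoff s‖

variable {φ : StrongDual ℂ Linf} {s t : Set ℕ}

theorem variation_nonneg : 0 ≤ variation φ s := norm_nonneg _

theorem norm_apply_cutoff_le (φ : StrongDual ℂ Linf) (s : Set ℕ) (x : Linf) :
    ‖φ (cutoff s x)‖ ≤ variation φ s * ‖x‖ := (φ ∘L cutoff s).le_opNorm x

theorem variation_le {C : ℝ} (hC : 0 ≤ C) (h : ∀ x, ‖φ (cutoff s x)‖ ≤ C * ‖x‖) :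
    variation φ s ≤ C := ContinuousLinearMap.opNorm_le_bound _ hC h

theorem variation_le_norm : variation φ s ≤ ‖φ‖ :=
  variation_le (norm_nonneg _) fun x => (φ.le_opNorm _).trans (by
    gcongr; exact norm_cutoff_apply_le s x)

theorem norm_le_variation_univ : ‖φ‖ ≤ variation φ Set.univ :=
  ContinuousLinearMap.opNorm_le_bound _ variation_nonneg fun x => by
    have := norm_apply_cutoff_le φ Set.univ x
    rwa [cutoff_univ] at this

theorem variation_mono (h : s ⊆ t) : variation φ s ≤ variation φ t := by
  refine variation_le variation_nonneg fun x => ?_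
  rw [← Set.inter_eq_right.2 h, ← cutoff_cutoff]
  exact (norm_apply_cutoff_le φ t _).trans (by
    gcongr
    · exact variation_nonneg
    · exact norm_cutoff_apply_le s x)

theorem variation_union_le : variation φ (s ∪ t) ≤ variation φ s + variation φ t := by
  refine variation_le (add_nonneg variation_nonneg variation_nonneg) fun x => ?_
  rw [← Set.union_sdiff_self, cutoff_union_of_disjoint Set.disjoint_sdiff_right, map_add, add_mul]
  refine (norm_add_le _ _).trans ?_
  gcongr
  · exact norm_apply_cutoff_le φ s x
  · refine (norm_apply_cutoff_le φ _ x).trans ?_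
    gcongr
    exact variation_mono Set.sdiff_subset

theorem exists_apply_gt_of_lt_variation {r : ℝ} (h : r < variation φ s) :
    ∃ x : Linf, ‖x‖ ≤ 1 ∧ cutoff s x = x ∧ ∃ a : ℝ, r < a ∧ φ x = a := by
  obtain ⟨x, hx1, hx2⟩ := (φ ∘L cutoff s).exists_lt_apply_of_lt_opNorm h
  change r < ‖φ (cutoff s x)‖ at hx2
  obtain ⟨w, hw1, hw2⟩ : ∃ w : ℂ, ‖w‖ = 1 ∧ w * φ (cutoff s x) = ‖φ (cutoff s x)‖ := by
    by_cases h0 : φ (cutoff s x) = 0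
    · exact ⟨1, by simp, by simp [h0]⟩
    · refine ⟨‖φ (cutoff s x)‖ / φ (cutoff s x), ?_, div_mul_cancel₀ _ h0⟩
      rw [norm_div, Complex.norm_real, norm_norm, div_self (norm_ne_zero_iff.2 h0)]
  refine ⟨w • cutoff s x, ?_, ?_, _, hx2, ?_⟩
  · rw [norm_smul, hw1, one_mul]
    exact (norm_cutoff_apply_le s x).trans hx1.le
  · rw [map_smul, cutoff_cutoff, Set.inter_self]
  · rw [map_smul, smul_eq_mul, hw2]

/-- Nearly norming vectors supported on disjoint sets can be added without the supremum norm
exceeding one. Together with `variation_union_le` this makes the variation additive on disjoint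
sets. -/
theorem variation_add_le (h : Disjoint s t) :
    variation φ s + variation φ t ≤ variation φ (s ∪ t) := by
  refine le_of_forall_pos_lt_add fun ε hε => ?_
  obtain ⟨x, hx1, hx2, a, ha, hxa⟩ := exists_apply_gt_of_lt_variation
    (sub_lt_self (variation φ s) (half_pos hε))
  obtain ⟨y, hy1, hy2, b, hb, hyb⟩ := exists_apply_gt_of_lt_variation
    (sub_lt_self (variation φ t) (half_pos hε))
  have hxy : ‖x + y‖ ≤ 1 := by
    refine lp.norm_le_of_forall_le zero_le_one fun n => ?_
    rw [lp.coeFn_add, Pi.add_apply, ← hx2, ← hy2]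
    by_cases hn : n ∈ s
    · rw [cutoff_apply_of_notMem y (Set.disjoint_left.1 h hn), add_zero, hx2]
      exact (norm_coord_le x n).trans hx1
    · rw [cutoff_apply_of_notMem x hn, zero_add, hy2]
      exact (norm_coord_le y n).trans hy1
  have h1 := norm_apply_cutoff_le φ (s ∪ t) (x + y)
  have hxs : cutoff (s ∪ t) x = x := by
    rw [← hx2, cutoff_cutoff, Set.inter_eq_right.2 Set.subset_union_left]
  have hyt : cutoff (s ∪ t) y = y := by
    rw [← hy2, cutoff_cutoff, Set.inter_eq_right.2 Set.subset_union_right]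
  rw [map_add, hxs, hyt, map_add, hxa, hyb, ← Complex.ofReal_add, Complex.norm_real] at h1
  have h2 : variation φ (s ∪ t) * ‖x + y‖ ≤ variation φ (s ∪ t) * 1 :=
    mul_le_mul_of_nonneg_left hxy variation_nonneg
  have h3 := Real.le_norm_self (a + b)
  linarith

theorem norm_apply_le_variation_add (φ : StrongDual ℂ Linf) {x : Linf} {δ : ℝ} (hδ : 0 ≤ δ)
    (h : ∀ n ∉ s, ‖x n‖ ≤ δ) : ‖φ x‖ ≤ variation φ s * ‖x‖ + ‖φ‖ * δ := by
  have h1 : x = cutoff s x + cutoff sᶜ x := by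
    rw [← cutoff_union_of_disjoint disjoint_compl_right, Set.union_compl_self, cutoff_univ]
  have h2 : ‖cutoff sᶜ x‖ ≤ δ := lp.norm_le_of_forall_le hδ fun n => by
    by_cases hn : n ∈ s
    · rw [cutoff_apply_of_notMem x (by simpa using hn), norm_zero]; exact hδ
    · rw [cutoff_apply_of_mem x hn]; exact h n hn
  calc ‖φ x‖ = ‖φ (cutoff s x) + φ (cutoff sᶜ x)‖ := by rw [← map_add, ← h1]
    _ ≤ _ := (norm_add_le _ _).trans (by
      gcongr
      · exact norm_apply_cutoff_le φ s x
      · exact φ.le_opNorm_of_le h2)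

theorem sum_variation_le (φ : StrongDual ℂ Linf) {G : ℕ → Set ℕ}
    (hG : Pairwise (Function.onFun Disjoint G)) (u : Finset ℕ) :
    ∑ j ∈ u, variation φ (G j) ≤ variation φ (⋃ j ∈ u, G j) := by
  classical
  induction u using Finset.induction_on with
  | empty => simpa using variation_nonneg
  | insert a u ha ih =>
    rw [Finset.sum_insert ha, Finset.set_biUnion_insert]
    refine (add_le_add le_rfl ih).trans (variation_add_le ?_)
    rw [Set.disjoint_iUnion₂_right]
    intro i hi
    exact hG (fun h => ha (h ▸ hi))

theorem tendsto_variation_of_disjoint (φ : StrongDual ℂ Linf) {G : ℕ → Set ℕ}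
    (hG : Pairwise (Function.onFun Disjoint G)) :
    Tendsto (fun j => variation φ (G j)) atTop (𝓝 0) :=
  (summable_of_sum_le (fun _ => variation_nonneg)
    fun u => (sum_variation_le φ hG u).trans variation_le_norm).tendsto_atTop_zero

theorem exists_infinite_partition {N : Set ℕ} (hN : N.Infinite) :
    ∃ M : ℕ → Set ℕ, (∀ p, (M p).Infinite) ∧ (∀ p, M p ⊆ N) ∧
      Pairwise (Function.onFun Disjoint M) := by
  let e := hN.natEmbedding
  have he : Function.Injective fun k => (e k : ℕ) := fun a b h => e.injective (Subtype.ext h)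
  refine ⟨fun p => Set.range fun k => (e (Nat.pair p k) : ℕ), fun p => ?_, fun p => ?_, ?_⟩
  · refine Set.infinite_range_of_injective fun a b h => ?_
    exact (Nat.pair_eq_pair.1 (he h)).2
  · rintro _ ⟨k, rfl⟩
    exact (e _).2
  · intro p q hpq
    refine Set.disjoint_left.2 ?_
    rintro _ ⟨k, rfl⟩ ⟨l, hl⟩
    exact hpq (Nat.pair_eq_pair.1 (he hl)).1.symm

/-- Rosenthal's disjointification lemma. -/
theorem exists_infinite_variation_le {φ : ℕ → StrongDual ℂ Linf} {G : ℕ → Set ℕ}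
    (hG : Pairwise (Function.onFun Disjoint G)) {δ : ℝ} (hδ : 0 ≤ δ) (q : ℕ) :
    ∀ N : Set ℕ, N.Infinite → (∀ j ∈ N, variation (φ j) (⋃ i ∈ N, G i) ≤ q * δ) →
      ∃ M ⊆ N, M.Infinite ∧ ∀ j ∈ M, variation (φ j) (⋃ i ∈ M \ {j}, G i) ≤ δ := by
  induction q with
  | zero =>
    intro N hN h
    refine ⟨N, subset_rfl, hN, fun j hj => ?_⟩
    refine (variation_mono (Set.biUnion_subset_biUnion_left Set.sdiff_subset)).trans
      ((h j hj).trans ?_)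
    simpa using hδ
  | succ q ih =>
    intro N hN h
    obtain ⟨M, hM, hMN, hMd⟩ := exists_infinite_partition hN
    by_cases hex : ∃ p, ∀ j ∈ M p, variation (φ j) (⋃ i ∈ M p \ {j}, G i) ≤ δ
    · obtain ⟨p, hp⟩ := hex
      exact ⟨M p, hMN p, hM p, hp⟩
    push Not at hex
    -- Every piece `M p` contains a bad index `j p`, whose functional has variation above `δ` on the
    -- rest of that piece. The range of `j` meets `M p` only in `j p`, so restricting to this range
    -- lowers the available variation by `δ`, and the induction on `q` proceeds.
    choose j hjM hj using hex
    have hjinj : Function.Injective j := fun p p' hpp => by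
      by_contra hne
      exact Set.disjoint_left.1 (hMd hne) (hjM p) (hpp ▸ hjM p')
    obtain ⟨M', hM'N, hM'⟩ := ih (Set.range j) (Set.infinite_range_of_injective hjinj) (by
      rintro _ ⟨p, rfl⟩
      have hdisj : Disjoint (⋃ i ∈ Set.range j, G i) (⋃ i ∈ M p \ {j p}, G i) := by
        simp only [Set.disjoint_iUnion_left, Set.disjoint_iUnion_right]
        rintro i ⟨hi, hij⟩ _ ⟨p', rfl⟩
        refine hG fun heq => ?_
        subst heq
        have hpp : p' ≠ p := fun h => hij (by rw [h]; rfl)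
        exact Set.disjoint_left.1 (hMd hpp) (hjM p') hi
      have h1 := variation_add_le (φ := φ (j p)) hdisj
      have h2 : (⋃ i ∈ Set.range j, G i) ∪ (⋃ i ∈ M p \ {j p}, G i) ⊆ ⋃ i ∈ N, G i := by
        refine Set.union_subset (Set.biUnion_subset_biUnion_left ?_)
          (Set.biUnion_subset_biUnion_left (Set.sdiff_subset.trans (hMN p)))
        rintro _ ⟨p', rfl⟩
        exact hMN p' (hjM p')
      have h3 := (h1.trans (variation_mono h2)).trans (h (j p) (hMN p (hjM p)))
      have h4 := hj p
      push_cast at h3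
      linarith)
    refine ⟨M', hM'N.trans ?_, hM'⟩
    rintro _ ⟨p, rfl⟩
    exact hMN p (hjM p)

/-- Disjointly supported unit-ball vectors combine into one vector of the unit ball, which serves as
a single test vector for a whole sequence of functionals. -/
theorem exists_glue {G : ℕ → Set ℕ} (hG : Pairwise (Function.onFun Disjoint G)) (M : Set ℕ)
    {x : ℕ → Linf} (hx : ∀ i, ‖x i‖ ≤ 1) (hxG : ∀ i, cutoff (G i) (x i) = x i) :
    ∃ y : Linf, ‖y‖ ≤ 1 ∧ ∀ i ∈ M, y = x i + cutoff (⋃ l ∈ M \ {i}, G l) y := by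
  classical
  let g : ℕ → ℂ := fun n => if h : ∃ i ∈ M, n ∈ G i then x h.choose n else 0
  have hg : ∀ i ∈ M, ∀ n ∈ G i, g n = x i n := fun i hi n hn => by
    have h : ∃ i ∈ M, n ∈ G i := ⟨i, hi, hn⟩
    have heq : h.choose = i := by
      by_contra hne
      exact Set.disjoint_left.1 (hG hne) h.choose_spec.2 hn
    simp only [g, dif_pos h, heq]
  have hgn : ∀ n, ‖g n‖ ≤ 1 := fun n => by
    by_cases h : ∃ i ∈ M, n ∈ G i
    · simp only [g, dif_pos h]; exact (norm_coord_le _ n).trans (hx _)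
    · simp only [g, dif_neg h, norm_zero]; exact zero_le_one
  refine ⟨linfMk g ⟨1, hgn⟩, lp.norm_le_of_forall_le zero_le_one hgn, fun i hi => ?_⟩
  ext n
  rw [lp.coeFn_add, Pi.add_apply, linfMk_apply]
  by_cases hn : n ∈ G i
  · have h1 : n ∉ ⋃ l ∈ M \ {i}, G l := by
      simp only [Set.mem_iUnion, not_exists]
      intro l hl hnl
      exact Set.disjoint_left.1 (hG hl.2) hnl hn
    rw [cutoff_apply_of_notMem _ h1, add_zero, hg i hi n hn]
  · rw [← hxG i, cutoff_apply_of_notMem _ hn, zero_add]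
    by_cases h1 : n ∈ ⋃ l ∈ M \ {i}, G l
    · rw [cutoff_apply_of_mem _ h1, linfMk_apply]
    · rw [cutoff_apply_of_notMem _ h1]
      have h2 : ¬ ∃ l ∈ M, n ∈ G l := by
        rintro ⟨l, hl, hnl⟩
        by_cases hli : l = i
        · exact hn (hli ▸ hnl)
        · exact h1 (Set.mem_biUnion (show l ∈ M \ {i} from ⟨hl, hli⟩) hnl)
      simp only [g, dif_neg h2]

/-- A bounded weak-star null sequence of functionals on `l^∞` is uniformly strongly additive
(Phillips' lemma). -/
theorem exists_forall_variation_lt {φ : ℕ → StrongDual ℂ Linf} {K : ℝ} (hK : ∀ n, ‖φ n‖ ≤ K)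
    (hφ : ∀ y, Tendsto (fun n => φ n y) atTop (𝓝 0)) {G : ℕ → Set ℕ}
    (hG : Pairwise (Function.onFun Disjoint G)) {ε : ℝ} (hε : 0 < ε) :
    ∃ J, ∀ j ≥ J, ∀ n, variation (φ n) (G j) < ε := by
  by_contra! hcon
  -- Any finite set of functionals is uniformly small on late sets of the family, so a failure of
  -- uniformity pushes both indices to infinity.
  have h1 : ∀ N, ∃ j ≥ N, ∃ n ≥ N, ε ≤ variation (φ n) (G j) := by
    intro N
    have h2 : ∀ᶠ j in atTop, ∀ n ∈ Finset.range N, variation (φ n) (G j) < ε :=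
      (Finset.eventually_all _).2 fun n _ =>
        (tendsto_variation_of_disjoint (φ n) hG).eventually_lt_const hε
    obtain ⟨J, hJ⟩ := eventually_atTop.1 h2
    obtain ⟨j, hj, n, hn⟩ := hcon (max J N)
    refine ⟨j, (le_max_right _ _).trans hj, n, ?_, hn⟩
    by_contra hnN
    exact absurd (hJ j ((le_max_left _ _).trans hj) n (Finset.mem_range.2 (not_le.1 hnN)))
      (not_lt.2 hn)
  choose j hj n hn hjn using h1
  have hjt : Tendsto j atTop atTop := tendsto_atTop_mono hj tendsto_id
  have hnt : Tendsto n atTop atTop := tendsto_atTop_mono hn tendsto_id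
  obtain ⟨κ, hκ, hjκ⟩ := strictMono_subseq_of_tendsto_atTop hjt
  let ψ : ℕ → StrongDual ℂ Linf := fun i => φ (n (κ i))
  let H : ℕ → Set ℕ := fun i => G (j (κ i))
  have hH : Pairwise (Function.onFun Disjoint H) := fun a b hab => hG (hjκ.injective.ne hab)
  have hψH : ∀ i, ε / 2 < variation (ψ i) (H i) := fun i => (half_lt_self hε).trans_le (hjn _)
  obtain ⟨q, hq⟩ := exists_nat_gt (K / (ε / 4))
  rw [div_lt_iff₀ (by positivity)] at hq
  obtain ⟨M, -, hMinf, hM⟩ := exists_infinite_variation_le (φ := ψ) hH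
    (δ := ε / 4) (by positivity) q Set.univ Set.infinite_univ
    (fun i _ => (variation_le_norm.trans (hK _)).trans hq.le)
  choose x hx1 hxH a ha hxa using fun i => exists_apply_gt_of_lt_variation (hψH i)
  obtain ⟨y, hy1, hy⟩ := exists_glue hH M hx1 hxH
  -- On `y`, the diagonal part of `ψ i` exceeds `ε / 2` and the part outside `H i` contributes at
  -- most `ε / 4`, which is incompatible with `φ n y → 0`.
  have hlow : ∀ i ∈ M, ε / 4 ≤ ‖ψ i y‖ := fun i hi => by
    have h2 : ψ i y = a i + ψ i (cutoff (⋃ l ∈ M \ {i}, H l) y) := by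
      rw [← hxa, ← map_add, ← hy i hi]
    have h3 := (norm_apply_cutoff_le (ψ i) (⋃ l ∈ M \ {i}, H l) y).trans
      (mul_le_mul (hM i hi) hy1 (norm_nonneg _) (by positivity))
    have h4 : ‖(a i : ℂ)‖ ≤ ‖ψ i y‖ + ‖ψ i (cutoff (⋃ l ∈ M \ {i}, H l) y)‖ := by
      rw [eq_sub_of_add_eq h2.symm]; exact norm_sub_le _ _
    rw [Complex.norm_real] at h4
    have h5 := Real.le_norm_self (a i)
    have h6 := ha i
    linarith
  have hlim := ((hφ y).comp (hnt.comp hκ.tendsto_atTop)).norm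
  rw [norm_zero] at hlim
  obtain ⟨N, hN⟩ := eventually_atTop.1 (hlim.eventually_lt_const (show 0 < ε / 4 by positivity))
  obtain ⟨i, hi, hNi⟩ := hMinf.exists_gt N
  exact absurd (hN i hNi.le) (not_lt.2 (hlow i hi))

end Variation
end JClassOp
end

noncomputable section
namespace JClassOp

/-! ### Schur's theorem for `l^1`. -/

section Schur

/-- The functional on `l^∞` defined by an element of `l^1`. -/
def evalL1 : L1 →L[ℂ] StrongDual ℂ Linf := toDual.flip

theorem evalL1_apply (x : L1) (y : Linf) : evalL1 x y = toDual y x := rfl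

theorem norm_le_norm_evalL1 (x : L1) : ‖x‖ ≤ ‖evalL1 x‖ := by
  by_cases hx : x = 0
  · simp [hx]
  obtain ⟨φ, hφ, hφx⟩ := exists_dual_vector ℂ x (norm_ne_zero_iff.2 hx)
  have h1 : ‖ofDual φ‖ ≤ 1 := lp.norm_le_of_forall_le zero_le_one fun n =>
    (norm_dual_single_le φ n).trans_eq hφ
  have h2 := (evalL1 x).le_opNorm_of_le h1
  rw [evalL1_apply, toDual_ofDual, hφx, mul_one] at h2
  exact (norm_norm x).symm.trans_le ((Complex.norm_real _).symm.trans_le h2)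

theorem norm_evalL1_le (x : L1) : ‖evalL1 x‖ ≤ ‖x‖ := by
  refine ContinuousLinearMap.opNorm_le_bound _ (norm_nonneg _) fun y => ?_
  rw [evalL1_apply, toDual_apply]
  have hs : Summable fun n => ‖x n‖ := by
    simpa using (lp.memℓp x).summable (by norm_num)
  have hn : ‖x‖ = ∑' n, ‖x n‖ := by
    have := lp.norm_eq_tsum_rpow (p := 1) (by norm_num) x
    simpa using this
  rw [hn, mul_comm, ← tsum_mul_left]
  refine tsum_of_norm_bounded (hs.mul_left ‖y‖).hasSum fun n => ?_
  rw [norm_mul]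
  gcongr
  exact norm_coord_le y n

theorem toDual_cutoff (s : Set ℕ) (y : Linf) (x : L1) :
    toDual (cutoff s y) x = ∑' n, s.indicator (fun n => y n * x n) n := by
  rw [toDual_apply]
  refine tsum_congr fun n => ?_
  rw [cutoff_apply]
  by_cases hn : n ∈ s <;> simp [hn]

theorem tendsto_variation_Ici (x : L1) :
    Tendsto (fun N => variation (evalL1 x) (Set.Ici N)) atTop (𝓝 0) := by
  have hs : HasSum (fun n => lp.single 1 n (x n)) x := lp.hasSum_single (by norm_num) x
  have h1 := hs.tendsto_sum_nat
  refine squeeze_zero (fun _ => variation_nonneg) (fun N => ?_)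
    (tendsto_iff_norm_sub_tendsto_zero.1 h1)
  have hz : ∀ y, evalL1 (∑ n ∈ Finset.range N, lp.single 1 n (x n)) (cutoff (Set.Ici N) y) = 0 := by
    intro y
    rw [evalL1_apply, map_sum]
    refine Finset.sum_eq_zero fun n hn => ?_
    have h2 : lp.single 1 n (x n) = x n • lp.single (E := fun _ : ℕ => ℂ) 1 n (1 : ℂ) := by
      rw [← lp.single_smul, smul_eq_mul, mul_one]
    rw [h2, map_smul, toDual_single, cutoff_apply_of_notMem, smul_zero]
    simpa using Finset.mem_range.1 hn
  refine variation_le (norm_nonneg _) fun y => ?_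
  have h3 : evalL1 x (cutoff (Set.Ici N) y) =
      -evalL1 (∑ n ∈ Finset.range N, lp.single 1 n (x n) - x) (cutoff (Set.Ici N) y) := by
    rw [map_sub, sub_apply, hz, zero_sub, neg_neg]
  rw [h3, norm_neg]
  refine ((evalL1 _).le_opNorm _).trans ?_
  gcongr
  · exact norm_evalL1_le _
  · exact norm_cutoff_apply_le _ y

theorem variation_Iio_le (x : L1) (N : ℕ) :
    variation (evalL1 x) (Set.Iio N) ≤ ∑ n ∈ Finset.range N, ‖x n‖ := by
  refine variation_le (Finset.sum_nonneg fun _ _ => norm_nonneg _) fun y => ?_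
  rw [evalL1_apply, toDual_cutoff, tsum_eq_sum (s := Finset.range N) fun n hn =>
    Set.indicator_of_notMem (by simpa using hn) _, Finset.sum_mul]
  refine (norm_sum_le _ _).trans (Finset.sum_le_sum fun n _ => ?_)
  refine (norm_indicator_le_norm_self _ _).trans ?_
  rw [norm_mul, mul_comm]
  gcongr
  exact norm_coord_le y n

/-- Schur's theorem: weakly null sequences in `l^1` do not lie on the unit sphere. -/
theorem not_weakly_null_of_norm_eq_one {x : ℕ → L1} (hx : ∀ n, ‖x n‖ = 1)
    (hw : ∀ y, Tendsto (fun n => evalL1 (x n) y) atTop (𝓝 0)) : False := by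
  have hK : ∀ n, ‖evalL1 (x n)‖ ≤ 1 := fun n => (norm_evalL1_le _).trans_eq (hx n)
  -- Gliding hump: without a uniform tail bound there would be consecutive disjoint blocks each
  -- carrying variation at least `1 / 4` for some functional, contrary to Phillips' lemma. With it,
  -- the remaining finite head vanishes coordinate by coordinate.
  have htail : ∃ N, ∀ n, variation (evalL1 (x n)) (Set.Ici N) < 1 / 2 := by
    by_contra! hcon
    have h1 : ∀ N, ∃ N' > N, ∃ n, 1 / 4 ≤ variation (evalL1 (x n)) (Set.Ico N N') := fun N => by
      obtain ⟨n, hn⟩ := hcon N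
      obtain ⟨N', hN', hlt⟩ := (((tendsto_variation_Ici (x n)).eventually_lt_const
        (show (0 : ℝ) < 1 / 4 by norm_num)).and (eventually_gt_atTop N)).exists
      refine ⟨N', hlt, n, ?_⟩
      have h2 := variation_union_le (φ := evalL1 (x n)) (s := Set.Ico N N') (t := Set.Ici N')
      rw [Set.Ico_union_Ici_eq_Ici hlt.le] at h2
      linarith
    choose g hg n hn using h1
    let a : ℕ → ℕ := fun i => g^[i] 0
    have ha : ∀ i, a (i + 1) = g (a i) := fun i => Function.iterate_succ_apply' _ _ _
    have hmono : Monotone a := monotone_nat_of_le_succ fun i => by rw [ha]; exact (hg _).le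
    have hdisj : Pairwise (Function.onFun Disjoint fun i => Set.Ico (a i) (a (i + 1))) :=
      hmono.pairwise_disjoint_on_Ico_succ
    obtain ⟨J, hJ⟩ := exists_forall_variation_lt hK hw hdisj (show (0 : ℝ) < 1 / 4 by norm_num)
    have h3 := hJ J le_rfl (n (a J))
    rw [ha] at h3
    exact absurd (hn (a J)) (not_le.2 h3)
  obtain ⟨N, hN⟩ := htail
  have hcoord : Tendsto (fun n => ∑ k ∈ Finset.range N, ‖x n k‖) atTop (𝓝 0) := by
    rw [← Finset.sum_const_zero (s := Finset.range N) (ι := ℕ)]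
    refine tendsto_finsetSum _ fun k _ => ?_
    obtain ⟨e, he⟩ : ∃ e : Linf, ∀ n, e n = if n = k then 1 else 0 :=
      ⟨linfMk (fun n => if n = k then 1 else 0) ⟨1, fun n => by split_ifs <;> simp⟩, fun _ => rfl⟩
    have h1 := (hw e).norm
    rw [norm_zero] at h1
    refine h1.congr fun n => ?_
    rw [evalL1_apply, toDual_apply, tsum_eq_single k]
    · simp [he]
    · intro m hm
      simp [he, hm]
  obtain ⟨n, hn⟩ := (hcoord.eventually_lt_const (show (0 : ℝ) < 1 / 2 by norm_num)).exists
  have h1 := norm_le_variation_univ (φ := evalL1 (x n))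
  rw [← Set.Iio_union_Ici (a := N)] at h1
  have h2 := norm_le_norm_evalL1 (x n)
  rw [hx] at h2
  have h3 := variation_Iio_le (x n) N
  have h4 := hN n
  have h5 := variation_union_le (φ := evalL1 (x n)) (s := Set.Iio N) (t := Set.Ici N)
  linarith

end Schur

/-! ### Exhaustive submeasures and ultrafilter limits. -/

section Submeasure

/-- For an exhaustive submeasure, infinitely many members of a sequence of sets of submeasure
bounded away from zero belong to a common ultrafilter. -/
theorem exists_ultrafilter_frequently {η : Set ℕ → ℝ} (hmono : ∀ s t, s ⊆ t → η s ≤ η t)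
    (hsub : ∀ s t, η (s ∪ t) ≤ η s + η t)
    (hexh : ∀ G : ℕ → Set ℕ, Pairwise (Function.onFun Disjoint G) →
      Tendsto (fun j => η (G j)) atTop (𝓝 0))
    {A : ℕ → Set ℕ} {ε : ℝ} (hε : 0 < ε) (hA : ∀ n, ε ≤ η (A n)) :
    ∃ U : Ultrafilter ℕ, ∃ᶠ n in atTop, A n ∈ U := by
  have h0 : η ∅ = 0 := tendsto_nhds_unique tendsto_const_nhds
    (hexh (fun _ => ∅) fun _ _ _ => Set.disjoint_empty _)
  let V : ℕ → ℕ → Set ℕ := fun n m => ⋃ i ∈ Finset.Icc n m, A i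
  have hV : ∀ n m m', m ≤ m' → V n m ⊆ V n m' := fun n m m' h =>
    Set.biUnion_subset_biUnion_left (Finset.Icc_subset_Icc_right h)
  -- The increasing unions `V n m` stabilise in `m` up to submeasure `e`; otherwise their successive
  -- increments would be disjoint sets of submeasure at least `e`.
  have h1 : ∀ n, ∀ e > 0, ∃ m, ∀ m' ≥ m, η (V n m' \ V n m) < e := by
    intro n e he
    by_contra! hcon
    choose g hg hge using hcon
    let a : ℕ → ℕ := fun i => g^[i] 0
    have ha : ∀ i, a (i + 1) = g (a i) := fun i => Function.iterate_succ_apply' _ _ _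
    have ham : Monotone a := monotone_nat_of_le_succ fun i => by rw [ha]; exact hg _
    have hd : Pairwise (Function.onFun Disjoint fun i => V n (a (i + 1)) \ V n (a i)) := by
      refine (pairwise_disjoint_on _).2 fun i j hij => ?_
      refine Set.disjoint_left.2 fun k hk hk' => hk'.2 ?_
      exact hV n _ _ (ham hij) hk.1
    obtain ⟨j, hj⟩ := ((hexh _ hd).eventually_lt_const he).exists
    rw [ha] at hj
    exact absurd (hge (a j)) (not_le.2 hj)
  -- The tolerances sum to `ε / 2`, so late sets `A M` lose less than `ε` when intersected with
  -- finitely many `V n (m n)`. Hence these sets have the finite intersection property.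
  choose m hm using fun n => h1 n (ε / 2 ^ (n + 2)) (by positivity)
  let I : ℕ → Set ℕ := fun N => ⋂ n ∈ Finset.range N, V n (m n)
  have hI : ∀ N, ∀ᶠ M in atTop, η (A M) ≤ η (A M ∩ I N) + ε / 2 * (1 - (1 / 2) ^ N) := by
    intro N
    induction N with
    | zero =>
      refine Eventually.of_forall fun M => ?_
      simp [I]
    | succ N ih =>
      filter_upwards [ih, eventually_ge_atTop N, eventually_ge_atTop (m N)] with M hM hN hmN
      have h2 : A M ∩ I N ⊆ (A M ∩ I (N + 1)) ∪ (V N M \ V N (m N)) := by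
        rintro k ⟨hkA, hkI⟩
        by_cases hk : k ∈ V N (m N)
        · refine Or.inl ⟨hkA, ?_⟩
          simp only [I, Finset.range_add_one, Finset.set_biInter_insert]
          exact ⟨hk, hkI⟩
        · refine Or.inr ⟨?_, hk⟩
          exact Set.mem_biUnion (show M ∈ Finset.Icc N M from Finset.mem_Icc.2 ⟨hN, le_rfl⟩) hkA
      have h3 := (hmono _ _ h2).trans (hsub _ _)
      have h4 := hm N M hmN
      have h5 : ε / 2 * (1 - (1 / 2) ^ N) + ε / 2 ^ (N + 2) = ε / 2 * (1 - (1 / 2) ^ (N + 1)) := by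
        rw [one_div, inv_pow, inv_pow, pow_succ, pow_succ]
        field_simp
        ring
      linarith
  have hne : ∀ N, (I N).Nonempty := fun N => by
    by_contra hcon
    rw [Set.not_nonempty_iff_eq_empty] at hcon
    obtain ⟨M, hM⟩ := (hI N).exists
    rw [hcon, Set.inter_empty, h0, zero_add] at hM
    have h2 := hA M
    have h3 : 0 < ε / 2 * (1 / 2) ^ N := by positivity
    nlinarith
  have hanti : ∀ a b, a ≤ b → I b ⊆ I a := fun a b hab =>
    Set.biInter_subset_biInter_left (fun i hi => Finset.mem_range.2
      ((Finset.mem_range.1 hi).trans_le hab))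
  have hbot : (⨅ N, 𝓟 (I N)).NeBot := by
    refine iInf_neBot_of_directed' (fun a b => ⟨max a b, ?_, ?_⟩)
      fun N => principal_neBot_iff.2 (hne N)
    · exact principal_mono.2 (hanti _ _ (le_max_left _ _))
    · exact principal_mono.2 (hanti _ _ (le_max_right _ _))
  let U := Ultrafilter.of (⨅ N, 𝓟 (I N))
  have hU : ∀ N, I N ∈ U := fun N =>
    Ultrafilter.of_le _ (mem_iInf_of_mem N (mem_principal_self _))
  -- The ultrafilter contains each `V n (m n)`, a finite union of sets `A i` with `i ≥ n`, and so
  -- contains one of these `A i`.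
  refine ⟨U, frequently_atTop.2 fun n => ?_⟩
  have h2 : V n (m n) ∈ U := mem_of_superset (hU (n + 1))
    (Set.biInter_subset_of_mem (Finset.mem_range.2 n.lt_succ_self))
  obtain ⟨i, hi, hiU⟩ := (Ultrafilter.finite_biUnion_mem_iff (Finset.Icc n (m n)).finite_toSet).1 h2
  exact ⟨i, (Finset.mem_Icc.1 hi).1, hiU⟩

theorem exists_tendsto_ultrafilter (U : Ultrafilter ℕ) (x : Linf) :
    ∃ z : ℂ, ‖z‖ ≤ ‖x‖ ∧ Tendsto x U (𝓝 z) := by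
  obtain ⟨z, hz, hxz⟩ := (isCompact_closedBall (0 : ℂ) ‖x‖).ultrafilter_le_nhds (U.map x)
    (le_principal_iff.2 (Ultrafilter.mem_map.2 (univ_mem' fun n => by
      simpa using norm_coord_le x n)))
  exact ⟨z, by simpa using hz, hxz⟩

/-- The limit along an ultrafilter as a functional on `l^∞`. -/
def ultraLim (U : Ultrafilter ℕ) : StrongDual ℂ Linf :=
  LinearMap.mkContinuous
    { toFun := fun x => (exists_tendsto_ultrafilter U x).choose
      map_add' := fun x y => tendsto_nhds_unique (exists_tendsto_ultrafilter U (x + y)).choose_spec.2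
        ((exists_tendsto_ultrafilter U x).choose_spec.2.add
          (exists_tendsto_ultrafilter U y).choose_spec.2)
      map_smul' := fun c x => tendsto_nhds_unique
        (exists_tendsto_ultrafilter U (c • x)).choose_spec.2
        ((exists_tendsto_ultrafilter U x).choose_spec.2.const_smul c) }
    1 (fun x => by rw [one_mul]; exact (exists_tendsto_ultrafilter U x).choose_spec.1)

theorem tendsto_ultraLim (U : Ultrafilter ℕ) (x : Linf) : Tendsto x U (𝓝 (ultraLim U x)) :=
  (exists_tendsto_ultrafilter U x).choose_spec.2

end Submeasure

/-! ### Weak-star null functionals against weakly null vectors. -/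

section DunfordPettis

/-- Weak-star null sequences of functionals on `l^∞` tend to zero along weakly null sequences. -/
theorem tendsto_apply_of_weakly_null {φ : ℕ → StrongDual ℂ Linf} {K : ℝ} (hK : ∀ n, ‖φ n‖ ≤ K)
    (hφ : ∀ y, Tendsto (fun n => φ n y) atTop (𝓝 0)) {v : ℕ → Linf} {C : ℝ} (hC : ∀ n, ‖v n‖ ≤ C)
    (hv : ∀ ψ : StrongDual ℂ Linf, Tendsto (fun n => ψ (v n)) atTop (𝓝 0)) {ε : ℝ} (hε : 0 < ε) :
    ∃ n, ‖φ n (v n)‖ < ε := by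
  by_contra! hcon
  have hK0 : 0 ≤ K := (norm_nonneg _).trans (hK 0)
  have hC0 : 0 ≤ C := (norm_nonneg _).trans (hC 0)
  -- Entries of `v n` of size at most `δ` contribute at most `ε / 2` to `φ n (v n)`, so `φ n` must
  -- have a definite amount of variation on the set where `v n` exceeds `δ`.
  let δ := ε / (2 * (K + 1))
  have hδ : 0 < δ := by positivity
  -- The supremum of the variations is a submeasure, and Phillips' lemma says that it is exhaustive.
  let η : Set ℕ → ℝ := fun s => ⨆ n, variation (φ n) s
  have hbdd : ∀ s, BddAbove (Set.range fun n => variation (φ n) s) := fun s =>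
    ⟨K, by rintro _ ⟨n, rfl⟩; exact variation_le_norm.trans (hK n)⟩
  have hle : ∀ s n, variation (φ n) s ≤ η s := fun s n => le_ciSup (hbdd s) n
  let A : ℕ → Set ℕ := fun n => {k | δ < ‖v n k‖}
  have hA : ∀ n, ε / (2 * (C + 1)) ≤ η (A n) := fun n => by
    refine le_trans ?_ (hle (A n) n)
    have h1 := norm_apply_le_variation_add (φ n) (x := v n) (s := A n) hδ.le
      (fun k hk => not_lt.1 hk)
    have h2 : ‖φ n‖ * δ ≤ ε / 2 := by
      calc ‖φ n‖ * δ ≤ (K + 1) * δ := by gcongr; linarith [hK n]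
        _ = ε / 2 := by simp only [δ]; field_simp
    have h3 : variation (φ n) (A n) * ‖v n‖ ≤ variation (φ n) (A n) * (C + 1) :=
      mul_le_mul_of_nonneg_left (by linarith [hC n]) variation_nonneg
    have h4 := hcon n
    rw [div_le_iff₀ (by positivity)]
    linarith
  obtain ⟨U, hU⟩ := exists_ultrafilter_frequently (η := η)
    (fun s t hst => ciSup_mono (hbdd t) fun n => variation_mono hst)
    (fun s t => ciSup_le fun n => variation_union_le.trans (add_le_add (hle s n) (hle t n)))
    (fun G hG => by
      rw [Metric.tendsto_atTop]
      intro e he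
      obtain ⟨J, hJ⟩ := exists_forall_variation_lt hK hφ hG (half_pos he)
      refine ⟨J, fun j hj => ?_⟩
      have h1 : η (G j) ≤ e / 2 := ciSup_le fun n => (hJ j hj n).le
      have h2 : 0 ≤ η (G j) := variation_nonneg.trans (hle _ 0)
      rw [Real.dist_eq, sub_zero, abs_of_nonneg h2]
      linarith)
    (by positivity) hA
  -- The limit along `U` is a single functional with modulus at least `δ` on `v n` for infinitely
  -- many `n`, contradicting weak nullity.
  have hlim := (hv (ultraLim U)).norm
  rw [norm_zero] at hlim
  obtain ⟨n, hnU, hn⟩ := (hU.and_eventually (hlim.eventually_lt_const hδ)).exists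
  have h1 : δ ≤ ‖ultraLim U (v n)‖ := ge_of_tendsto (tendsto_ultraLim U (v n)).norm
    (mem_of_superset hnU fun k (hk : δ < ‖v n k‖) => hk.le)
  linarith

/-- Sequential weak compactness: images of sequences in the unit ball have weakly convergent
subsequences. -/
def IsSeqWeaklyCompact {E F : Type*} [NormedAddCommGroup E] [NormedSpace ℂ E]
    [NormedAddCommGroup F] [NormedSpace ℂ F] (W : E →L[ℂ] F) : Prop :=
  ∀ x : ℕ → E, (∀ n, ‖x n‖ ≤ 1) → ∃ (κ : ℕ → ℕ) (w : F), StrictMono κ ∧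
    ∀ φ : StrongDual ℂ F, Tendsto (fun n => φ (W (x (κ n)))) atTop (𝓝 (φ w))

/-- The adjoint of a weakly compact operator into `l^∞` maps weak-star null sequences to norm null
sequences. -/
theorem IsSeqWeaklyCompact.exists_norm_comp_lt {E : Type*} [NormedAddCommGroup E] [NormedSpace ℂ E]
    {W : E →L[ℂ] Linf} (hW : IsSeqWeaklyCompact W)
    {φ : ℕ → StrongDual ℂ Linf} {K : ℝ} (hK : ∀ n, ‖φ n‖ ≤ K)
    (hφ : ∀ y, Tendsto (fun n => φ n y) atTop (𝓝 0)) {ε : ℝ} (hε : 0 < ε) :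
    ∃ n, ‖φ n ∘L W‖ < ε := by
  by_contra! hcon
  have h1 : ∀ n, ∃ x : E, ‖x‖ ≤ 1 ∧ ε / 2 < ‖φ n (W x)‖ := fun n => by
    obtain ⟨x, hx1, hx2⟩ := (φ n ∘L W).exists_lt_apply_of_lt_opNorm
      ((half_lt_self hε).trans_le (hcon n))
    exact ⟨x, hx1.le, hx2⟩
  choose x hx1 hx2 using h1
  obtain ⟨κ, w, hκ, hw⟩ := hW x hx1
  have hφw := ((hφ w).comp hκ.tendsto_atTop).norm
  rw [norm_zero] at hφw
  -- Beyond `N` the value at the weak limit `w` is negligible, so the lower bound rests on `φ`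
  -- applied to the weakly null differences `W x - w`.
  obtain ⟨N, hN⟩ := eventually_atTop.1 (hφw.eventually_lt_const (show 0 < ε / 4 by positivity))
  obtain ⟨n, hn⟩ := tendsto_apply_of_weakly_null (φ := fun n => φ (κ (n + N)))
    (v := fun n => W (x (κ (n + N))) - w) (C := ‖W‖ + ‖w‖) (fun n => hK _)
    (fun y => ((hφ y).comp hκ.tendsto_atTop).comp (tendsto_add_atTop_nat N))
    (fun n => (norm_sub_le _ _).trans (by
      gcongr
      exact (W.le_opNorm_of_le (hx1 _)).trans_eq (mul_one _)))
    (fun ψ => by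
      have h2 := ((hw ψ).comp (tendsto_add_atTop_nat N)).sub_const (ψ w)
      rw [sub_self] at h2
      refine h2.congr fun n => ?_
      rw [map_sub]; rfl)
    (show 0 < ε / 4 by positivity)
  rw [map_sub] at hn
  have h3 := hN (n + N) (Nat.le_add_left _ _)
  have h4 := hx2 (κ (n + N))
  have h5 := norm_sub_norm_le (φ (κ (n + N)) (W (x (κ (n + N))))) (φ (κ (n + N)) w)
  simp only [Function.comp_apply] at h3
  linarith

end DunfordPettis
end JClassOp
end

noncomputable section
namespace JClassOp

/-! ### Sequential weak compactness and its stability properties. -/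

section SequentialWeakCompactness

/-- The `j`-th coordinate functional on `l^∞`. -/
def coordFunctional (j : ℕ) : StrongDual ℂ Linf := evalL1 (lp.single 1 j (1 : ℂ))

theorem coordFunctional_apply (j : ℕ) (y : Linf) : coordFunctional j y = y j := toDual_single y j

theorem exists_subseq_tendsto_coord {u : ℕ → Linf} {C : ℝ} (hu : ∀ n, ‖u n‖ ≤ C) :
    ∃ (κ : ℕ → ℕ) (y : Linf), StrictMono κ ∧ ‖y‖ ≤ C ∧
      ∀ j, Tendsto (fun n => u (κ n) j) atTop (𝓝 (y j)) := by
  have hcomp : IsCompact (Set.univ.pi fun _ : ℕ => Metric.closedBall (0 : ℂ) C) :=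
    isCompact_univ_pi fun _ => isCompact_closedBall 0 C
  obtain ⟨z, hz, κ, hκ, hlim⟩ := hcomp.tendsto_subseq (x := fun n => (u n : ℕ → ℂ))
    (fun n j _ => mem_closedBall_zero_iff.2 ((norm_coord_le (u n) j).trans (hu n)))
  have hzC : ∀ j, ‖z j‖ ≤ C := fun j => mem_closedBall_zero_iff.1 (hz j (Set.mem_univ j))
  exact ⟨κ, linfMk z ⟨C, hzC⟩, hκ, lp.norm_le_of_forall_le ((norm_nonneg _).trans (hu 0)) hzC,
    fun j => tendsto_pi_nhds.1 hlim j⟩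

variable {E F G : Type*} [NormedAddCommGroup E] [NormedSpace ℂ E]
  [NormedAddCommGroup F] [NormedSpace ℂ F] [NormedAddCommGroup G] [NormedSpace ℂ G]

/-- Coordinates separate points, so a coordinatewise limit is the only possible weak cluster point
of a coordinatewise convergent subsequence; compactness then gives weak convergence. No
Eberlein-Šmulian theorem is needed for `l^∞`. -/
theorem IsWeaklyCompact.isSeqWeaklyCompact {W : E →L[ℂ] Linf} (hW : IsWeaklyCompact W) :
    IsSeqWeaklyCompact W := by
  intro x hx
  obtain ⟨κ, y, hκ, -, hy⟩ := exists_subseq_tendsto_coord (u := fun n => W (x n)) (C := ‖W‖)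
    (fun n => (W.le_opNorm_of_le (hx n)).trans_eq (mul_one _))
  have hcont : ∀ φ : StrongDual ℂ Linf,
      Continuous fun w : WeakSpace ℂ Linf => φ ((toWeakSpace ℂ Linf).symm w) := fun φ =>
    WeakBilin.eval_continuous (topDualPairing ℂ Linf).flip φ
  have hlim : Tendsto (fun n => toWeakSpace ℂ Linf (W (x (κ n)))) atTop
      (𝓝 (toWeakSpace ℂ Linf y)) := by
    refine IsCompact.tendsto_nhds_of_unique_mapClusterPt hW (Eventually.of_forall fun n => ?_)
      fun w _ hw => ?_
    · exact subset_closure ⟨_, ⟨x (κ n), mem_closedBall_zero_iff.2 (hx _), rfl⟩, rfl⟩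
    · rw [← LinearEquiv.symm_apply_eq]
      ext j
      have h1 := hw.continuousAt_comp (hcont (coordFunctional j)).continuousAt
      have h2 : Tendsto (((fun w : WeakSpace ℂ Linf =>
          coordFunctional j ((toWeakSpace ℂ Linf).symm w)) ∘
          fun n => toWeakSpace ℂ Linf (W (x (κ n))))) atTop (𝓝 (y j)) := by
        refine (hy j).congr fun n => ?_
        simp only [Function.comp_apply, LinearEquiv.symm_apply_apply, coordFunctional_apply]
      have h3 : coordFunctional j ((toWeakSpace ℂ Linf).symm w) = y j :=
        eq_of_nhds_neBot (neBot_of_le (hf := h1)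
          (inf_le_inf le_rfl h2))
      rwa [coordFunctional_apply] at h3
  refine ⟨κ, y, hκ, fun φ => ?_⟩
  exact ((hcont φ).tendsto _).comp hlim

theorem isSeqWeaklyCompact_zero : IsSeqWeaklyCompact (0 : E →L[ℂ] F) :=
  fun _ _ => ⟨id, 0, strictMono_id, fun φ => by simp⟩

theorem IsSeqWeaklyCompact.add {V W : E →L[ℂ] F} (hV : IsSeqWeaklyCompact V)
    (hW : IsSeqWeaklyCompact W) : IsSeqWeaklyCompact (V + W) := by
  intro x hx
  obtain ⟨κ, v, hκ, hv⟩ := hV x hx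
  obtain ⟨ι, w, hι, hw⟩ := hW (fun n => x (κ n)) fun n => hx _
  refine ⟨κ ∘ ι, v + w, hκ.comp hι, fun φ => ?_⟩
  rw [map_add]
  refine (((hv φ).comp hι.tendsto_atTop).add (hw φ)).congr fun n => ?_
  simp [add_apply, map_add]

theorem IsSeqWeaklyCompact.comp_left {W : E →L[ℂ] F} (hW : IsSeqWeaklyCompact W)
    (S : F →L[ℂ] G) : IsSeqWeaklyCompact (S ∘L W) := by
  intro x hx
  obtain ⟨κ, w, hκ, hw⟩ := hW x hx
  exact ⟨κ, S w, hκ, fun φ => hw (φ ∘L S)⟩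

theorem IsSeqWeaklyCompact.smul {W : E →L[ℂ] F} (hW : IsSeqWeaklyCompact W) (c : ℂ) :
    IsSeqWeaklyCompact (c • W) := hW.comp_left (c • ContinuousLinearMap.id ℂ F)

theorem IsSeqWeaklyCompact.comp_right {W : E →L[ℂ] F} (hW : IsSeqWeaklyCompact W)
    (S : G →L[ℂ] E) : IsSeqWeaklyCompact (W ∘L S) := by
  have hS : 0 < ‖S‖ + 1 := by positivity
  have hS' : ((‖S‖ + 1 : ℝ) : ℂ) ≠ 0 := by exact_mod_cast hS.ne'
  have h1 : IsSeqWeaklyCompact (W ∘L (((‖S‖ + 1 : ℝ) : ℂ)⁻¹ • S)) := by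
    intro x hx
    refine hW (fun n => (((‖S‖ + 1 : ℝ) : ℂ)⁻¹ • S) (x n)) fun n => ?_
    rw [smul_apply, norm_smul, norm_inv, Complex.norm_real, Real.norm_of_nonneg hS.le,
      inv_mul_le_iff₀ hS, mul_one]
    have := S.le_opNorm_of_le (hx n)
    linarith
  have h2 := h1.smul ((‖S‖ + 1 : ℝ) : ℂ)
  rwa [ContinuousLinearMap.comp_smul, smul_smul, mul_inv_cancel₀ hS', one_smul] at h2

/-- Norm limits of sequentially weakly compact operators into `l^∞` are sequentially weakly
compact. -/
theorem isSeqWeaklyCompact_of_tendsto {W : ℕ → E →L[ℂ] Linf} {V : E →L[ℂ] Linf}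
    (hW : ∀ m, IsSeqWeaklyCompact (W m)) (hV : Tendsto W atTop (𝓝 V)) :
    IsSeqWeaklyCompact V := by
  intro x hx
  -- The candidate limit is fixed by coordinates before any `W m` enters. A subsequence staying away
  -- from it is refuted by one close `W m`, whose weak limit `w` differs from `y` by at most `‖W m -
  -- V‖`.
  obtain ⟨κ, y, hκ, -, hy⟩ := exists_subseq_tendsto_coord (u := fun n => V (x n)) (C := ‖V‖)
    (fun n => (V.le_opNorm_of_le (hx n)).trans_eq (mul_one _))
  refine ⟨κ, y, hκ, fun φ => ?_⟩
  rw [Metric.tendsto_atTop]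
  by_contra! hcon
  obtain ⟨ε, hε, hcon⟩ := hcon
  obtain ⟨ι, hι, hfar⟩ := extraction_of_frequently_atTop (frequently_atTop.2 hcon)
  obtain ⟨m, hm⟩ := ((tendsto_iff_norm_sub_tendsto_zero.1 hV).eventually_lt_const
    (show 0 < ε / (3 * (‖φ‖ + 1)) by positivity)).exists
  obtain ⟨θ, w, hθ, hw⟩ := hW m (fun n => x (κ (ι n))) fun n => hx _
  have hdiff : ∀ n, ‖(W m - V) (x n)‖ ≤ ‖W m - V‖ := fun n =>
    ((W m - V).le_opNorm_of_le (hx n)).trans_eq (mul_one _)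
  have hwy : ‖w - y‖ ≤ ‖W m - V‖ := by
    refine lp.norm_le_of_forall_le (norm_nonneg _) fun j => ?_
    have h1 := (hw (coordFunctional j)).sub
      ((hy j).comp (hι.tendsto_atTop.comp hθ.tendsto_atTop))
    rw [coordFunctional_apply] at h1
    refine le_of_tendsto' h1.norm fun n => ?_
    rw [coordFunctional_apply]
    exact (norm_coord_le ((W m - V) (x (κ (ι (θ n))))) j).trans (hdiff _)
  obtain ⟨n, hn⟩ := ((tendsto_iff_norm_sub_tendsto_zero.1 (hw φ)).eventually_lt_const
    (show 0 < ε / 3 by positivity)).exists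
  have h2 : ‖φ‖ * ‖W m - V‖ ≤ ε / 3 := by
    calc ‖φ‖ * ‖W m - V‖ ≤ (‖φ‖ + 1) * (ε / (3 * (‖φ‖ + 1))) := by
          gcongr; linarith
      _ = ε / 3 := by field_simp
  have h3 : φ (V (x (κ (ι (θ n))))) - φ y = (φ (W m (x (κ (ι (θ n))))) - φ w) + φ (w - y) -
      φ ((W m - V) (x (κ (ι (θ n))))) := by
    simp only [map_sub, sub_apply]; ring
  have h4 := hfar (θ n)
  rw [dist_eq_norm, h3] at h4
  have h5 := (norm_sub_le ((φ (W m (x (κ (ι (θ n))))) - φ w) + φ (w - y))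
    (φ ((W m - V) (x (κ (ι (θ n))))))).trans (add_le_add_left (norm_add_le _ _) _)
  have h6 := (φ.le_opNorm_of_le hwy).trans h2
  have h7 := (φ.le_opNorm_of_le (hdiff (κ (ι (θ n))))).trans h2
  linarith

end SequentialWeakCompactness

/-! ### Dense range implies surjectivity for an adjoint plus a weakly compact operator. -/

section ClosedRange

/-- Bounded functionals whose images under an injective adjoint tend to zero are weak-star null. -/
theorem tendsto_apply_of_dualOp_tendsto {E F : Type*} [NormedAddCommGroup E] [NormedSpace ℂ E]
    [NormedAddCommGroup F] [NormedSpace ℂ F] {A : E →L[ℂ] F} (hA : Function.Injective (dualOp A))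
    {ψ : ℕ → StrongDual ℂ F} {K : ℝ} (hK : ∀ n, ‖ψ n‖ ≤ K)
    (hψ : Tendsto (fun n => dualOp A (ψ n)) atTop (𝓝 0)) (y : F) :
    Tendsto (fun n => ψ n y) atTop (𝓝 0) := by
  have hlim : Tendsto (fun n => StrongDual.toWeakDual (ψ n)) atTop (𝓝 0) := by
    refine IsCompact.tendsto_nhds_of_unique_mapClusterPt
      (WeakDual.isCompact_closedBall (𝕜 := ℂ) (0 : StrongDual ℂ F) K)
      (Eventually.of_forall fun n => ?_) fun χ _ hχ => ?_
    · exact mem_closedBall_zero_iff.2 (hK n)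
    -- Every weak-star cluster point is annihilated by the injective adjoint and is therefore zero;
    -- Banach-Alaoglu turns this into convergence.
    · have h1 : dualOp A (WeakDual.toStrongDual χ) = 0 := by
        ext u
        have h2 := hχ.continuousAt_comp (WeakDual.eval_continuous (A u)).continuousAt
        have h3 : Tendsto ((fun χ : WeakDual ℂ F => χ (A u)) ∘
            fun n => StrongDual.toWeakDual (ψ n)) atTop (𝓝 0) := by
          have h4 := ((ContinuousLinearMap.apply ℂ ℂ u).continuous.tendsto 0).comp hψ
          rw [map_zero] at h4
          exact h4
        exact eq_of_nhds_neBot (neBot_of_le (hf := h2) (inf_le_inf le_rfl h3))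
      have h2 : WeakDual.toStrongDual χ = 0 := hA (h1.trans (map_zero _).symm)
      exact (LinearEquiv.map_eq_zero_iff _).1 h2
  exact ((WeakDual.eval_continuous y).tendsto 0).comp hlim

theorem adj_apply (S : L1 →L[ℂ] L1) (u : Linf) (x : L1) : toDual (adj S u) x = toDual u (S x) := by
  change toDual (ofDual (dualOp S (toDual u))) x = _
  rw [toDual_ofDual]
  rfl

theorem tendsto_toDual_of_coord {u : ℕ → Linf} {C : ℝ} (hu : ∀ n, ‖u n‖ ≤ C) {y : Linf}
    (hy : ∀ j, Tendsto (fun n => u n j) atTop (𝓝 (y j))) (x : L1) :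
    Tendsto (fun n => toDual (u n) x) atTop (𝓝 (toDual y x)) := by
  simp only [toDual_apply]
  have hs : Summable fun n => ‖x n‖ := by
    simpa using (lp.memℓp x).summable (by norm_num)
  refine tendsto_tsum_of_dominated_convergence (hs.mul_left C) (fun k => (hy k).mul_const _)
    (Eventually.of_forall fun n k => ?_)
  rw [norm_mul]
  gcongr
  exact (norm_coord_le _ _).trans (hu n)

/-- The restriction to the first `n` coordinates. -/
def firstCoords (n : ℕ) : Linf →L[ℂ] (Fin n → ℂ) :=
  ContinuousLinearMap.pi fun j => coordFunctional j

theorem firstCoords_apply (n : ℕ) (y : Linf) (j : Fin n) : firstCoords n y j = y j :=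
  coordFunctional_apply j y

/-- A functional of finitely many coordinates comes from an element of `l^1`, so a lower bound on
`l^1` alone suffices for the Hahn-Banach approximation in the first `n` coordinates. -/
theorem exists_coord_approx {A : Linf →L[ℂ] Linf} {c : ℝ} (hc : 0 < c)
    (hA : ∀ x : L1, c * ‖x‖ ≤ ‖evalL1 x ∘L A‖) {y : Linf} (hy : ‖y‖ ≤ c) (n : ℕ) {ε : ℝ}
    (hε : 0 < ε) : ∃ u : Linf, ‖u‖ ≤ 1 ∧ ∀ j < n, ‖A u j - y j‖ < ε := by
  obtain ⟨u, hu1, hu2⟩ := exists_norm_apply_sub_lt (A := firstCoords n ∘L A) hc (fun z => by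
    let x : L1 := ∑ j : Fin n, z (Pi.single j 1) • lp.single (E := fun _ : ℕ => ℂ) 1 (j : ℕ) (1 : ℂ)
    have hx : z ∘L firstCoords n = evalL1 x := by
      ext v
      rw [ContinuousLinearMap.comp_apply, evalL1_apply, map_sum]
      simp only [map_smul, toDual_single, smul_eq_mul]
      conv_lhs => rw [pi_eq_sum_univ' (firstCoords n v)]
      rw [map_sum]
      refine Finset.sum_congr rfl fun j _ => ?_
      rw [map_smul, smul_eq_mul, firstCoords_apply, mul_comm]
    have hzx : ‖z‖ ≤ ‖x‖ := by
      refine ContinuousLinearMap.opNorm_le_bound _ (norm_nonneg _) fun v => ?_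
      let w : Linf := linfMk (fun k => if h : k < n then v ⟨k, h⟩ else 0) ⟨‖v‖, fun k => by
        split_ifs
        · exact norm_le_pi_norm v _
        · rw [norm_zero]; exact norm_nonneg v⟩
      have hw : ‖w‖ ≤ ‖v‖ := lp.norm_le_of_forall_le (norm_nonneg _) fun k => by
        change ‖if h : k < n then v ⟨k, h⟩ else 0‖ ≤ _
        split_ifs
        · exact norm_le_pi_norm v _
        · rw [norm_zero]; exact norm_nonneg v
      have hwv : firstCoords n w = v := by
        ext j
        rw [firstCoords_apply]
        exact dif_pos j.2
      rw [← hwv, ← ContinuousLinearMap.comp_apply, hx, hwv]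
      exact ((evalL1 x).le_opNorm_of_le hw).trans (by gcongr; exact norm_evalL1_le x)
    rw [← ContinuousLinearMap.comp_assoc, hx]
    exact (mul_le_mul_of_nonneg_left hzx hc.le).trans (hA x)) (firstCoords n y) hε
  have h1 : ‖firstCoords n y‖ ≤ c := (pi_norm_le_iff_of_nonneg hc.le).2 fun j => by
    rw [firstCoords_apply]; exact (norm_coord_le y j).trans hy
  refine ⟨u, le_of_mul_le_mul_left (by linarith) hc, fun j hj => ?_⟩
  have h2 := (norm_le_pi_norm ((firstCoords n ∘L A) u - firstCoords n y) ⟨j, hj⟩).trans_lt hu2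
  rwa [Pi.sub_apply, ContinuousLinearMap.comp_apply, firstCoords_apply, firstCoords_apply] at h2

/-- For `‖y‖ ≤ c`, unit-ball vectors solve the equation approximately in more and more coordinates.
In the limit `y = S* y' + k`, with `y'` a coordinatewise limit, which `S*` respects, and `k` a weak
limit of images under `W`. In general `k` need not be `W y'`, but `|φ k| ≤ ‖φ ∘ W‖` still holds. -/
theorem norm_le_of_boundedBelow_evalL1 {S : L1 →L[ℂ] L1} {W : Linf →L[ℂ] Linf}
    (hW : IsSeqWeaklyCompact W) {c : ℝ} (hc : 0 < c)
    (hA : ∀ x : L1, c * ‖x‖ ≤ ‖evalL1 x ∘L (adj S + W)‖) (φ : StrongDual ℂ Linf) :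
    c * ‖φ‖ ≤ ‖φ ∘L adj S‖ + ‖φ ∘L W‖ := by
  have key : ∀ y : Linf, ‖y‖ ≤ c → ‖φ y‖ ≤ ‖φ ∘L adj S‖ + ‖φ ∘L W‖ := by
    intro y hy
    choose u hu1 hu2 using fun n : ℕ => exists_coord_approx hc hA hy n
      (Nat.one_div_pos_of_nat (α := ℝ) (n := n))
    obtain ⟨κ, k, hκ, hk⟩ := hW u hu1
    obtain ⟨ι, y', hι, hy'1, hy'⟩ := exists_subseq_tendsto_coord (u := fun n => u (κ n))
      (fun n => hu1 _)
    have hsum : y = adj S y' + k := by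
      ext j
      have h1 : Tendsto (fun n => (adj S + W) (u (κ (ι n))) j) atTop (𝓝 (y j)) := by
        rw [tendsto_iff_norm_sub_tendsto_zero]
        have hκι := (hκ.comp hι).tendsto_atTop
        refine squeeze_zero' (Eventually.of_forall fun _ => norm_nonneg _) ?_
          ((tendsto_one_div_add_atTop_nhds_zero_nat (𝕜 := ℝ)).comp hκι)
        filter_upwards [hκι.eventually_gt_atTop j] with n hn
        exact (hu2 _ j hn).le
      have h2 : Tendsto (fun n => adj S (u (κ (ι n))) j) atTop (𝓝 (adj S y' j)) := by
        have h3 := tendsto_toDual_of_coord (fun n => hu1 _) hy' (S (lp.single 1 j 1))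
        simpa only [← adj_apply, toDual_single] using h3
      have h3 : Tendsto (fun n => W (u (κ (ι n))) j) atTop (𝓝 (k j)) := by
        have h4 := (hk (coordFunctional j)).comp hι.tendsto_atTop
        simp only [coordFunctional_apply] at h4
        exact h4
      exact tendsto_nhds_unique h1 (h2.add h3)
    have h4 : ‖φ (adj S y')‖ ≤ ‖φ ∘L adj S‖ :=
      ((φ ∘L adj S).le_opNorm_of_le hy'1).trans_eq (mul_one _)
    have h5 : ‖φ k‖ ≤ ‖φ ∘L W‖ := le_of_tendsto' (hk φ).norm fun n =>
      ((φ ∘L W).le_opNorm_of_le (hu1 _)).trans_eq (mul_one _)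
    rw [hsum, map_add]
    exact (norm_add_le _ _).trans (add_le_add h4 h5)
  have h1 : ‖φ‖ ≤ (‖φ ∘L adj S‖ + ‖φ ∘L W‖) / c := by
    refine ContinuousLinearMap.opNorm_le_bound _ (by positivity) fun y => ?_
    by_cases hy : y = 0
    · simp [hy]
    have hy0 : 0 < ‖y‖ := norm_pos_iff.2 hy
    have h2 := key (((c / ‖y‖ : ℝ) : ℂ) • y) (by
      rw [norm_smul, Complex.norm_real, Real.norm_of_nonneg (by positivity),
        div_mul_cancel₀ _ hy0.ne'])
    rw [map_smul, norm_smul, Complex.norm_real, Real.norm_of_nonneg (by positivity)] at h2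
    rw [div_mul_eq_mul_div, div_le_iff₀ hy0] at h2
    rw [div_mul_eq_mul_div, le_div_iff₀ hc]
    linarith
  rwa [le_div_iff₀ hc, mul_comm] at h1

/-- If `S^* + W` has dense range and `W` is weakly compact, then `S^* + W` is onto; here both
properties are expressed through the adjoint. -/
theorem boundedBelow_dualOp_of_injective {S : L1 →L[ℂ] L1} {W : Linf →L[ℂ] Linf}
    (hW : IsSeqWeaklyCompact W) (hinj : Function.Injective (dualOp (adj S + W))) :
    BoundedBelow (dualOp (adj S + W)) := by
  -- Failure on `l^1` would give unit vectors that are null against all of `l^∞`, by injectivity of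
  -- the adjoint; Schur's theorem forbids this.
  have h1 : BoundedBelow (dualOp (adj S + W) ∘L evalL1) := by
    by_contra hcon
    obtain ⟨x, hx, hlim⟩ := exists_seq_of_not_boundedBelow hcon
    exact not_weakly_null_of_norm_eq_one hx (tendsto_apply_of_dualOp_tendsto hinj
      (fun n => (norm_evalL1_le _).trans_eq (hx n)) hlim)
  obtain ⟨c, hc, hA⟩ := h1
  by_contra hcon
  obtain ⟨φ, hφ, hlim⟩ := exists_seq_of_not_boundedBelow hcon
  have hnull := tendsto_apply_of_dualOp_tendsto hinj (fun n => (hφ n).le) hlim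
  have hlim' := hlim.norm
  rw [norm_zero] at hlim'
  obtain ⟨N, hN⟩ := eventually_atTop.1 (hlim'.eventually_lt_const (show 0 < c / 4 by positivity))
  obtain ⟨n, hn⟩ := hW.exists_norm_comp_lt (φ := fun n => φ (n + N)) (fun n => (hφ _).le)
    (fun y => (hnull y).comp (tendsto_add_atTop_nat N)) (show 0 < c / 4 by positivity)
  have h2 := norm_le_of_boundedBelow_evalL1 hW hc hA (φ (n + N))
  have h3 : φ (n + N) ∘L adj S = dualOp (adj S + W) (φ (n + N)) - φ (n + N) ∘L W := by
    ext u
    simp [dualOp_apply_apply]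
  have h4 := hN (n + N) (Nat.le_add_left _ _)
  have h5 := norm_sub_le (dualOp (adj S + W) (φ (n + N))) (φ (n + N) ∘L W)
  -- The bound becomes `c ≤ ‖A* φ‖ + 2 ‖φ ∘ W‖` with `A = S* + W`, whose right side is below `3 c /
  -- 4`.
  rw [hφ, h3] at h2
  linarith

end ClosedRange
end JClassOp
end

noncomputable section
namespace JClassOp

/-! ### The class of adjoints plus weakly compact operators under the calculus. -/

section AdjointPlusWeaklyCompact

theorem adj_apply_coord (S : L1 →L[ℂ] L1) (y : Linf) (n : ℕ) :
    adj S y n = toDual y (S (lp.single 1 n (1 : ℂ))) := rfl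

theorem toDual_injective : Function.Injective toDual :=
  Function.LeftInverse.injective ofDual_toDual

theorem adj_mul (S S' : L1 →L[ℂ] L1) : adj (S * S') = adj S' * adj S := by
  ext y : 1
  refine toDual_injective ?_
  ext x : 1
  change _ = toDual (adj S' (adj S y)) x
  rw [adj_apply, adj_apply, adj_apply]
  rfl

theorem adj_one : adj 1 = 1 := by
  ext y : 1
  refine toDual_injective ?_
  ext x : 1
  rw [adj_apply, one_apply_eq_self, one_apply_eq_self]

theorem adj_pow (S : L1 →L[ℂ] L1) (n : ℕ) : adj (S ^ n) = adj S ^ n := by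
  induction n with
  | zero => exact adj_one
  | succ n ih => rw [pow_succ', pow_succ, adj_mul, ih]

/-- The adjoint as a continuous linear map of the operator. -/
def adjL : (L1 →L[ℂ] L1) →L[ℂ] (Linf →L[ℂ] Linf) :=
  (ContinuousLinearMap.compL ℂ Linf (StrongDual ℂ L1) Linf
      (dualEquiv.symm : StrongDual ℂ L1 →L[ℂ] Linf)) ∘L
    ((ContinuousLinearMap.compL ℂ Linf (StrongDual ℂ L1) (StrongDual ℂ L1)).flip
      (dualEquiv : Linf →L[ℂ] StrongDual ℂ L1)) ∘L
    (ContinuousLinearMap.compL ℂ L1 L1 ℂ).flip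

theorem adjL_apply (S : L1 →L[ℂ] L1) : adjL S = adj S := rfl

theorem isUnit_adj_iff {S : L1 →L[ℂ] L1} : IsUnit (adj S) ↔ IsUnit S := by
  rw [← isUnit_dualOp_iff (A := S), ContinuousLinearMap.isUnit_iff_bijective,
    ContinuousLinearMap.isUnit_iff_bijective]
  have h : ⇑(adj S) = dualEquiv.symm ∘ dualOp S ∘ dualEquiv := rfl
  rw [h]
  exact (Function.Bijective.of_comp_iff' dualEquiv.symm.bijective _).trans
    (Function.Bijective.of_comp_iff _ dualEquiv.bijective)

theorem adj_sub_smul (S : L1 →L[ℂ] L1) (μ : ℂ) :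
    adj (S - μ • (1 : L1 →L[ℂ] L1)) = adj S - μ • (1 : Linf →L[ℂ] Linf) := by
  rw [← adjL_apply, map_sub, map_smul, adjL_apply, adjL_apply, adj_one]

theorem spectrum_adj (S : L1 →L[ℂ] L1) : spectrum ℂ (adj S) = spectrum ℂ S := by
  ext μ
  rw [mem_spectrum_iff_sub, mem_spectrum_iff_sub, ← adj_sub_smul, isUnit_adj_iff]

theorem funcCalc_adj {S : L1 →L[ℂ] L1} {f : ℂ → ℂ} {R : ℝ}
    (hS : spectralRadius ℂ (adj S) < ENNReal.ofReal R)
    (hf : DifferentiableOn ℂ f (Metric.ball 0 R)) :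
    funcCalc f (adj S) = adj (funcCalc f S) := by
  have hS' : spectralRadius ℂ S < ENNReal.ofReal R := by
    rwa [spectralRadius, ← spectrum_adj]
  refine ((adjL.hasSum (hasSum_calcTerm hS' hf)).tsum_eq.symm.trans (tsum_congr fun n => ?_)).symm
  rw [calcTerm, map_smul, adjL_apply, adj_pow, calcTerm]

/-- The sequentially weakly compact operators form an ideal, and the difference of powers telescopes
into products with a factor `T - Q`. -/
theorem isSeqWeaklyCompact_pow_sub_pow {E : Type*} [NormedAddCommGroup E] [NormedSpace ℂ E]
    {T Q : E →L[ℂ] E} (h : IsSeqWeaklyCompact (T - Q)) (n : ℕ) :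
    IsSeqWeaklyCompact (T ^ n - Q ^ n) := by
  induction n with
  | zero => simpa using isSeqWeaklyCompact_zero (E := E) (F := E)
  | succ n ih =>
    have h1 : T ^ (n + 1) - Q ^ (n + 1) = T * (T ^ n - Q ^ n) + (T - Q) * Q ^ n := by
      rw [pow_succ', pow_succ']; noncomm_ring
    rw [h1]
    exact (ih.comp_left T).add (h.comp_right (Q ^ n))

theorem isSeqWeaklyCompact_funcCalc_sub {T Q : Linf →L[ℂ] Linf} (h : IsSeqWeaklyCompact (T - Q))
    {f : ℂ → ℂ} {R : ℝ} (hT : spectralRadius ℂ T < ENNReal.ofReal R)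
    (hQ : spectralRadius ℂ Q < ENNReal.ofReal R)
    (hf : DifferentiableOn ℂ f (Metric.ball 0 R)) :
    IsSeqWeaklyCompact (funcCalc f T - funcCalc f Q) := by
  refine isSeqWeaklyCompact_of_tendsto (fun m => ?_)
    ((hasSum_calcTerm hT hf).sub (hasSum_calcTerm hQ hf)).tendsto_sum_nat
  induction m with
  | zero => simpa using isSeqWeaklyCompact_zero
  | succ m ih =>
    rw [Finset.sum_range_succ]
    refine ih.add ?_
    rw [calcTerm, calcTerm, ← smul_sub]
    exact (isSeqWeaklyCompact_pow_sub_pow h m).smul _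

/-- The characterization of `J`-class operators `f(S^* + W)` with `W` weakly compact. -/
theorem isJClass_funcCalc_adj_add_iff {S : L1 →L[ℂ] L1} {W T : Linf →L[ℂ] Linf}
    (hW : IsSeqWeaklyCompact W) (hTS : T = adj S + W) {R : ℝ}
    (hT : spectralRadius ℂ T < ENNReal.ofReal R)
    (hS : spectralRadius ℂ (adj S) < ENNReal.ofReal R) {f : ℂ → ℂ}
    (hf : DifferentiableOn ℂ f (Metric.ball 0 R)) :
    IsJClass (funcCalc f T) ↔
      f '' approxPointSpectrum (dualOp T) ∩ Metric.closedBall 0 1 = ∅ ∧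
      Metric.closedBall 0 1 ⊆
        f '' (spectrum ℂ (dualOp T) \ approxPointSpectrum (dualOp T)) := by
  refine isJClass_funcCalc_iff hT hf fun μ hμ => ?_
  have hV : IsSeqWeaklyCompact (funcCalc f T - funcCalc f (adj S)) :=
    isSeqWeaklyCompact_funcCalc_sub (by rwa [hTS, add_sub_cancel_left]) hT hS hf
  -- The operator `f(T) - μ` again has the form adjoint plus weakly compact, which is what the
  -- surjectivity theorem requires.
  have h1 : funcCalc f T - μ • (1 : Linf →L[ℂ] Linf) =
      adj (funcCalc f S - μ • (1 : L1 →L[ℂ] L1)) + (funcCalc f T - funcCalc f (adj S)) := by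
    rw [adj_sub_smul, ← funcCalc_adj hS hf]; abel
  rw [← dualOp_sub_smul, h1] at hμ ⊢
  exact boundedBelow_dualOp_of_injective hV hμ

end AdjointPlusWeaklyCompact
end JClassOp
end

noncomputable section
namespace JClassOp

/-! ### A growth dichotomy for positive sequences. -/

section PositiveSequences

variable {β : ℕ → ℝ} {K : ℝ}

/-- The central term `β (m + q)` lies in each block from `m + j` to `m + 2q - j` and is bounded by
`K` times its two ends. Summing over `j < q` bounds `q β (m + q)` by `K (K + 1)` times the ends of
the big block, and `q > 4 K (K + 1)` gives the factor four. -/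
theorem exists_step_convex (hβ : ∀ k, 0 < β k) (hK : 0 < K)
    (h : ∀ m n, ∑ i ∈ Finset.range n, β (m + i) ≤ K * (β m + β (m + n))) :
    ∃ q : ℕ, 1 ≤ q ∧ ∀ m, 4 * β (m + q) ≤ β m + β (m + 2 * q) := by
  obtain ⟨q, hq⟩ := exists_nat_gt (4 * (K * (K + 1)))
  have hq0 : (0 : ℝ) < q := lt_trans (by positivity) hq
  refine ⟨q, by exact_mod_cast hq0, fun m => ?_⟩
  have hpeak : ∀ j ∈ Finset.range q, β (m + q) ≤ K * (β (m + j) + β (m + (2 * q - j))) := by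
    intro j hj
    rw [Finset.mem_range] at hj
    have h1 := h (m + j) (2 * q - 2 * j)
    have h2 : m + j + (2 * q - 2 * j) = m + (2 * q - j) := by omega
    rw [h2] at h1
    refine le_trans ?_ h1
    have h3 : m + q = m + j + (q - j) := by omega
    rw [h3]
    exact Finset.single_le_sum (f := fun i => β (m + j + i)) (fun i _ => (hβ _).le)
      (Finset.mem_range.2 (by omega))
  have h1 := Finset.sum_le_sum hpeak
  rw [Finset.sum_const, Finset.card_range, nsmul_eq_mul, ← Finset.mul_sum,
    Finset.sum_add_distrib] at h1
  have h2 : ∑ j ∈ Finset.range q, β (m + (2 * q - j)) ≤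
      ∑ i ∈ Finset.range (q + 1), β (m + (q + i)) := by
    rw [← Finset.sum_range_reflect (fun i => β (m + (q + i))) (q + 1), Finset.sum_range_succ]
    refine le_trans (Finset.sum_le_sum fun j hj => le_of_eq ?_)
      (le_add_of_nonneg_right (hβ _).le)
    rw [Finset.mem_range] at hj
    congr 1
    omega
  have h3 : ∑ j ∈ Finset.range q, β (m + j) + ∑ i ∈ Finset.range (q + 1), β (m + (q + i)) =
      ∑ i ∈ Finset.range (2 * q), β (m + i) + β (m + 2 * q) := by
    rw [← Finset.sum_range_succ (fun i => β (m + i)), show 2 * q + 1 = q + (q + 1) by ring,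
      Finset.sum_range_add _ q (q + 1)]
  have h4 := h m (2 * q)
  have hm := hβ m
  have h5 : (q : ℝ) * β (m + q) ≤ K * (K + 1) * (β m + β (m + 2 * q)) := by
    refine h1.trans ?_
    rw [mul_assoc]
    gcongr
    linarith
  have h6 : 4 * (K * (K + 1)) * β (m + q) ≤ K * (K + 1) * (β m + β (m + 2 * q)) :=
    (mul_le_mul_of_nonneg_right hq.le (hβ _).le).trans h5
  refine le_of_mul_le_mul_left (a := K * (K + 1)) ?_ (by positivity)
  linarith

/-- The growth dichotomy: a positive sequence whose block sums are controlled by the end points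
of the block is eventually geometrically increasing or geometrically decreasing along an
arithmetic progression. -/
theorem exists_growth_dichotomy (hβ : ∀ k, 0 < β k) (hK : 0 < K)
    (h : ∀ m n, ∑ i ∈ Finset.range n, β (m + i) ≤ K * (β m + β (m + n))) :
    ∃ q : ℕ, 1 ≤ q ∧ ((∃ M, ∀ m ≥ M, 2 * β m ≤ β (m + q)) ∨ ∀ m, 2 * β (m + q) ≤ β m) := by
  obtain ⟨q, hq, hconv⟩ := exists_step_convex hβ hK h
  refine ⟨q, hq, ?_⟩
  -- If all steps of length `q` descend, convexity makes the descent geometric. One step that does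
  -- not descend instead starts tripling along its arithmetic progression.
  by_cases hcase : ∀ m, β (m + q) < β m
  · right
    intro m
    have h1 := hconv m
    have h2 := hcase (m + q)
    rw [show m + q + q = m + 2 * q by ring] at h2
    have h3 := hβ (m + q)
    linarith
  left
  push Not at hcase
  obtain ⟨m₀, hm₀⟩ := hcase
  have hstep : ∀ m, β m ≤ β (m + q) → 3 * β (m + q) ≤ β (m + q + q) := fun m hm => by
    have h1 := hconv m
    rw [show m + q + q = m + 2 * q by ring]
    linarith
  have hgrow : ∀ j : ℕ, β (m₀ + j * q) ≤ β (m₀ + j * q + q) := fun j => by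
    induction j with
    | zero => simpa using hm₀
    | succ j ih =>
      have h1 := hstep _ ih
      have h2 := hβ (m₀ + j * q + q)
      rw [show m₀ + (j + 1) * q = m₀ + j * q + q by ring]
      linarith
  have hexp : ∀ j : ℕ, 3 ^ j * β (m₀ + q) ≤ β (m₀ + q + j * q) := fun j => by
    induction j with
    | zero => simp
    | succ j ih =>
      have h1 := hstep _ (hgrow j)
      rw [show m₀ + j * q + q = m₀ + q + j * q by ring] at h1
      rw [show m₀ + q + (j + 1) * q = m₀ + q + j * q + q by ring, pow_succ]
      linarith
  -- Growth along one progression spreads to all indices: a block from `m₀` to a late `k` contains a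
  -- huge term, so its right end `β k` must be large.
  have hinf : ∀ C : ℝ, ∃ N, ∀ k ≥ N, C < β k := by
    intro C
    have h1 : Tendsto (fun j : ℕ => (3 : ℝ) ^ j * β (m₀ + q)) atTop atTop :=
      (tendsto_pow_atTop_atTop_of_one_lt (by norm_num)).atTop_mul_const (hβ _)
    obtain ⟨j, hj⟩ := (h1.eventually_gt_atTop (K * (β m₀ + C))).exists
    refine ⟨m₀ + q + j * q + 1, fun k hk => ?_⟩
    have h2 := h m₀ (k - m₀)
    rw [show m₀ + (k - m₀) = k by omega] at h2
    have h3 : β (m₀ + (q + j * q)) ≤ ∑ i ∈ Finset.range (k - m₀), β (m₀ + i) :=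
      Finset.single_le_sum (f := fun i => β (m₀ + i)) (fun i _ => (hβ _).le)
        (Finset.mem_range.2 (by omega))
    rw [← add_assoc] at h3
    have h4 : K * (β m₀ + C) < K * (β m₀ + β k) :=
      hj.trans_le ((hexp j).trans (h3.trans h2))
    have h5 := lt_of_mul_lt_mul_left h4 hK.le
    linarith
  -- By convexity a descent propagates backwards in steps of `q`, with ever larger values, down to
  -- the first `q` terms. So late terms, which exceed the sum of those, cannot begin a descent.
  have hback : ∀ m, β (m + q) < β m → β m ≤ ∑ r ∈ Finset.range q, β r := by
    intro m
    induction m using Nat.strong_induction_on with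
    | _ m ih =>
      intro hm
      by_cases hmq : m < q
      · exact Finset.single_le_sum (f := β) (fun i _ => (hβ i).le) (Finset.mem_range.2 hmq)
      · obtain ⟨l, rfl⟩ : ∃ l, m = l + q := ⟨m - q, by omega⟩
        have h1 := hconv l
        rw [show l + 2 * q = l + q + q by ring] at h1
        have h2 := hβ (l + q)
        have h3 : β (l + q) < β l := by linarith
        exact h3.le.trans (ih l (by omega) h3)
  obtain ⟨N, hN⟩ := hinf (∑ r ∈ Finset.range q, β r)
  refine ⟨N + q, fun m hm => ?_⟩
  obtain ⟨l, rfl⟩ : ∃ l, m = l + q := ⟨m - q, by omega⟩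
  have h1 : β l ≤ β (l + q) := by
    by_contra hlt
    exact absurd (hN l (by omega)) (not_lt.2 (hback l (not_le.1 hlt)))
  have h2 := hstep l h1
  have h3 := hβ (l + q)
  linarith

end PositiveSequences

/-! ### Products of consecutive weights and their growth rates. -/

section WeightProducts

variable {w : ℕ → ℝ}

/-- The product of `n` consecutive weights, starting at position `k`. -/
def wprod (w : ℕ → ℝ) (k n : ℕ) : ℝ := ∏ j ∈ Finset.range n, w (k + j)

theorem wprod_pos (hw : ∀ n, 0 < w n) (k n : ℕ) : 0 < wprod w k n :=
  Finset.prod_pos fun _ _ => hw _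

theorem wprod_add (w : ℕ → ℝ) (k m n : ℕ) :
    wprod w k (m + n) = wprod w k m * wprod w (k + m) n := by
  simp only [wprod, Finset.prod_range_add, add_assoc]

theorem wprod_one (w : ℕ → ℝ) (k : ℕ) : wprod w k 1 = w k := by simp [wprod]

theorem wprod_succ (w : ℕ → ℝ) (k n : ℕ) : wprod w k (n + 1) = wprod w k n * w (k + n) := by
  rw [wprod_add, wprod_one]

/-- If the products of `q` consecutive weights are uniformly small compared to `s ^ q`, then the
upper growth rate is less than `s`. -/
theorem lt_of_tendsto_iSup (hw : ∀ n, 0 < w n) {r s : ℝ} (hs : 0 < s) {q : ℕ} (hq : 1 ≤ q)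
    (hr : Tendsto (fun n : ℕ => ⨆ k : ℕ, wprod w k n ^ (1 / (n : ℝ))) atTop (𝓝 r))
    (h : ∀ m, 2 * wprod w m q ≤ s ^ q) : r < s := by
  have hpow : ∀ j m, wprod w m (j * q) ≤ (s ^ q / 2) ^ j := fun j => by
    induction j with
    | zero => intro m; simp [wprod]
    | succ j ih =>
      intro m
      rw [show (j + 1) * q = q + j * q by ring, wprod_add, pow_succ']
      have := h m
      exact mul_le_mul (by linarith) (ih _) (wprod_pos hw _ _).le (by positivity)
  have hq0 : (0 : ℝ) < q := by exact_mod_cast hq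
  have hlim : r ≤ (s ^ q / 2) ^ (1 / (q : ℝ)) := by
    -- The factor `j + 1` avoids the exponent `1 / 0 = 0`, since the estimate is used for every `j`.
    have h1 : Tendsto (fun j : ℕ => (j + 1) * q) atTop atTop :=
      tendsto_atTop_mono (fun j => le_trans j.le_succ (Nat.le_mul_of_pos_right _ hq)) tendsto_id
    refine le_of_tendsto' (hr.comp h1) fun j => ciSup_le fun k => ?_
    calc wprod w k ((j + 1) * q) ^ (1 / (((j + 1) * q : ℕ) : ℝ))
        ≤ ((s ^ q / 2) ^ (j + 1)) ^ (1 / (((j + 1) * q : ℕ) : ℝ)) :=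
          Real.rpow_le_rpow (wprod_pos hw _ _).le (hpow _ _) (by positivity)
      _ = (s ^ q / 2) ^ (1 / (q : ℝ)) := by
          rw [← Real.rpow_natCast, ← Real.rpow_mul (by positivity)]
          congr 1
          push_cast
          field_simp
  refine hlim.trans_lt ?_
  calc (s ^ q / 2) ^ (1 / (q : ℝ)) < (s ^ q) ^ (1 / (q : ℝ)) :=
        Real.rpow_lt_rpow (by positivity) (half_lt_self (by positivity)) (by positivity)
    _ = s := by rw [one_div, Real.pow_rpow_inv_natCast hs.le (by omega)]

/-- If the products of `jq` consecutive weights are uniformly large compared to `s ^ (jq)`, then the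
lower growth rate is greater than `s`. -/
theorem lt_of_tendsto_iInf {r s κ : ℝ} (hs : 0 < s) (hκ : 0 < κ) {q : ℕ} (hq : 1 ≤ q)
    (hr : Tendsto (fun n : ℕ => ⨅ k : ℕ, wprod w k n ^ (1 / (n : ℝ))) atTop (𝓝 r))
    (h : ∀ᶠ j in atTop, ∀ k, κ * (2 * s ^ q) ^ j ≤ wprod w k (j * q)) : s < r := by
  have hq0 : (0 : ℝ) < q := by exact_mod_cast hq
  have h1 : Tendsto (fun j : ℕ => j * q) atTop atTop :=
    tendsto_atTop_mono (fun j => Nat.le_mul_of_pos_right _ hq) tendsto_id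
  have h2 : Tendsto (fun j : ℕ => κ ^ (1 / ((j * q : ℕ) : ℝ)) * (2 * s ^ q) ^ (1 / (q : ℝ))) atTop
      (𝓝 (1 * (2 * s ^ q) ^ (1 / (q : ℝ)))) := by
    refine Tendsto.mul_const _ ?_
    have h3 : Tendsto (fun j : ℕ => 1 / ((j * q : ℕ) : ℝ)) atTop (𝓝 0) :=
      tendsto_one_div_atTop_nhds_zero_nat.comp h1
    have h4 := (Real.continuousAt_const_rpow (b := 0) hκ.ne').tendsto.comp h3
    rwa [Real.rpow_zero] at h4
  rw [one_mul] at h2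
  have hlim : (2 * s ^ q) ^ (1 / (q : ℝ)) ≤ r := by
    refine le_of_tendsto_of_tendsto h2 (hr.comp h1) ?_
    filter_upwards [h, eventually_ge_atTop 1] with j hj hj1
    have hj0 : (0 : ℝ) < j := by exact_mod_cast hj1
    refine le_ciInf fun k => ?_
    refine le_trans (le_of_eq ?_) (Real.rpow_le_rpow (by positivity) (hj k) (by positivity))
    rw [Real.mul_rpow hκ.le (by positivity)]
    congr 1
    rw [← Real.rpow_natCast (2 * s ^ q) j, ← Real.rpow_mul (by positivity)]
    congr 1
    push_cast
    field_simp
  refine lt_of_lt_of_le ?_ hlim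
  calc s = (s ^ q) ^ (1 / (q : ℝ)) := by
        rw [one_div, Real.pow_rpow_inv_natCast hs.le (by omega)]
    _ < (2 * s ^ q) ^ (1 / (q : ℝ)) := by
        refine Real.rpow_lt_rpow (by positivity) ?_ (by positivity)
        have : 0 < s ^ q := by positivity
        linarith

/-- A block estimate for the weights at level `s` excludes `s` from the annulus of growth rates. -/
theorem lt_or_lt_of_block_sum_le (hw : ∀ n, 0 < w n) {r₁ r₂ s K : ℝ} (hs : 0 < s) (hK : 0 < K)
    (hr₁ : Tendsto (fun n : ℕ => ⨆ k : ℕ, wprod w k n ^ (1 / (n : ℝ))) atTop (𝓝 r₁))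
    (hr₂ : Tendsto (fun n : ℕ => ⨅ k : ℕ, wprod w k n ^ (1 / (n : ℝ))) atTop (𝓝 r₂))
    (h : ∀ m n, ∑ i ∈ Finset.range n, wprod w m i / s ^ i ≤ K * (1 + wprod w m n / s ^ n)) :
    r₁ < s ∨ s < r₂ := by
  -- Normalised products from position zero: quotients `β (m + i) / β m` recover the normalised
  -- products from `m`, so the assumed estimate is the block condition of the dichotomy.
  let β : ℕ → ℝ := fun k => wprod w 0 k / s ^ k
  have hβ : ∀ k, 0 < β k := fun k => div_pos (wprod_pos hw 0 k) (by positivity)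
  have hβadd : ∀ m i, β (m + i) = β m * (wprod w m i / s ^ i) := fun m i => by
    simp only [β]
    rw [wprod_add, zero_add, pow_add]
    field_simp
  obtain ⟨q, hq, hdich⟩ := exists_growth_dichotomy hβ hK fun m n => by
    have h1 := mul_le_mul_of_nonneg_left (h m n) (hβ m).le
    rw [Finset.mul_sum] at h1
    simp only [hβadd]
    linarith
  rcases hdich with ⟨M, hM⟩ | hdec
  · right
    have hgrow : ∀ j m, M ≤ m → 2 ^ j * β m ≤ β (m + j * q) := fun j => by
      induction j with
      | zero => intro m _; simp
      | succ j ih =>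
        intro m hm
        have h1 := ih m hm
        have h2 := hM (m + j * q) (by omega)
        rw [show m + (j + 1) * q = m + j * q + q by ring, pow_succ]
        linarith
    -- Starting points `k < M` are first moved past `M` by `M` steps of length `q`, which need not
    -- double anything. The constant `κ` pays for the loss over these finitely many starts, and `2 ^
    -- M` for the missing doublings.
    let κ := (1 + ∑ k ∈ Finset.range M, β k / β (k + M * q))⁻¹
    have hsum0 : 0 ≤ ∑ k ∈ Finset.range M, β k / β (k + M * q) :=
      Finset.sum_nonneg fun k _ => (div_pos (hβ _) (hβ _)).le
    have hκ : 0 < κ := by positivity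
    have hκle : ∀ k < M, κ * β k ≤ β (k + M * q) := fun k hk => by
      have h1 := Finset.single_le_sum (f := fun k => β k / β (k + M * q))
        (fun k _ => (div_pos (hβ _) (hβ _)).le) (Finset.mem_range.2 hk)
      simp only [κ]
      rw [inv_mul_le_iff₀ (by positivity)]
      rw [div_le_iff₀ (hβ _)] at h1
      have h2 := hβ (k + M * q)
      linarith
    have hκ1 : κ ≤ 1 := inv_le_one_of_one_le₀ (by linarith)
    refine lt_of_tendsto_iInf hs (κ := κ / 2 ^ M) (by positivity) hq hr₂ ?_
    filter_upwards [eventually_ge_atTop M] with j hj k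
    have h1 : κ / 2 ^ M * 2 ^ j * β k ≤ β (k + j * q) := by
      by_cases hk : k < M
      · obtain ⟨l, rfl⟩ := Nat.exists_eq_add_of_le hj
        have hMq : M ≤ M * q := Nat.le_mul_of_pos_right _ hq
        have h2 := hgrow l (k + M * q) (by omega)
        have h3 := mul_le_mul_of_nonneg_left (hκle k hk) (show (0 : ℝ) ≤ 2 ^ l by positivity)
        rw [show k + M * q + l * q = k + (M + l) * q by ring] at h2
        have h4 : κ / 2 ^ M * 2 ^ (M + l) * β k = 2 ^ l * (κ * β k) := by
          rw [pow_add]; field_simp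
        rw [h4]
        exact h3.trans h2
      · refine le_trans ?_ (hgrow j k (not_lt.1 hk))
        have h2 : κ / 2 ^ M ≤ 1 := by
          rw [div_le_one (by positivity)]
          exact hκ1.trans (one_le_pow₀ (by norm_num))
        have h3 : 0 < 2 ^ j * β k := mul_pos (by positivity) (hβ k)
        nlinarith
    rw [hβadd, mul_comm (β k)] at h1
    have h2 := le_of_mul_le_mul_right h1 (hβ k)
    rw [le_div_iff₀ (by positivity)] at h2
    calc κ / 2 ^ M * (2 * s ^ q) ^ j = κ / 2 ^ M * 2 ^ j * s ^ (j * q) := by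
          rw [mul_pow, ← pow_mul, mul_comm q j]; ring
      _ ≤ _ := h2
  · left
    refine lt_of_tendsto_iSup hw hs hq hr₁ fun m => ?_
    have h1 := hdec m
    rw [hβadd, mul_comm (β m), ← mul_assoc] at h1
    have h2 : 2 * (wprod w m q / s ^ q) ≤ 1 := by
      refine le_of_mul_le_mul_right ?_ (hβ m)
      rwa [one_mul]
    rw [← mul_div_assoc, div_le_one (by positivity)] at h2
    exact h2

end WeightProducts
end JClassOp
end

noncomputable section
namespace JClassOp

/-! ### Gelfand's formula for real growth rates. -/

section Gelfand

theorem spectralRadius_ne_top {E : Type*} [NormedAddCommGroup E] [NormedSpace ℂ E]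
    [CompleteSpace E] (T : E →L[ℂ] E) : spectralRadius ℂ T ≠ ⊤ := by
  refine ne_top_of_le_ne_top ENNReal.ofReal_ne_top
    (iSup₂_le (a := ENNReal.ofReal (‖T‖ * ‖(1 : E →L[ℂ] E)‖)) fun k hk => ?_)
  rw [← ENNReal.ofReal_coe_nnreal]
  exact ENNReal.ofReal_le_ofReal (spectrum.norm_le_norm_mul_of_mem hk)

/-- Gelfand's formula for the real number `r(T)`. -/
theorem tendsto_norm_pow_rpow {E : Type*} [NormedAddCommGroup E] [NormedSpace ℂ E]
    [CompleteSpace E] (T : E →L[ℂ] E) :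
    Tendsto (fun n : ℕ => ‖T ^ n‖ ^ (1 / (n : ℝ))) atTop (𝓝 (spectralRadius ℂ T).toReal) := by
  have h := (ENNReal.tendsto_toReal (spectralRadius_ne_top T)).comp
    (spectrum.pow_norm_pow_one_div_tendsto_nhds_spectralRadius T)
  refine h.congr fun n => ?_
  exact ENNReal.toReal_ofReal (by positivity)

/-- The hypotheses describe `M` as the least upper bound of `a`, the form in which the operator norm
of a power of a shift is known. -/
theorem iSup_rpow_eq {a : ℕ → ℝ} (ha : ∀ k, 0 ≤ a k) {M : ℝ} (hM : ∀ k, a k ≤ M)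
    (hM' : ∀ C, (∀ k, a k ≤ C) → M ≤ C) {e : ℝ} (he : 0 < e) : ⨆ k, a k ^ e = M ^ e := by
  have hM0 : 0 ≤ M := (ha 0).trans (hM 0)
  have hle : ∀ k, a k ^ e ≤ M ^ e := fun k => Real.rpow_le_rpow (ha k) (hM k) he.le
  refine le_antisymm (ciSup_le hle) ?_
  have hS : ∀ k, a k ^ e ≤ ⨆ k, a k ^ e :=
    fun k => le_ciSup (f := fun k => a k ^ e) ⟨M ^ e, by rintro _ ⟨k, rfl⟩; exact hle k⟩ k
  have hS0 : 0 ≤ ⨆ k, a k ^ e := (Real.rpow_nonneg (ha 0) e).trans (hS 0)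
  have h1 : M ≤ (⨆ k, a k ^ e) ^ e⁻¹ :=
    hM' _ fun k => (Real.le_rpow_inv_iff_of_pos (ha k) hS0 he).2 (hS k)
  exact (Real.le_rpow_inv_iff_of_pos hM0 hS0 he).1 h1

theorem iInf_rpow_eq {a : ℕ → ℝ} (ha : ∀ k, 0 < a k) {M : ℝ} (hM : ∀ k, (a k)⁻¹ ≤ M)
    (hM' : ∀ C, (∀ k, (a k)⁻¹ ≤ C) → M ≤ C) {e : ℝ} (he : 0 < e) :
    ⨅ k, a k ^ e = (M ^ e)⁻¹ := by
  have hM0 : 0 < M := (inv_pos.2 (ha 0)).trans_le (hM 0)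
  have hMe : 0 < M ^ e := Real.rpow_pos_of_pos hM0 e
  have hbdd : BddBelow (Set.range fun k => a k ^ e) :=
    ⟨0, by rintro _ ⟨k, rfl⟩; exact Real.rpow_nonneg (ha k).le e⟩
  refine le_antisymm ?_ (le_ciInf fun k => ?_)
  · have hS : ∀ k, ⨅ k, a k ^ e ≤ a k ^ e := fun k => ciInf_le hbdd k
    by_cases hS0 : 0 < ⨅ k, a k ^ e
    · have h1 : M ≤ ((⨅ k, a k ^ e) ^ e⁻¹)⁻¹ := hM' _ fun k => by
        refine inv_anti₀ (Real.rpow_pos_of_pos hS0 _) ?_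
        exact (Real.rpow_inv_le_iff_of_pos hS0.le (ha k).le he).2 (hS k)
      rw [← Real.inv_rpow hS0.le, Real.le_rpow_inv_iff_of_pos hM0.le (inv_pos.2 hS0).le he] at h1
      exact (le_inv_comm₀ hMe hS0).1 h1
    · exact (not_lt.1 hS0).trans (inv_pos.2 hMe).le
  · rw [← Real.inv_rpow hM0.le]
    exact Real.rpow_le_rpow (inv_pos.2 hM0).le (inv_le_of_inv_le₀ (ha k) (hM k)) he.le

end Gelfand

/-! ### Weighted shifts, their powers and right inverses. -/

section Shifts

variable {w : ℕ → ℝ} (hw : ∃ C, ∀ n, |w n| ≤ C)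

/-- The sequence `(0, w_0 x_0, w_1 x_1, …)`. -/
def shiftSeq (w : ℕ → ℝ) (x : ℕ → ℂ) : ℕ → ℂ
  | 0 => 0
  | n + 1 => w n * x n

theorem norm_shiftSeq_succ_le {C : ℝ} (hC : ∀ n, |w n| ≤ C) (x : ℕ → ℂ) (n : ℕ) :
    ‖shiftSeq w x (n + 1)‖ ≤ C * ‖x n‖ := by
  rw [shiftSeq, norm_mul, Complex.norm_real]
  gcongr
  exact hC n

theorem shiftSeq_add (x y : ℕ → ℂ) : shiftSeq w (x + y) = shiftSeq w x + shiftSeq w y := by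
  ext n
  cases n with
  | zero => simp [shiftSeq]
  | succ n => simp [shiftSeq, mul_add]

theorem shiftSeq_smul (c : ℂ) (x : ℕ → ℂ) : shiftSeq w (c • x) = c • shiftSeq w x := by
  ext n
  cases n with
  | zero => simp [shiftSeq]
  | succ n => simp [shiftSeq, mul_left_comm]

theorem summable_norm_L1 (x : L1) : Summable fun n => ‖x n‖ := by
  simpa using (lp.memℓp x).summable (by norm_num)

theorem norm_L1_eq (x : L1) : ‖x‖ = ∑' n, ‖x n‖ := by
  simpa using lp.norm_eq_tsum_rpow (p := 1) (by norm_num) x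

theorem summable_norm_shiftSeq {C : ℝ} (hC : ∀ n, |w n| ≤ C) (x : L1) :
    Summable fun n => ‖shiftSeq w x n‖ :=
  (summable_nat_add_iff 1).1 (Summable.of_nonneg_of_le (fun _ => norm_nonneg _)
    (norm_shiftSeq_succ_le hC x) ((summable_norm_L1 x).mul_left C))

/-- The weighted forward shift on `l^1`. -/
def forwardShift (w : ℕ → ℝ) (hw : ∃ C, ∀ n, |w n| ≤ C) : L1 →L[ℂ] L1 :=
  LinearMap.mkContinuous
    { toFun := fun x => ⟨shiftSeq w x, memℓp_gen (by
        simpa using summable_norm_shiftSeq hw.choose_spec x)⟩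
      map_add' := fun x y => by ext n; exact congrFun (shiftSeq_add x y) n
      map_smul' := fun c x => by ext n; exact congrFun (shiftSeq_smul c x) n }
    hw.choose
    (fun x => by
      have hs := summable_norm_shiftSeq hw.choose_spec x
      rw [norm_L1_eq, norm_L1_eq, ← tsum_mul_left]
      refine (hs.tsum_eq_zero_add).trans_le ?_
      have h0 : ‖shiftSeq w x 0‖ = 0 := by simp [shiftSeq]
      rw [h0, zero_add]
      exact Summable.tsum_le_tsum (norm_shiftSeq_succ_le hw.choose_spec x)
        ((summable_nat_add_iff 1).2 hs) ((summable_norm_L1 x).mul_left _))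

theorem forwardShift_apply (x : L1) (n : ℕ) : forwardShift w hw x n = shiftSeq w x n := rfl

theorem forwardShift_single (n : ℕ) :
    forwardShift w hw (lp.single 1 n (1 : ℂ)) = (w n : ℂ) • lp.single 1 (n + 1) (1 : ℂ) := by
  ext m
  rw [forwardShift_apply, lp.coeFn_smul, Pi.smul_apply]
  cases m with
  | zero => rw [lp.single_apply_ne _ _ _ (by omega)]; simp [shiftSeq]
  | succ m =>
    rw [shiftSeq]
    by_cases h : m = n
    · subst h; rw [lp.single_apply_self, lp.single_apply_self, smul_eq_mul]
    · rw [lp.single_apply_ne _ _ _ h, lp.single_apply_ne _ _ _ (by omega)]; simp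

/-- This places the backward shift in the first case of the theorem, with weakly compact part zero.
-/
theorem backwardShift_eq_adj : backwardShift w hw = adj (forwardShift w hw) := by
  ext y n
  rw [backwardShift_apply, adj_apply_coord, forwardShift_single, map_smul, toDual_single,
    smul_eq_mul]

theorem backwardShift_pow_apply (n : ℕ) (x : Linf) (k : ℕ) :
    (backwardShift w hw ^ n) x k = (wprod w k n : ℂ) * x (k + n) := by
  induction n generalizing x with
  | zero => simp [wprod]
  | succ n ih =>
    rw [pow_succ, mul_apply_eq_comp, ih, backwardShift_apply, wprod_succ]
    push_cast
    rw [mul_assoc, add_assoc]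

/-- The constant sequence `1`. -/
def constOne : Linf := linfMk (fun _ => 1) ⟨1, fun _ => by simp⟩

theorem constOne_apply (n : ℕ) : constOne n = 1 := rfl

theorem norm_constOne_le : ‖constOne‖ ≤ 1 :=
  lp.norm_le_of_forall_le zero_le_one fun n => by rw [constOne_apply, norm_one]

theorem wprod_le_norm_backwardShift_pow (hpos : ∀ n, 0 < w n) (n k : ℕ) :
    wprod w k n ≤ ‖backwardShift w hw ^ n‖ := by
  have h1 := (norm_coord_le ((backwardShift w hw ^ n) constOne) k).trans
    ((backwardShift w hw ^ n).le_opNorm_of_le norm_constOne_le)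
  rwa [backwardShift_pow_apply, constOne_apply, mul_one, mul_one, Complex.norm_real,
    Real.norm_of_nonneg (wprod_pos hpos k n).le] at h1

theorem norm_backwardShift_pow_le (hpos : ∀ n, 0 < w n) (n : ℕ) {C : ℝ}
    (hC : ∀ k, wprod w k n ≤ C) : ‖backwardShift w hw ^ n‖ ≤ C := by
  have hC0 : 0 ≤ C := (wprod_pos hpos 0 n).le.trans (hC 0)
  refine ContinuousLinearMap.opNorm_le_bound _ hC0 fun x =>
    lp.norm_le_of_forall_le (by positivity) fun k => ?_
  rw [backwardShift_pow_apply, norm_mul, Complex.norm_real,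
    Real.norm_of_nonneg (wprod_pos hpos k n).le]
  exact mul_le_mul (hC k) (norm_coord_le x _) (norm_nonneg _) hC0

/-- The constant sequence shows that `‖B_w^n‖` is the supremum of the products of `n` consecutive
weights, so Gelfand's formula identifies `r₁` with the spectral radius. -/
theorem tendsto_iSup_wprod (hpos : ∀ n, 0 < w n) :
    Tendsto (fun n : ℕ => ⨆ k : ℕ, wprod w k n ^ (1 / (n : ℝ))) atTop
      (𝓝 (spectralRadius ℂ (backwardShift w hw)).toReal) := by
  refine (tendsto_norm_pow_rpow (backwardShift w hw)).congr' ?_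
  filter_upwards [eventually_ge_atTop 1] with n hn
  have hn0 : (0 : ℝ) < n := by exact_mod_cast hn
  exact (iSup_rpow_eq (fun k => (wprod_pos hpos k n).le)
    (wprod_le_norm_backwardShift_pow hw hpos n)
    (fun C hC => norm_backwardShift_pow_le hw hpos n hC) (by positivity)).symm

theorem exists_bound_inv {c : ℝ} (hc : 0 < c) (hwc : ∀ n, c ≤ w n) :
    ∃ C, ∀ n, |(w n)⁻¹| ≤ C :=
  ⟨c⁻¹, fun n => by
    rw [abs_of_nonneg (inv_nonneg.2 (hc.le.trans (hwc n)))]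
    exact inv_anti₀ hc (hwc n)⟩

/-- The weighted forward shift on `l^∞`. -/
def forwardShiftInf (v : ℕ → ℝ) (hv : ∃ C, ∀ n, |v n| ≤ C) : Linf →L[ℂ] Linf :=
  have key : ∀ (C : ℝ), (∀ n, |v n| ≤ C) → ∀ (x : Linf) (n : ℕ),
      ‖shiftSeq v x n‖ ≤ C * ‖x‖ := fun C hC x n => by
    have hC0 : 0 ≤ C := (abs_nonneg _).trans (hC 0)
    cases n with
    | zero => rw [shiftSeq, norm_zero]; positivity
    | succ n =>
      refine (norm_shiftSeq_succ_le hC x n).trans ?_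
      gcongr
      exact norm_coord_le x n
  LinearMap.mkContinuous
    { toFun := fun x => linfMk (shiftSeq v x) ⟨_, key _ hv.choose_spec x⟩
      map_add' := fun x y => by ext n; exact congrFun (shiftSeq_add x y) n
      map_smul' := fun c x => by ext n; exact congrFun (shiftSeq_smul c x) n }
    hv.choose
    (fun x => lp.norm_le_of_forall_le
      (mul_nonneg ((abs_nonneg _).trans (hv.choose_spec 0)) (norm_nonneg _))
      (key _ hv.choose_spec x))

theorem forwardShiftInf_apply (v : ℕ → ℝ) (hv : ∃ C, ∀ n, |v n| ≤ C) (x : Linf) (n : ℕ) :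
    forwardShiftInf v hv x n = shiftSeq v x n := rfl

theorem forwardShiftInf_pow_apply_add (v : ℕ → ℝ) (hv : ∃ C, ∀ n, |v n| ≤ C) (n : ℕ) (x : Linf)
    (k : ℕ) : (forwardShiftInf v hv ^ n) x (k + n) = (wprod v k n : ℂ) * x k := by
  induction n with
  | zero => simp [wprod]
  | succ n ih =>
    rw [pow_succ', mul_apply_eq_comp, forwardShiftInf_apply, ← add_assoc, shiftSeq, ih, wprod_succ]
    push_cast
    ring

theorem forwardShiftInf_pow_apply_of_lt (v : ℕ → ℝ) (hv : ∃ C, ∀ n, |v n| ≤ C) (n : ℕ) (x : Linf)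
    {k : ℕ} (hk : k < n) : (forwardShiftInf v hv ^ n) x k = 0 := by
  induction n generalizing k with
  | zero => omega
  | succ n ih =>
    rw [pow_succ', mul_apply_eq_comp, forwardShiftInf_apply]
    cases k with
    | zero => rfl
    | succ k => rw [shiftSeq, ih (by omega), mul_zero]

theorem wprod_le_norm_forwardShiftInf_pow {v : ℕ → ℝ} (hv : ∃ C, ∀ n, |v n| ≤ C)
    (hpos : ∀ n, 0 < v n) (n k : ℕ) : wprod v k n ≤ ‖forwardShiftInf v hv ^ n‖ := by
  have h1 := (norm_coord_le ((forwardShiftInf v hv ^ n) constOne) (k + n)).trans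
    ((forwardShiftInf v hv ^ n).le_opNorm_of_le norm_constOne_le)
  rwa [forwardShiftInf_pow_apply_add, constOne_apply, mul_one, mul_one, Complex.norm_real,
    Real.norm_of_nonneg (wprod_pos hpos k n).le] at h1

theorem norm_forwardShiftInf_pow_le {v : ℕ → ℝ} (hv : ∃ C, ∀ n, |v n| ≤ C)
    (hpos : ∀ n, 0 < v n) (n : ℕ) {C : ℝ} (hC : ∀ k, wprod v k n ≤ C) :
    ‖forwardShiftInf v hv ^ n‖ ≤ C := by
  have hC0 : 0 ≤ C := (wprod_pos hpos 0 n).le.trans (hC 0)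
  refine ContinuousLinearMap.opNorm_le_bound _ hC0 fun x =>
    lp.norm_le_of_forall_le (by positivity) fun k => ?_
  by_cases hk : k < n
  · rw [forwardShiftInf_pow_apply_of_lt v hv n x hk, norm_zero]; positivity
  · obtain ⟨l, rfl⟩ : ∃ l, k = l + n := ⟨k - n, by omega⟩
    rw [forwardShiftInf_pow_apply_add, norm_mul, Complex.norm_real,
      Real.norm_of_nonneg (wprod_pos hpos l n).le]
    exact mul_le_mul (hC l) (norm_coord_le x _) (norm_nonneg _) hC0

theorem wprod_inv (w : ℕ → ℝ) (k n : ℕ) : wprod (fun i => (w i)⁻¹) k n = (wprod w k n)⁻¹ := by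
  simp only [wprod, Finset.prod_inv_distrib]

theorem backwardShift_mul_forwardShiftInf (hpos : ∀ n, 0 < w n)
    (hv : ∃ C, ∀ n, |(w n)⁻¹| ≤ C) :
    backwardShift w hw * forwardShiftInf (fun n => (w n)⁻¹) hv = 1 := by
  ext x n
  rw [mul_apply_eq_comp, backwardShift_apply, forwardShiftInf_apply, shiftSeq, one_apply_eq_self,
    ← mul_assoc, ← Complex.ofReal_mul, mul_inv_cancel₀ (hpos n).ne', Complex.ofReal_one, one_mul]

theorem not_isUnit_backwardShift : ¬ IsUnit (backwardShift w hw) := by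
  intro h
  have h1 := (ContinuousLinearMap.isUnit_iff_bijective.1 h).1
  obtain ⟨e, he⟩ : ∃ e : Linf, ∀ n, e n = if n = 0 then 1 else 0 :=
    ⟨linfMk (fun n => if n = 0 then 1 else 0) ⟨1, fun n => by split_ifs <;> simp⟩, fun _ => rfl⟩
  have h2 : backwardShift w hw e = 0 := by
    ext n
    rw [backwardShift_apply, he, if_neg (Nat.succ_ne_zero n), mul_zero]
    rfl
  have h3 : e = 0 := h1 (h2.trans (map_zero _).symm)
  have h4 : e 0 = 1 := by rw [he, if_pos rfl]
  rw [h3] at h4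
  exact zero_ne_one h4

theorem boundedBelow_dualOp_of_mul_eq_one {E : Type*} [NormedAddCommGroup E] [NormedSpace ℂ E]
    {A G : E →L[ℂ] E} (h : A * G = 1) : BoundedBelow (dualOp A) := by
  refine ⟨(‖G‖ + 1)⁻¹, by positivity, fun φ => ?_⟩
  rw [inv_mul_le_iff₀ (by positivity)]
  have h1 : φ = (dualOp A φ) ∘L G := by
    ext x
    change φ x = φ ((A * G) x)
    rw [h, one_apply_eq_self]
  calc ‖φ‖ = ‖(dualOp A φ) ∘L G‖ := by rw [← h1]
    _ ≤ ‖dualOp A φ‖ * ‖G‖ := ContinuousLinearMap.opNorm_comp_le _ _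
    _ ≤ (‖G‖ + 1) * ‖dualOp A φ‖ := by
      rw [mul_comm]; gcongr; linarith

/-- If `A F = 1` and `|z| r(F) < 1`, then `A - z` has a right inverse and is not invertible unless
`A` is. -/
theorem boundedBelow_dualOp_sub_of_right_inverse {E : Type*} [NormedAddCommGroup E]
    [NormedSpace ℂ E] [CompleteSpace E] {A F : E →L[ℂ] E} (h : A * F = 1) {z : ℂ}
    (hz : ‖z‖ * (spectralRadius ℂ F).toReal < 1) :
    BoundedBelow (dualOp (A - z • (1 : E →L[ℂ] E))) ∧
      (IsUnit (A - z • (1 : E →L[ℂ] E)) → IsUnit A) := by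
  have hu : IsUnit (1 - z • F) := by
    by_cases hz0 : z = 0
    · simp [hz0]
    have hz' : 0 < ‖z‖ := norm_pos_iff.2 hz0
    have h1 : z⁻¹ ∉ spectrum ℂ F := fun hmem => by
      have h2 : (‖z⁻¹‖₊ : ℝ≥0∞) ≤ spectralRadius ℂ F :=
        le_iSup₂ (f := fun (k : ℂ) (_ : k ∈ spectrum ℂ F) => (‖k‖₊ : ℝ≥0∞)) z⁻¹ hmem
      have h3 := ENNReal.toReal_mono (spectralRadius_ne_top F) h2
      rw [ENNReal.coe_toReal, coe_nnnorm, norm_inv] at h3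
      have h4 := mul_le_mul_of_nonneg_left h3 hz'.le
      rw [mul_inv_cancel₀ hz'.ne'] at h4
      linarith
    rw [spectrum.notMem_iff, Algebra.algebraMap_eq_smul_one] at h1
    have h2 : 1 - z • F = z • (z⁻¹ • (1 : E →L[ℂ] E) - F) := by
      rw [smul_sub, smul_smul, mul_inv_cancel₀ hz0, one_smul]
    rw [h2]
    exact h1.smul (Units.mk0 z hz0)
  have hfac : A - z • (1 : E →L[ℂ] E) = A * (1 - z • F) := by
    rw [mul_sub, mul_one, mul_smul_comm, h]
  obtain ⟨u, hu⟩ := hu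
  constructor
  · refine boundedBelow_dualOp_of_mul_eq_one (G := (↑u⁻¹ : E →L[ℂ] E) * F) ?_
    rw [hfac, ← hu, ← mul_assoc, mul_assoc A, Units.mul_inv, mul_one, h]
  · intro h1
    rw [hfac, ← hu] at h1
    exact (Units.isUnit_mul_units A u).1 h1

/-- The lower growth rate of the weights exists, and it bounds the disc in which `B_w - z` is onto
but not invertible. -/
theorem exists_tendsto_iInf_wprod (hpos : ∀ n, 0 < w n) :
    ∃ r : ℝ, Tendsto (fun n : ℕ => ⨅ k : ℕ, wprod w k n ^ (1 / (n : ℝ))) atTop (𝓝 r) ∧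
      ∀ z : ℂ, ‖z‖ < r → BoundedBelow (dualOp (backwardShift w hw - z • (1 : Linf →L[ℂ] Linf))) ∧
        ¬ IsUnit (backwardShift w hw - z • (1 : Linf →L[ℂ] Linf)) := by
  -- For weights bounded away from zero, the forward shift `F` with reciprocal weights is a right
  -- inverse and the rate is `1 / r(F)`. Otherwise every infimum with `n ≥ 1` is zero and the disc
  -- is empty.
  by_cases hinf : ∃ c > 0, ∀ n, c ≤ w n
  · obtain ⟨c, hc, hwc⟩ := hinf
    have hv := exists_bound_inv hc hwc
    let F := forwardShiftInf (fun n => (w n)⁻¹) hv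
    have hBF : backwardShift w hw * F = 1 := backwardShift_mul_forwardShiftInf hw hpos hv
    have hvpos : ∀ n, 0 < (w n)⁻¹ := fun n => inv_pos.2 (hpos n)
    obtain ⟨C, hC⟩ := hw
    have hC0 : 0 < C := (hpos 0).trans_le ((le_abs_self _).trans (hC 0))
    have hlim := tendsto_norm_pow_rpow F
    -- The upper bound `C` for the weights gives `‖F^n‖ ≥ C^{-n}`; positivity is needed to pass to
    -- the reciprocal limit.
    have hr0 : 0 < (spectralRadius ℂ F).toReal := by
      refine lt_of_lt_of_le (inv_pos.2 hC0) (ge_of_tendsto hlim ?_)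
      filter_upwards [eventually_ge_atTop 1] with n hn
      have hn0 : (n : ℝ) ≠ 0 := by exact_mod_cast (by omega : n ≠ 0)
      have h1 := wprod_le_norm_forwardShiftInf_pow hv hvpos n 0
      have h2 : (C⁻¹) ^ n ≤ wprod (fun i => (w i)⁻¹) 0 n := by
        rw [wprod, ← Finset.card_range n, ← Finset.prod_const, Finset.card_range]
        refine Finset.prod_le_prod (fun _ _ => (inv_pos.2 hC0).le) fun i _ => ?_
        exact inv_anti₀ (hpos _) ((le_abs_self _).trans (hC _))
      calc C⁻¹ = ((C⁻¹) ^ n) ^ (1 / (n : ℝ)) := by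
            rw [one_div, Real.pow_rpow_inv_natCast (inv_pos.2 hC0).le (by omega)]
        _ ≤ _ := Real.rpow_le_rpow (by positivity) (h2.trans h1) (by positivity)
    refine ⟨(spectralRadius ℂ F).toReal⁻¹, ?_, fun z hz => ?_⟩
    · refine (hlim.inv₀ hr0.ne').congr' ?_
      filter_upwards [eventually_ge_atTop 1] with n hn
      have hn0 : (0 : ℝ) < n := by exact_mod_cast hn
      refine (iInf_rpow_eq (fun k => wprod_pos hpos k n) (fun k => ?_) (fun D hD => ?_)
        (by positivity)).symm
      · rw [← wprod_inv]
        exact wprod_le_norm_forwardShiftInf_pow hv hvpos n k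
      · refine norm_forwardShiftInf_pow_le hv hvpos n fun k => ?_
        rw [wprod_inv]
        exact hD k
    · have h1 : ‖z‖ * (spectralRadius ℂ F).toReal < 1 := by
        rwa [← lt_inv_mul_iff₀' hr0, mul_one]
      obtain ⟨h2, h3⟩ := boundedBelow_dualOp_sub_of_right_inverse hBF h1
      exact ⟨h2, fun h => not_isUnit_backwardShift _ (h3 h)⟩
  · push Not at hinf
    refine ⟨0, ?_, fun z hz => absurd (norm_nonneg z) (not_le.2 hz)⟩
    refine tendsto_const_nhds.congr' ?_
    filter_upwards [eventually_ge_atTop 1] with n hn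
    have hn0 : (0 : ℝ) < n := by exact_mod_cast hn
    obtain ⟨C, hC⟩ := hw
    have hC0 : 0 < C := (hpos 0).trans_le ((le_abs_self _).trans (hC 0))
    have hbdd : BddBelow (Set.range fun k => wprod w k n ^ (1 / (n : ℝ))) :=
      ⟨0, by rintro _ ⟨k, rfl⟩; exact Real.rpow_nonneg (wprod_pos hpos k n).le _⟩
    refine le_antisymm (le_ciInf fun k => Real.rpow_nonneg (wprod_pos hpos k n).le _)
      (le_of_forall_pos_le_add fun ε hε => ?_)
    rw [zero_add]
    obtain ⟨m, rfl⟩ : ∃ m, n = m + 1 := ⟨n - 1, by omega⟩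
    -- One weight this small outweighs the remaining `m` factors, each at most `C`.
    obtain ⟨k, hk⟩ := hinf (ε ^ (m + 1) / C ^ m) (by positivity)
    refine (ciInf_le hbdd k).trans ?_
    have h1 : wprod w (k + 1) m ≤ C ^ m := by
      rw [wprod, ← Finset.card_range m, ← Finset.prod_const, Finset.card_range]
      exact Finset.prod_le_prod (fun _ _ => (hpos _).le) fun i _ =>
        (le_abs_self _).trans (hC _)
    have h2 : wprod w k (m + 1) ≤ ε ^ (m + 1) := by
      rw [add_comm m 1, wprod_add, wprod_one, add_comm 1 m]
      refine (mul_le_mul hk.le h1 (wprod_pos hpos _ _).le (by positivity)).trans_eq ?_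
      field_simp
    calc wprod w k (m + 1) ^ (1 / ((m + 1 : ℕ) : ℝ))
        ≤ (ε ^ (m + 1)) ^ (1 / ((m + 1 : ℕ) : ℝ)) :=
          Real.rpow_le_rpow (wprod_pos hpos _ _).le h2 (by positivity)
      _ = ε := by rw [one_div, Real.pow_rpow_inv_natCast hε.le (by omega)]

end Shifts
end JClassOp
end

noncomputable section
namespace JClassOp

/-! ### The spectral annulus of a weighted backward shift. -/

section Annulus

variable {w : ℕ → ℝ} (hw : ∃ C, ∀ n, |w n| ≤ C)

theorem norm_coordFunctional_le (j : ℕ) : ‖coordFunctional j‖ ≤ 1 :=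
  ContinuousLinearMap.opNorm_le_bound _ zero_le_one fun y => by
    rw [coordFunctional_apply, one_mul]
    exact norm_coord_le y j

theorem one_le_norm_coordFunctional (j : ℕ) : 1 ≤ ‖coordFunctional j‖ := by
  have h := (coordFunctional j).le_opNorm_of_le norm_constOne_le
  rwa [coordFunctional_apply, constOne_apply, norm_one, mul_one] at h

theorem dualOp_backwardShift_coordFunctional (k : ℕ) :
    dualOp (backwardShift w hw) (coordFunctional k) = (w k : ℂ) • coordFunctional (k + 1) := by
  ext x
  change coordFunctional k (backwardShift w hw x) = (w k : ℂ) * coordFunctional (k + 1) x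
  rw [coordFunctional_apply, coordFunctional_apply, backwardShift_apply]

/-- Testing on coordinate functionals bounds all weights below by `c`. This covers `z = 0`, where
the orbit functionals, which contain powers of `z⁻¹`, are of no use. -/
theorem pos_of_boundedBelow_dualOp_backwardShift (hpos : ∀ n, 0 < w n) {r : ℝ}
    (hr : Tendsto (fun n : ℕ => ⨅ k : ℕ, wprod w k n ^ (1 / (n : ℝ))) atTop (𝓝 r))
    (h : BoundedBelow (dualOp (backwardShift w hw))) : 0 < r := by
  obtain ⟨c, hc, hb⟩ := h
  have hcw : ∀ k, c ≤ w k := fun k => by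
    have h1 := hb (coordFunctional k)
    rw [dualOp_backwardShift_coordFunctional, norm_smul, Complex.norm_real,
      Real.norm_of_nonneg (hpos k).le] at h1
    calc c ≤ c * ‖coordFunctional k‖ := le_mul_of_one_le_right hc.le (one_le_norm_coordFunctional k)
      _ ≤ w k * ‖coordFunctional (k + 1)‖ := h1
      _ ≤ w k := mul_le_of_le_one_right (hpos k).le (norm_coordFunctional_le _)
  refine hc.trans_le (ge_of_tendsto hr ?_)
  filter_upwards [eventually_ge_atTop 1] with n hn
  refine le_ciInf fun k => ?_
  have h1 : c ^ n ≤ wprod w k n := by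
    rw [wprod, ← Finset.card_range n, ← Finset.prod_const, Finset.card_range]
    exact Finset.prod_le_prod (fun _ _ => hc.le) fun i _ => hcw _
  calc c = (c ^ n) ^ (1 / (n : ℝ)) := by rw [one_div, Real.pow_rpow_inv_natCast hc.le (by omega)]
    _ ≤ _ := Real.rpow_le_rpow (by positivity) h1 (by positivity)

/-- The functional `∑_{i < n} z^{-i} w_m ⋯ w_{m+i-1} e_{m+i}`. -/
def orbitFunctional (w : ℕ → ℝ) (z : ℂ) (m n : ℕ) : StrongDual ℂ Linf :=
  ∑ i ∈ Finset.range n, ((z ^ i)⁻¹ * (wprod w m i : ℂ)) • coordFunctional (m + i)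

/-- The sum is a truncated formal eigenfunctional of `B_w*`: consecutive terms cancel and only the
two ends survive. -/
theorem dualOp_orbitFunctional {z : ℂ} (hz : z ≠ 0) (m n : ℕ) :
    dualOp (backwardShift w hw - z • (1 : Linf →L[ℂ] Linf)) (orbitFunctional w z m n) =
      (z * ((z ^ n)⁻¹ * (wprod w m n : ℂ))) • coordFunctional (m + n) -
        z • coordFunctional m := by
  induction n with
  | zero => simp [orbitFunctional, wprod]
  | succ n ih =>
    have h1 : orbitFunctional w z m (n + 1) = orbitFunctional w z m n +
        ((z ^ n)⁻¹ * (wprod w m n : ℂ)) • coordFunctional (m + n) := Finset.sum_range_succ _ _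
    have h2 : z * ((z ^ (n + 1))⁻¹ * (wprod w m (n + 1) : ℂ)) =
        (z ^ n)⁻¹ * (wprod w m n : ℂ) * (w (m + n) : ℂ) := by
      rw [wprod_succ]
      push_cast
      field_simp
      ring
    have h3 : dualOp (backwardShift w hw - z • (1 : Linf →L[ℂ] Linf)) (coordFunctional (m + n)) =
        (w (m + n) : ℂ) • coordFunctional (m + n + 1) - z • coordFunctional (m + n) := by
      rw [dualOp_sub_smul, ← dualOp_backwardShift_coordFunctional hw]
      rfl
    rw [h1, map_add, ih, map_smul, h3, h2, smul_sub, smul_smul, smul_smul, mul_comm _ z, add_assoc]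
    abel

theorem sum_le_norm_orbitFunctional (hpos : ∀ n, 0 < w n) {z : ℂ} (hz : z ≠ 0) (m n : ℕ) :
    ∑ i ∈ Finset.range n, wprod w m i / ‖z‖ ^ i ≤ ‖orbitFunctional w z m n‖ := by
  have hs : (‖z‖ : ℂ) ≠ 0 := by exact_mod_cast norm_ne_zero_iff.2 hz
  have hu : ‖z / ‖z‖‖ = 1 := by
    rw [norm_div, Complex.norm_real, norm_norm, div_self (norm_ne_zero_iff.2 hz)]
  -- The unimodular entries cancel the arguments of `z^{-i}`, so all terms add up as positive
  -- numbers. Entries with `k < m` are irrelevant.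
  obtain ⟨x, hx⟩ : ∃ x : Linf, ∀ k, x k = (z / ‖z‖) ^ (k - m) :=
    ⟨linfMk (fun k => (z / ‖z‖) ^ (k - m)) ⟨1, fun k => by rw [norm_pow, hu, one_pow]⟩,
      fun _ => rfl⟩
  have hx1 : ‖x‖ ≤ 1 := lp.norm_le_of_forall_le zero_le_one fun k => by
    rw [hx, norm_pow, hu, one_pow]
  have h1 : orbitFunctional w z m n x =
      ((∑ i ∈ Finset.range n, wprod w m i / ‖z‖ ^ i : ℝ) : ℂ) := by
    rw [orbitFunctional, _root_.sum_apply, Complex.ofReal_sum]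
    refine Finset.sum_congr rfl fun i _ => ?_
    change (z ^ i)⁻¹ * (wprod w m i : ℂ) * coordFunctional (m + i) x = _
    rw [coordFunctional_apply, hx, Nat.add_sub_cancel_left, div_pow]
    push_cast
    field_simp
  have h2 := (orbitFunctional w z m n).le_opNorm_of_le hx1
  rwa [h1, mul_one, Complex.norm_real, Real.norm_of_nonneg
    (Finset.sum_nonneg fun i _ => div_nonneg (wprod_pos hpos m i).le (by positivity))] at h2

/-- On the closed annulus between the growth rates, `B_w^* - z` is not bounded below. -/
theorem not_boundedBelow_of_mem_annulus (hpos : ∀ n, 0 < w n) {r₁ r₂ : ℝ}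
    (hr₁ : Tendsto (fun n : ℕ => ⨆ k : ℕ, wprod w k n ^ (1 / (n : ℝ))) atTop (𝓝 r₁))
    (hr₂ : Tendsto (fun n : ℕ => ⨅ k : ℕ, wprod w k n ^ (1 / (n : ℝ))) atTop (𝓝 r₂))
    {z : ℂ} (hz₁ : ‖z‖ ≤ r₁) (hz₂ : r₂ ≤ ‖z‖) :
    ¬ BoundedBelow (dualOp (backwardShift w hw - z • (1 : Linf →L[ℂ] Linf))) := by
  intro h
  by_cases hz : z = 0
  · subst hz
    rw [show backwardShift w hw - (0 : ℂ) • (1 : Linf →L[ℂ] Linf) = backwardShift w hw by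
      ext; simp] at h
    rw [norm_zero] at hz₂
    exact (pos_of_boundedBelow_dualOp_backwardShift hw hpos hr₂ h).not_ge hz₂
  have hs : 0 < ‖z‖ := norm_pos_iff.2 hz
  obtain ⟨c, hc, hb⟩ := h
  -- A lower bound `c` applied to the orbit functionals is the block estimate at level `|z|` with
  -- constant `|z| / c`.
  refine (lt_or_lt_of_block_sum_le hpos hs (div_pos hs hc) hr₁ hr₂ fun m n => ?_).elim
    hz₁.not_gt hz₂.not_gt
  have hP := (wprod_pos hpos m n).le
  have h1 : ‖(z * ((z ^ n)⁻¹ * (wprod w m n : ℂ))) • coordFunctional (m + n) -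
      z • coordFunctional m‖ ≤ ‖z‖ * (1 + wprod w m n / ‖z‖ ^ n) := by
    refine (norm_sub_le _ _).trans ?_
    rw [norm_smul, norm_smul, norm_mul, norm_mul, norm_inv, norm_pow, Complex.norm_real,
      Real.norm_of_nonneg hP, mul_add, mul_one, add_comm, div_eq_inv_mul]
    exact add_le_add (mul_le_of_le_one_right (norm_nonneg z) (norm_coordFunctional_le m))
      (mul_le_of_le_one_right (by positivity) (norm_coordFunctional_le _))
  have h2 := (hb (orbitFunctional w z m n)).trans
    ((congrArg norm (dualOp_orbitFunctional hw hz m n)).le.trans h1)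
  have h3 := (mul_le_mul_of_nonneg_left (sum_le_norm_orbitFunctional hpos hz m n) hc.le).trans h2
  rw [div_mul_eq_mul_div, le_div_iff₀ hc, mul_comm]
  exact h3

/-- The approximate point spectrum of `B_w^*` is a closed annulus and the rest of the spectrum is
the open disc inside it. -/
theorem spectral_sets_dualOp_backwardShift (hpos : ∀ n, 0 < w n) {r₂ : ℝ}
    (hr₂ : Tendsto (fun n : ℕ => ⨅ k : ℕ, wprod w k n ^ (1 / (n : ℝ))) atTop (𝓝 r₂))
    (hdisc : ∀ z : ℂ, ‖z‖ < r₂ →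
      BoundedBelow (dualOp (backwardShift w hw - z • (1 : Linf →L[ℂ] Linf))) ∧
        ¬ IsUnit (backwardShift w hw - z • (1 : Linf →L[ℂ] Linf))) :
    approxPointSpectrum (dualOp (backwardShift w hw)) =
        Metric.closedBall 0 (spectralRadius ℂ (backwardShift w hw)).toReal \ Metric.ball 0 r₂ ∧
      spectrum ℂ (dualOp (backwardShift w hw)) \
        approxPointSpectrum (dualOp (backwardShift w hw)) = Metric.ball 0 r₂ := by
  have hle : ∀ z ∈ spectrum ℂ (dualOp (backwardShift w hw)),
      ‖z‖ ≤ (spectralRadius ℂ (backwardShift w hw)).toReal := fun z hz => by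
    rw [spectrum_dualOp] at hz
    have h1 : (‖z‖₊ : ℝ≥0∞) ≤ spectralRadius ℂ (backwardShift w hw) :=
      le_iSup₂ (f := fun (k : ℂ) (_ : k ∈ spectrum ℂ (backwardShift w hw)) => (‖k‖₊ : ℝ≥0∞)) z hz
    have h2 := ENNReal.toReal_mono (spectralRadius_ne_top _) h1
    rwa [ENNReal.coe_toReal, coe_nnnorm] at h2
  have hin : ∀ z : ℂ, ‖z‖ < r₂ → z ∉ approxPointSpectrum (dualOp (backwardShift w hw)) :=
    fun z hz h => by
      rw [mem_approxPointSpectrum_iff, ← dualOp_sub_smul] at h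
      exact h (hdisc z hz).1
  have hann : ∀ z : ℂ, ‖z‖ ≤ (spectralRadius ℂ (backwardShift w hw)).toReal → r₂ ≤ ‖z‖ →
      z ∈ approxPointSpectrum (dualOp (backwardShift w hw)) := fun z h1 h2 => by
    rw [mem_approxPointSpectrum_iff, ← dualOp_sub_smul]
    exact not_boundedBelow_of_mem_annulus hw hpos (tendsto_iSup_wprod hw hpos) hr₂ h1 h2
  constructor
  · ext z
    rw [Set.mem_sdiff, mem_closedBall_zero_iff, mem_ball_zero_iff]
    exact ⟨fun h => ⟨hle z (approxPointSpectrum_subset_spectrum _ h), fun h' => hin z h' h⟩,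
      fun h => hann z h.1 (not_lt.1 h.2)⟩
  · ext z
    rw [Set.mem_sdiff, mem_ball_zero_iff]
    refine ⟨fun h => ?_, fun h => ⟨?_, hin z h⟩⟩
    · by_contra h'
      exact h.2 (hann z (hle z h.1) (not_lt.1 h'))
    · rw [spectrum_dualOp, mem_spectrum_iff_sub]
      exact (hdisc z h).2

theorem exists_ball_subset_of_closedBall_subset {r : ℝ} (hr : 0 ≤ r) {U : Set ℂ} (hU : IsOpen U)
    (h : Metric.closedBall 0 r ⊆ U) : ∃ R, r < R ∧ Metric.ball 0 R ⊆ U := by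
  obtain ⟨δ, hδ, hsub⟩ := (isCompact_closedBall (0 : ℂ) r).exists_thickening_subset_open hU h
  rw [thickening_closedBall hδ hr] at hsub
  exact ⟨δ + r, by linarith, hsub⟩

end Annulus
end JClassOp
end

/-! ### Assembly of the two cases. -/

theorem theorem3p10 :
    -- the case of operators `T = S^* + W`
    (∀ (S : JClassOp.L1 →L[ℂ] JClassOp.L1) (W T : JClassOp.Linf →L[ℂ] JClassOp.Linf),
      JClassOp.IsWeaklyCompact W → T = JClassOp.adj S + W →
      ∀ (R : ℝ), max (spectralRadius ℂ T) (spectralRadius ℂ (JClassOp.adj S)) < ENNReal.ofReal R →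
      ∀ (f : ℂ → ℂ), DifferentiableOn ℂ f (Metric.ball 0 R) →
        Summable (JClassOp.calcTerm f T) ∧
        (JClassOp.IsJClass (JClassOp.funcCalc f T) ↔
          f '' JClassOp.approxPointSpectrum (JClassOp.dualOp T) ∩ Metric.closedBall 0 1 = ∅ ∧
          Metric.closedBall 0 1 ⊆
            f '' (spectrum ℂ (JClassOp.dualOp T) \
              JClassOp.approxPointSpectrum (JClassOp.dualOp T)))) ∧
    -- the case of weighted backward shifts
    (∀ (w : ℕ → ℝ) (_ : ∀ n, 0 < w n) (hw : ∃ C, ∀ n, |w n| ≤ C),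
      ∃ r₁ r₂ : ℝ,
        Tendsto (fun n : ℕ => ⨆ k : ℕ, (∏ j ∈ Finset.range n, w (k + j)) ^ (1 / (n : ℝ)))
          atTop (𝓝 r₁) ∧
        Tendsto (fun n : ℕ => ⨅ k : ℕ, (∏ j ∈ Finset.range n, w (k + j)) ^ (1 / (n : ℝ)))
          atTop (𝓝 r₂) ∧
        ∀ (f : ℂ → ℂ) (U : Set ℂ), IsOpen U → Metric.closedBall 0 r₁ ⊆ U →
          DifferentiableOn ℂ f U →
          Summable (JClassOp.calcTerm f (JClassOp.backwardShift w hw)) ∧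
          (JClassOp.IsJClass (JClassOp.funcCalc f (JClassOp.backwardShift w hw)) ↔
            Metric.closedBall 0 1 ∩ f '' (Metric.closedBall 0 r₁ \ Metric.ball 0 r₂) = ∅ ∧
            Metric.closedBall 0 1 ⊆ f '' Metric.ball 0 r₂)) := by
  refine ⟨fun S W T hW hTS R hR f hf => ?_, fun w hpos hw => ?_⟩
  · obtain ⟨hT, hS⟩ := max_lt_iff.1 hR
    exact ⟨(JClassOp.summable_norm_calcTerm hT hf).of_norm,
      JClassOp.isJClass_funcCalc_adj_add_iff hW.isSeqWeaklyCompact hTS hT hS hf⟩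
  · obtain ⟨r₂, hr₂, hdisc⟩ := JClassOp.exists_tendsto_iInf_wprod hw hpos
    refine ⟨(spectralRadius ℂ (JClassOp.backwardShift w hw)).toReal, r₂,
      JClassOp.tendsto_iSup_wprod hw hpos, hr₂, fun f U hU hsub hf => ?_⟩
    obtain ⟨R, hR, hRU⟩ :=
      JClassOp.exists_ball_subset_of_closedBall_subset ENNReal.toReal_nonneg hU hsub
    have hB : spectralRadius ℂ (JClassOp.backwardShift w hw) < ENNReal.ofReal R :=
      (ENNReal.lt_ofReal_iff_toReal_lt (JClassOp.spectralRadius_ne_top _)).2 hR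
    have hf' := hf.mono hRU
    obtain ⟨hσa, hσ⟩ := JClassOp.spectral_sets_dualOp_backwardShift hw hpos hr₂ hdisc
    refine ⟨(JClassOp.summable_norm_calcTerm hB hf').of_norm, ?_⟩
    -- The first case with the forward shift as `S` and zero weakly compact part; the spectral sets
    -- are then replaced by the annulus and the disc.
    rw [JClassOp.isJClass_funcCalc_adj_add_iff (S := JClassOp.forwardShift w hw)
      JClassOp.isSeqWeaklyCompact_zero (by rw [add_zero, JClassOp.backwardShift_eq_adj]) hB
      (by rwa [← JClassOp.backwardShift_eq_adj]) hf', hσ, hσa, Set.inter_comm]
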